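/- Let $1\le n\le m$, let $A=(a_{ij})$ be a unitary $m\times m$ matrix, and let $\Phi_{m,n}$ be the set of non-decreasing arrays $\mathbf z=(z_1,\dots,z_n)$ with entries in $[m]$. The boson sampling distribution is $$q(\mathbf z\mid A)=\frac{1}{\prod_{j=1}^m s_j!}\,\bigl|\operatorname{Per}(a_{z_k,\ell})_{k,\ell\in[n]}\bigr|^2,\qquad \mathbf z\in\Phi_{m,n},$$ where $s_j$ is the multiplicity of $j$ in $\mathbf z$. Consider the following randomised algorithm on a random access machine that performs, at unit cost each, exact arithmetical operations on complex numbers, additions, subtractions and comparisons of integers, memory accesses, and random choices with a prescribed bias. First permute the first $n$ columns of $A$ uniformly at random. Then, for $k=1,\dots,n$, with rows $r_1,\dots,r_{k-1}$ already chosen: compute the permanents $p_1,\dots,p_k$, where $p_\ell$ is the permanent of the $(k-1)\times(k-1)$ matrix formed by the rows $r_1,\dots,r_{k-1}$ of the first $k$ (permuted) columns with column $\ell$ deleted, all of them jointly by Ryser's formula for repeated rows, whose terms are visited in the order of a Guan code (mixed radix reflected Gray code), with forward and backward cumulative products; then choose $r_k=i\in[m]$ with probability proportional to $\bigl|\sum_{\ell=1}^k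 a_{i,\ell}\,p_\ell\bigr|^2$. Finally output $r_1,\dots,r_n$ sorted in non-decreasing order. For every unitary $A$ and all $1\le n\le m$ the output of this algorithm has law $q(\cdot\mid A)$. Let $T(m,n)$ be its expected number of steps, averaged over its random choices and over $A$ drawn from the normalised Haar measure on the unitary group $U(m)$, and put $$b(m,n)=\frac{n(m+n)}{m}\binom{m+n}{n+1}^{-1}\binom{2m+n}{n+1}+n^2m .$$ There is an absolute constant $C$ with $T(m,n)\le C\,b(m,n)$ for all $1\le n\le m$. Moreover, for every fixed real $\theta\ge1$ and $$\rho(\theta)=\frac{(2\theta+1)^{2\theta+1}}{(4\theta)^\theta(\theta+1)^{\theta+1}}$$ there are constants $c_\theta,C_\theta>0$ such that, for all integers $n\ge1$ and $m=\theta n$, $$c_\theta\, n\,\rho(\theta)^n\le b(m,n)\le C_\theta\, n\,\rho(\theta)^n\qquad\text{and}\qquad T(m,n)\le C_\theta\, n\,\rho(\theta)^n .$$ -/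

import Mathlib

open MeasureTheory TopologicalSpace
open scoped ENNReal

noncomputable section

namespace BosonSampling

/-! ### Boson sampling distribution -/

/-- The multiplicity of the value `j` in the array `z`. -/
def mult {m n : ℕ} (z : Fin n → Fin m) (j : Fin m) : ℕ :=
  (Finset.univ.filter fun i => z i = j).card

/-- The `n × n` matrix whose `k`-th row is row `z k` of the first `n` columns of `A`. -/
def subMatrix {m n : ℕ} (hnm : n ≤ m) (A : Matrix (Fin m) (Fin m) ℂ) (z : Fin n → Fin m) :
    Matrix (Fin n) (Fin n) ℂ :=
  A.submatrix z (Fin.castLE hnm)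

/-- The boson sampling mass function `q(z | A) = |Per A_z|² / μ(z)`; multisets of size `n` are
represented by non-decreasing arrays `z`. -/
def bosonPMF {m n : ℕ} (hnm : n ≤ m) (A : Matrix (Fin m) (Fin m) ℂ) (z : Fin n → Fin m) : ℝ :=
  ‖(subMatrix hnm A z).permanent‖ ^ 2 / ∏ j, ((mult z j).factorial : ℝ)

/-! ### Haar measure on the unitary group -/

instance instMeasurableSpaceUnitary (m : ℕ) :
    MeasurableSpace (Matrix.unitaryGroup (Fin m) ℂ) := borel _

instance instBorelSpaceUnitary (m : ℕ) : BorelSpace (Matrix.unitaryGroup (Fin m) ℂ) := ⟨rfl⟩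

instance instCompactSpaceUnitary (m : ℕ) : CompactSpace (Matrix.unitaryGroup (Fin m) ℂ) := by
  refine isCompact_iff_compactSpace.mp (?_ : IsCompact
    ((Matrix.unitaryGroup (Fin m) ℂ : Submonoid _) : Set (Matrix (Fin m) (Fin m) ℂ)))
  have hK : IsCompact (Set.univ.pi fun _ : Fin m => Set.univ.pi fun _ : Fin m =>
      Metric.closedBall (0 : ℂ) 1) :=
    isCompact_univ_pi fun _ => isCompact_univ_pi fun _ => isCompact_closedBall 0 1
  refine IsCompact.of_isClosed_subset (X := Matrix (Fin m) (Fin m) ℂ) hK ?_ ?_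
  · have : ((Matrix.unitaryGroup (Fin m) ℂ : Submonoid _) : Set (Matrix (Fin m) (Fin m) ℂ)) =
        {U | U * star U = 1} := by
      ext U
      exact Matrix.mem_unitaryGroup_iff
    rw [this]
    exact isClosed_eq (continuous_id.mul continuous_star) continuous_const
  · intro U hU i _ j _
    simpa using entry_norm_bound_of_unitary hU i j

/-- The normalised Haar measure on the group of unitary `m × m` matrices. -/
def haarUnitary (m : ℕ) : Measure (Matrix.unitaryGroup (Fin m) ℂ) :=
  Measure.haarMeasure ⊤

/-! ### A randomised random access machine with exact arithmetic

The memory consists of finitely many named arrays of natural numbers (indices and counters) and of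
complex numbers.  The input matrix is read-only.  Every node of an expression (constant, memory
access, access to the input, arithmetical operation) and every command cost one step; so does
every round of a loop.  A random choice compares the real part of a number with a fresh uniform
variate on `[0, 1]`. -/

/-- Names of the arrays of natural numbers; a scalar is the entry with index `0`. -/
inductive IVar
  | m | n | i | j | k | l | t | pick | found | count | aux | distinct | pos
  | value | r | dir | s | perm | z
  deriving DecidableEq

/-- Names of the arrays of complex numbers; a scalar is the entry with index `0`. -/
inductive NVar
  | rem | acc | coef | sign | wt | lin | fwd | minor
  deriving DecidableEq

/-- A memory state, together with the number of steps made so far. -/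
structure State where
  int : IVar → ℕ → ℕ
  num : NVar → ℕ → ℂ
  time : ℕ

/-- Integer expressions; subtraction is truncated. -/
inductive IExpr
  | lit (c : ℕ)
  | get (x : IVar) (i : IExpr)
  | add (a b : IExpr)
  | sub (a b : IExpr)

/-- Number expressions. -/
inductive NExpr
  | lit (c : ℕ)
  | ofInt (a : IExpr)
  | get (x : NVar) (i : IExpr)
  | input (i j : IExpr)
  | add (a b : NExpr)
  | sub (a b : NExpr)
  | mul (a b : NExpr)
  | div (a b : NExpr)
  | absSq (a : NExpr)

/-- Commands. -/
inductive Cmd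
  | skip
  /-- `x[i] := a` for an array of natural numbers -/
  | setI (x : IVar) (i a : IExpr)
  /-- `x[i] := a` for an array of complex numbers -/
  | setN (x : NVar) (i : IExpr) (a : NExpr)
  | seq (c d : Cmd)
  /-- if `a < b` then `c` else `d` -/
  | ifLt (a b : IExpr) (c d : Cmd)
  /-- with probability `p` do `c`, otherwise `d` -/
  | coin (p : NExpr) (c d : Cmd)
  /-- for `x = 0, …, b - 1` do `c` -/
  | loop (x : IVar) (b : IExpr) (c : Cmd)

namespace State

def tick (σ : State) (t : ℕ) : State := { σ with time := σ.time + t }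

def setI (σ : State) (x : IVar) (i a : ℕ) : State :=
  { σ with int := Function.update σ.int x (Function.update (σ.int x) i a) }

def setN (σ : State) (x : NVar) (i : ℕ) (a : ℂ) : State :=
  { σ with num := Function.update σ.num x (Function.update (σ.num x) i a) }

end State

namespace IExpr

def eval (σ : State) : IExpr → ℕ
  | lit c => c
  | get x i => σ.int x (i.eval σ)
  | add a b => a.eval σ + b.eval σ
  | sub a b => a.eval σ - b.eval σ

def cost : IExpr → ℕ
  | lit _ => 1
  | get _ i => i.cost + 1
  | add a b => a.cost + b.cost + 1
  | sub a b => a.cost + b.cost + 1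

end IExpr

namespace NExpr

/-- The value of an expression, where `A` holds the entries of the input matrix. -/
def eval (A : ℕ → ℕ → ℂ) (σ : State) : NExpr → ℂ
  | lit c => (c : ℂ)
  | ofInt a => (a.eval σ : ℂ)
  | get x i => σ.num x (i.eval σ)
  | input i j => A (i.eval σ) (j.eval σ)
  | add a b => a.eval A σ + b.eval A σ
  | sub a b => a.eval A σ - b.eval A σ
  | mul a b => a.eval A σ * b.eval A σ
  | div a b => a.eval A σ / b.eval A σ
  | absSq a => ((Complex.normSq (a.eval A σ) : ℝ) : ℂ)

def cost : NExpr → ℕ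
  | lit _ => 1
  | ofInt a => a.cost + 1
  | get _ i => i.cost + 1
  | input i j => i.cost + j.cost + 1
  | add a b => a.cost + b.cost + 1
  | sub a b => a.cost + b.cost + 1
  | mul a b => a.cost + b.cost + 1
  | div a b => a.cost + b.cost + 1
  | absSq a => a.cost + 1

end NExpr

/-- The probability that a uniform variate on `[0, 1]` is at most `p`. -/
def clamp (p : ℝ) : ℝ≥0∞ := min (ENNReal.ofReal p) 1

/-- A random bit, equal to `true` with probability `p` (cut off at `0` and `1`). -/
def coinPMF (p : ℝ) : PMF Bool :=
  PMF.ofFintype (fun b => if b then clamp p else 1 - clamp p)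
    (by simp [clamp, add_tsub_cancel_of_le])

/-- Perform `f 0, …, f (b - 1)` one after the other. -/
def iter (f : ℕ → State → PMF State) : ℕ → State → PMF State
  | 0, σ => PMF.pure σ
  | b + 1, σ => (iter f b σ).bind (f b)

/-- The law of the state that a command reaches from a given state. -/
def run (A : ℕ → ℕ → ℂ) : Cmd → State → PMF State
  | .skip, σ => PMF.pure (σ.tick 1)
  | .setI x i a, σ => PMF.pure ((σ.setI x (i.eval σ) (a.eval σ)).tick (i.cost + a.cost + 1))
  | .setN x i a, σ => PMF.pure ((σ.setN x (i.eval σ) (a.eval A σ)).tick (i.cost + a.cost + 1))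
  | .seq c d, σ => (run A c σ).bind (run A d)
  | .ifLt a b c d, σ =>
      if a.eval σ < b.eval σ then run A c (σ.tick (a.cost + b.cost + 1))
      else run A d (σ.tick (a.cost + b.cost + 1))
  | .coin p c d, σ =>
      (coinPMF (p.eval A σ).re).bind fun h =>
        if h then run A c (σ.tick (p.cost + 1)) else run A d (σ.tick (p.cost + 1))
  | .loop x b c, σ =>
      iter (fun v τ => run A c ((τ.setI x 0 v).tick 1)) (b.eval σ) (σ.tick (b.cost + 1))

/-! ### The algorithm -/

end BosonSampling

end

namespace BosonSampling

infixr:60 " ;; " => Cmd.seq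

/-- A scalar integer variable. -/
def iv (x : IVar) : IExpr := .get x (.lit 0)

/-- A scalar number variable. -/
def nv (x : NVar) : NExpr := .get x (.lit 0)

/-- The successor of an integer expression. -/
def inc (a : IExpr) : IExpr := .add a (.lit 1)

/-- Draw an index `pick < b` with probability proportional to the weight `wt[pick]`: the indices are
offered in turn, and each is taken with its conditional probability. -/
def sample (b : IExpr) : Cmd :=
  .setN .rem (.lit 0) (.lit 0) ;;
  .loop .i b (.setN .rem (.lit 0) (.add (nv .rem) (.get .wt (iv .i)))) ;;
  .setI .pick (.lit 0) (.lit 0) ;;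
  .setI .found (.lit 0) (.lit 0) ;;
  .loop .i b
    (.ifLt (iv .found) (.lit 1)
      (.coin (.div (.get .wt (iv .i)) (nv .rem))
        (.setI .pick (.lit 0) (iv .i) ;; .setI .found (.lit 0) (.lit 1))
        (.setN .rem (.lit 0) (.sub (nv .rem) (.get .wt (iv .i)))))
      .skip)

/-- Draw a uniformly random permutation `perm[0], …, perm[n-1]` of the first `n` columns. -/
def permute : Cmd :=
  .loop .k (iv .n)
    (.loop .j (inc (iv .k)) (.setN .wt (iv .j) (.lit 1)) ;;
    sample (inc (iv .k)) ;;
    .setI .perm (iv .k) (.get .perm (iv .pick)) ;;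
    .setI .perm (iv .pick) (iv .k))

/-- List the distinct rows chosen so far in `value[0], …, value[distinct-1]`, set the code word
`r` to zero with all directions upward, and let `count` be the product of the `s[ν] + 1`. -/
def initCode : Cmd :=
  .setI .distinct (.lit 0) (.lit 0) ;;
  .setI .count (.lit 0) (.lit 1) ;;
  .loop .i (iv .m)
    (.ifLt (.lit 0) (.get .s (iv .i))
      (.setI .value (iv .distinct) (iv .i) ;;
      .setI .r (iv .distinct) (.lit 0) ;;
      .setI .dir (iv .distinct) (.lit 0) ;;
      .setI .distinct (.lit 0) (inc (iv .distinct)) ;;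
      .setI .aux (.lit 0) (.lit 0) ;;
      .loop .j (inc (.get .s (iv .i))) (.setI .aux (.lit 0) (.add (iv .aux) (iv .count))) ;;
      .setI .count (.lit 0) (iv .aux))
      .skip)

/-- The multiplicity of the row to which the `j`-th digit of the code word belongs. -/
def sj : IExpr := .get .s (.get .value (iv .j))

/-- The `j`-th digit of the code word. -/
def rj : IExpr := .get .r (iv .j)

/-- The entry in row `value[j]` and (permuted) column `l` of the input matrix. -/
def ajl : NExpr := .input (.get .value (iv .j)) (.get .perm (iv .l))

/-- Pass to the next word of the Guan (mixed radix reflected Gray) code.  The first digit that can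
move in its direction is changed by one; the directions of the digits before it are reversed.
The signed product of binomial coefficients `coef` and the linear forms `lin` are updated. -/
def nextCode : Cmd :=
  .setI .found (.lit 0) (.lit 0) ;;
  .loop .j (iv .distinct)
    (.ifLt (iv .found) (.lit 1)
      (.ifLt (.get .dir (iv .j)) (.lit 1)
        (.ifLt rj sj
          (.setN .coef (.lit 0) (.sub (.lit 0)
            (.div (.mul (nv .coef) (.ofInt (.sub sj rj))) (.ofInt (inc rj)))) ;;
          .setI .r (iv .j) (inc rj) ;;
          .loop .l (inc (iv .k)) (.setN .lin (iv .l) (.add (.get .lin (iv .l)) ajl)) ;;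
          .setI .found (.lit 0) (.lit 1))
          (.setI .dir (iv .j) (.lit 1)))
        (.ifLt (.lit 0) rj
          (.setN .coef (.lit 0) (.sub (.lit 0)
            (.div (.mul (nv .coef) (.ofInt rj)) (.ofInt (inc (.sub sj rj))))) ;;
          .setI .r (iv .j) (.sub rj (.lit 1)) ;;
          .loop .l (inc (iv .k)) (.setN .lin (iv .l) (.sub (.get .lin (iv .l)) ajl)) ;;
          .setI .found (.lit 0) (.lit 1))
          (.setI .dir (iv .j) (.lit 0))))
      .skip)

/-- Add to every `minor[l]` the term `coef * ∏ j ≠ l, lin[j]`, by means of forward and backward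
cumulative products. -/
def addTerms : Cmd :=
  .setN .acc (.lit 0) (nv .coef) ;;
  .loop .l (inc (iv .k))
    (.setN .fwd (iv .l) (nv .acc) ;;
    .setN .acc (.lit 0) (.mul (nv .acc) (.get .lin (iv .l)))) ;;
  .setN .acc (.lit 0) (.lit 1) ;;
  .loop .l (inc (iv .k))
    (.setN .minor (.sub (iv .k) (iv .l))
      (.add (.get .minor (.sub (iv .k) (iv .l)))
        (.mul (.get .fwd (.sub (iv .k) (iv .l))) (nv .acc))) ;;
    .setN .acc (.lit 0) (.mul (nv .acc) (.get .lin (.sub (iv .k) (iv .l)))))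

/-- With `k` rows chosen, compute the permanents `minor[l]`, `l = 0, …, k`, of the `k × k`
matrices that arise from these rows of the first `k + 1` columns by deleting column `l`; Ryser's
formula is summed in the order of the Guan code.  Here `sign` holds `(-1) ^ k`. -/
def minors : Cmd :=
  initCode ;;
  .loop .l (inc (iv .k))
    (.setN .lin (iv .l) (.lit 0) ;; .setN .minor (iv .l) (.lit 0)) ;;
  .setN .coef (.lit 0) (nv .sign) ;;
  .loop .t (iv .count) (addTerms ;; nextCode)

/-- The weights `wt[i] = |∑ l, a[i, l] * minor[l]|²`, by Laplace expansion. -/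
def weights : Cmd :=
  .loop .i (iv .m)
    (.setN .acc (.lit 0) (.lit 0) ;;
    .loop .l (inc (iv .k))
      (.setN .acc (.lit 0) (.add (nv .acc)
        (.mul (.input (iv .i) (.get .perm (iv .l))) (.get .minor (iv .l))))) ;;
    .setN .wt (iv .i) (.absSq (nv .acc)))

/-- Write the chosen rows in non-decreasing order to `z[0], …, z[n-1]`. -/
def sortedOutput : Cmd :=
  .setI .pos (.lit 0) (.lit 0) ;;
  .loop .i (iv .m)
    (.loop .j (.get .s (iv .i))
      (.setI .z (iv .pos) (iv .i) ;; .setI .pos (.lit 0) (inc (iv .pos))))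

/-- The boson sampler.  The rows chosen so far are stored by their multiplicities `s`.  In the
first round (`k = 0`) the only minor is the empty permanent `1`, so that the weights are the
`|a[i, 0]|²`. -/
def bosonSampler : Cmd :=
  permute ;;
  .loop .i (iv .m) (.setI .s (iv .i) (.lit 0)) ;;
  .setN .sign (.lit 0) (.lit 1) ;;
  .loop .k (iv .n)
    (minors ;;
    weights ;;
    sample (iv .m) ;;
    .setI .s (iv .pick) (inc (.get .s (iv .pick))) ;;
    .setN .sign (.lit 0) (.sub (.lit 0) (nv .sign))) ;;
  sortedOutput

end BosonSampling

noncomputable section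

namespace BosonSampling

/-- The entries of a matrix as a read-only memory. -/
def entries {m : ℕ} (A : Matrix (Fin m) (Fin m) ℂ) (i j : ℕ) : ℂ :=
  if h : i < m ∧ j < m then A ⟨i, h.1⟩ ⟨j, h.2⟩ else 0

/-- The initial state: the memory holds `m` and `n`, and zeros everywhere else. -/
def start (m n : ℕ) : State where
  int x i := if i = 0 then (if x = .m then m else if x = .n then n else 0) else 0
  num _ _ := 0
  time := 0

/-- The law of the final state of the boson sampler on input `A`, for `n` photons. -/
def finalLaw {m : ℕ} (n : ℕ) (A : Matrix (Fin m) (Fin m) ℂ) : PMF State :=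
  run (entries A) bosonSampler (start m n)

/-- The law of the output `z[0], …, z[n-1]`; indices of rows start at `0`. -/
def outputLaw {m : ℕ} (n : ℕ) (A : Matrix (Fin m) (Fin m) ℂ) : PMF (Fin n → ℕ) :=
  (finalLaw n A).map fun σ i => σ.int .z i

/-- The expected number of steps on input `A`. -/
def expectedTime {m : ℕ} (n : ℕ) (A : Matrix (Fin m) (Fin m) ℂ) : ℝ≥0∞ :=
  ∑' σ, finalLaw n A σ * (σ.time : ℝ≥0∞)

/-- The expected number of steps, averaged over Haar random unitary inputs. -/
def averageTime (m n : ℕ) : ℝ≥0∞ :=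
  ∫⁻ A : Matrix.unitaryGroup (Fin m) ℂ, expectedTime n A.1 ∂haarUnitary m

/-- `n (m + n) / m * C(m + n, n + 1)⁻¹ * C(2 m + n, n + 1) + n² m` -/
def timeBound (m n : ℕ) : ℝ :=
  (n * (m + n) / m : ℝ) * ((m + n).choose (n + 1) : ℝ)⁻¹ * ((2 * m + n).choose (n + 1) : ℝ)
    + (n : ℝ) ^ 2 * m

/-- `(2 θ + 1) ^ (2 θ + 1) / ((4 θ) ^ θ * (θ + 1) ^ (θ + 1))` -/
def growthRate (θ : ℝ) : ℝ :=
  (2 * θ + 1) ^ (2 * θ + 1) / ((4 * θ) ^ θ * (θ + 1) ^ (θ + 1))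

end BosonSampling

end

/-! Exactness comes from averaging over the order of the columns. For one fixed order the chosen
rows need not have a simple law, but the sum of these laws over all orders of distinct columns `c`
gives an array `r` exactly the mass |Per A[r,c]|² (`sum_perm_rowsLaw`). The proof is by induction on
the number of rows. By Laplace expansion a new row i is drawn with weight |Per A[(r,i),c]|², which
does not depend on the order of the columns. Since the columns of a unitary matrix are orthonormal,
the sum of these weights over i is ∑_l |Per A[r, c without c_l]|² (`sum_perSq_snoc`), and by
induction this is the total mass that all orders give to `r`. The two factors cancel. So an array
has probability |Per|²/n!, and sorting merges n!/∏ s_j! arrays of equal probability into one output.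

The time is governed by the Guan code: with k rows chosen it has ∏ (s_j + 1) words, and each costs
O(k + 1) steps; the weights cost O(m (k + 1)). Averaged over Haar measure, |Per A[r,c]|²/k! equals ∏
s_j! / ∏_{i<k} (m + i), that is, the multiset of rows becomes uniform (`integral_perSq`). Only left
invariance is needed. Diagonal unitaries kill the correlations of entry products with different row
multiplicities; rotations show that the mean square of a product of column forms at a real point x
is a constant times |x|^{2k}; comparing coefficients in the squares x_i² gives the claim up to a
constant, which the total mass k! determines. Under the uniform law the mean of ∏ (s_j + 1) is L_k =
∏_{i<k} (2m + i)/(m + i), by an urn recursion (`sum_factProd_mul_codeLength`). As L_k is a multiple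
of L_{k+1} - L_k, the sum over the rounds telescopes to the stated bound. For m = θn, Stirling's
formula shows that L_{n+1} is of order ρ(θ)^n.

The program is tied to this analysis by couplings (`coupled_bosonSampler`): its final state is
paired with an array `r` such that the output is `r` sorted and the time is bounded by a function of
`r`. Loop invariants handle the deterministic parts; Ryser's formula for repeated rows and the
correctness of the code give the minors. -/

noncomputable section

namespace BosonSampling

/-! ### Expectations and couplings -/

/-- The expectation of a nonnegative function under a discrete law. -/
def expect {α : Type*} (p : PMF α) (f : α → ℝ≥0∞) : ℝ≥0∞ := ∑' a, p a * f a

theorem expect_pure {α : Type*} (a : α) (f : α → ℝ≥0∞) : expect (PMF.pure a) f = f a := by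
  unfold expect
  rw [tsum_eq_single a]
  · simp
  · intro b hb
    simp [PMF.pure_apply, hb]

theorem expect_bind {α β : Type*} (p : PMF α) (q : α → PMF β) (f : β → ℝ≥0∞) :
    expect (p.bind q) f = expect p fun a => expect (q a) f := by
  unfold expect
  simp_rw [PMF.bind_apply, ← ENNReal.tsum_mul_right, ← ENNReal.tsum_mul_left]
  rw [ENNReal.tsum_comm]
  simp_rw [mul_assoc]

theorem expect_map {α β : Type*} (p : PMF α) (g : α → β) (f : β → ℝ≥0∞) :
    expect (p.map g) f = expect p (f ∘ g) := by
  rw [← PMF.bind_pure_comp, expect_bind]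
  simp [expect_pure, Function.comp_def]

theorem expect_mono {α : Type*} (p : PMF α) {f g : α → ℝ≥0∞}
    (h : ∀ a ∈ p.support, f a ≤ g a) : expect p f ≤ expect p g := by
  refine ENNReal.tsum_le_tsum fun a => ?_
  by_cases ha : a ∈ p.support
  · exact mul_le_mul_right (h a ha) _
  · simp [(PMF.apply_eq_zero_iff p a).2 ha]

theorem expect_const {α : Type*} (p : PMF α) (c : ℝ≥0∞) : expect p (fun _ => c) = c := by
  simp [expect, ENNReal.tsum_mul_right]

theorem expect_add {α : Type*} (p : PMF α) (f g : α → ℝ≥0∞) :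
    expect p (fun a => f a + g a) = expect p f + expect p g := by
  simp [expect, mul_add, ENNReal.tsum_add]

/-- Two laws are coupled along a relation if they are the marginals of a law that is supported on
that relation. -/
def Coupled {α β : Type*} (q : PMF α) (p : PMF β) (R : α → β → Prop) : Prop :=
  ∃ j : PMF (α × β), j.map Prod.fst = q ∧ j.map Prod.snd = p ∧ ∀ x ∈ j.support, R x.1 x.2

theorem Coupled.pure {α β : Type*} {a : α} {b : β} {R : α → β → Prop} (h : R a b) :
    Coupled (PMF.pure a) (PMF.pure b) R := by
  refine ⟨PMF.pure (a, b), by simp [PMF.pure_map], by simp [PMF.pure_map], ?_⟩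
  intro x hx
  simp only [PMF.support_pure, Set.mem_singleton_iff] at hx
  subst hx
  exact h

/-- The supports enter the hypothesis so that facts about reachable states, such as frame
conditions, can be added to a coupling afterwards. -/
theorem Coupled.mono {α β : Type*} {q : PMF α} {p : PMF β} {R R' : α → β → Prop}
    (h : Coupled q p R) (hR : ∀ a b, a ∈ q.support → b ∈ p.support → R a b → R' a b) :
    Coupled q p R' := by
  obtain ⟨j, rfl, rfl, hj⟩ := h
  refine ⟨j, rfl, rfl, fun x hx => hR _ _ ?_ ?_ (hj x hx)⟩
  · exact (PMF.mem_support_map_iff _ _ _).2 ⟨x, hx, rfl⟩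
  · exact (PMF.mem_support_map_iff _ _ _).2 ⟨x, hx, rfl⟩

theorem Coupled.map_left {α β γ : Type*} {q : PMF α} {p : PMF β} {R : α → β → Prop}
    {R' : γ → β → Prop} (g : α → γ) (h : Coupled q p R) (hR : ∀ a b, R a b → R' (g a) b) :
    Coupled (q.map g) p R' := by
  obtain ⟨j, rfl, rfl, hj⟩ := h
  refine ⟨j.map fun x => (g x.1, x.2), ?_, ?_, ?_⟩
  · simp [PMF.map_comp, Function.comp_def]
  · simp [PMF.map_comp, Function.comp_def]
  · intro x hx
    obtain ⟨y, hy, rfl⟩ := (PMF.mem_support_map_iff _ _ _).1 hx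
    exact hR _ _ (hj y hy)

/-- The independent product is a filler for `Coupled.bind`, where a joint law must be chosen also at
pairs outside the relation. -/
theorem coupled_true {α β : Type*} (q : PMF α) (p : PMF β) : Coupled q p fun _ _ => True := by
  refine ⟨q.bind fun a => p.map (Prod.mk a), ?_, ?_, fun _ _ => trivial⟩
  · rw [PMF.map_bind]
    have h : ∀ a : α, p.map (fun _ => a) = PMF.pure a := fun a => PMF.map_const p a
    simp [PMF.map_comp, Function.comp_def, h]
  · rw [PMF.map_bind]
    have h : p.map (fun b => b) = p := PMF.map_id p
    simp [PMF.map_comp, Function.comp_def, h]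

theorem Coupled.bind {α β α' β' : Type*} {q : PMF α} {p : PMF β} {R : α → β → Prop}
    {q' : α → PMF α'} {p' : β → PMF β'} {R' : α' → β' → Prop} (h : Coupled q p R)
    (h' : ∀ a b, R a b → Coupled (q' a) (p' b) R') : Coupled (q.bind q') (p.bind p') R' := by
  classical
  obtain ⟨j, rfl, rfl, hj⟩ := h
  have key : ∀ x : α × β, ∃ j' : PMF (α' × β'), j'.map Prod.fst = q' x.1 ∧
      j'.map Prod.snd = p' x.2 ∧ (R x.1 x.2 → ∀ y ∈ j'.support, R' y.1 y.2) := by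
    intro x
    by_cases hx : R x.1 x.2
    · obtain ⟨j', h1, h2, h3⟩ := h' _ _ hx
      exact ⟨j', h1, h2, fun _ => h3⟩
    · obtain ⟨j', h1, h2, -⟩ := coupled_true (q' x.1) (p' x.2)
      exact ⟨j', h1, h2, fun h => absurd h hx⟩
  choose J h1 h2 h3 using key
  refine ⟨j.bind J, ?_, ?_, ?_⟩
  · rw [PMF.map_bind, PMF.bind_map]
    simp [h1, Function.comp_def]
  · rw [PMF.map_bind, PMF.bind_map]
    simp [h2, Function.comp_def]
  · intro y hy
    obtain ⟨x, hx, hxy⟩ := (PMF.mem_support_bind_iff _ _ _).1 hy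
    exact h3 x (hj x hx) y hxy

theorem coupled_refl {α : Type*} (p : PMF α) : Coupled p p Eq := by
  refine ⟨p.map fun a => (a, a), ?_, ?_, ?_⟩
  · rw [PMF.map_comp]
    exact PMF.map_id p
  · rw [PMF.map_comp]
    exact PMF.map_id p
  · intro x hx
    obtain ⟨a, -, rfl⟩ := (PMF.mem_support_map_iff _ _ _).1 hx
    rfl

/-- This transfers the exact output law from the abstract chain to the machine; `Coupled.expect_le`
does the same for the time, where only an inequality is known. -/
theorem Coupled.map_eq {α β γ : Type*} {q : PMF α} {p : PMF β} {g : α → γ} {f : β → γ}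
    (h : Coupled q p fun a b => f b = g a) : p.map f = q.map g := by
  obtain ⟨j, rfl, rfl, hj⟩ := h
  rw [PMF.map_comp, PMF.map_comp]
  rw [← PMF.bind_pure_comp, ← PMF.bind_pure_comp]
  refine PMF.ext fun c => ?_
  rw [PMF.bind_apply, PMF.bind_apply]
  refine tsum_congr fun x => ?_
  by_cases hx : x ∈ j.support
  · simp [hj x hx]
  · simp [(PMF.apply_eq_zero_iff j x).2 hx]

theorem Coupled.expect_le {α β : Type*} {q : PMF α} {p : PMF β} {g : α → ℝ≥0∞} {f : β → ℝ≥0∞}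
    (h : Coupled q p fun a b => f b ≤ g a) : expect p f ≤ expect q g := by
  obtain ⟨j, rfl, rfl, hj⟩ := h
  rw [expect_map, expect_map]
  exact expect_mono _ fun x hx => hj x hx

/-! ### Deterministic execution -/

/-- The command `c` makes no random choice that matters when started in `σ`, and the state that it
reaches satisfies `Q`. -/
def Exec (A : ℕ → ℕ → ℂ) (c : Cmd) (σ : State) (Q : State → Prop) : Prop :=
  ∃ τ, run A c σ = PMF.pure τ ∧ Q τ

variable {A : ℕ → ℕ → ℂ}

theorem Exec.mono {c : Cmd} {σ : State} {Q Q' : State → Prop} (h : Exec A c σ Q)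
    (hQ : ∀ τ, Q τ → Q' τ) : Exec A c σ Q' := by
  obtain ⟨τ, h1, h2⟩ := h
  exact ⟨τ, h1, hQ τ h2⟩

theorem exec_skip {σ : State} {Q : State → Prop} (h : Q (σ.tick 1)) : Exec A .skip σ Q :=
  ⟨_, rfl, h⟩

theorem exec_setI {x : IVar} {i a : IExpr} {σ : State} {Q : State → Prop}
    (h : Q ((σ.setI x (i.eval σ) (a.eval σ)).tick (i.cost + a.cost + 1))) :
    Exec A (.setI x i a) σ Q :=
  ⟨_, rfl, h⟩

theorem exec_setN {x : NVar} {i : IExpr} {a : NExpr} {σ : State} {Q : State → Prop}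
    (h : Q ((σ.setN x (i.eval σ) (a.eval A σ)).tick (i.cost + a.cost + 1))) :
    Exec A (.setN x i a) σ Q :=
  ⟨_, rfl, h⟩

theorem exec_seq {c d : Cmd} {σ : State} {Q : State → Prop}
    (h : Exec A c σ fun τ => Exec A d τ Q) : Exec A (.seq c d) σ Q := by
  obtain ⟨τ, h1, ρ, h2, h3⟩ := h
  exact ⟨ρ, by simp [run, h1, h2], h3⟩

theorem exec_ifLt {a b : IExpr} {c d : Cmd} {σ : State} {Q : State → Prop}
    (h1 : a.eval σ < b.eval σ → Exec A c (σ.tick (a.cost + b.cost + 1)) Q)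
    (h2 : ¬ a.eval σ < b.eval σ → Exec A d (σ.tick (a.cost + b.cost + 1)) Q) :
    Exec A (.ifLt a b c d) σ Q := by
  by_cases h : a.eval σ < b.eval σ
  · obtain ⟨τ, h3, h4⟩ := h1 h
    exact ⟨τ, by simp [run, h, h3], h4⟩
  · obtain ⟨τ, h3, h4⟩ := h2 h
    exact ⟨τ, by simp [run, h, h3], h4⟩

/-- The bound is evaluated once, on entry, so the final index is its value in `σ`. The invariant is
stated before the loop variable is written. -/
theorem exec_loop {x : IVar} {b : IExpr} {c : Cmd} {σ : State} (I : ℕ → State → Prop)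
    (h0 : I 0 (σ.tick (b.cost + 1)))
    (hs : ∀ v τ, v < b.eval σ → I v τ → Exec A c ((τ.setI x 0 v).tick 1) (I (v + 1))) :
    Exec A (.loop x b c) σ (I (b.eval σ)) := by
  suffices ∀ N ≤ b.eval σ, ∃ τ, iter (fun v τ => run A c ((τ.setI x 0 v).tick 1)) N
      (σ.tick (b.cost + 1)) = PMF.pure τ ∧ I N τ from this _ le_rfl
  intro N
  induction N with
  | zero => exact fun _ => ⟨_, rfl, h0⟩
  | succ N ih =>
    intro hN
    obtain ⟨τ, h1, h2⟩ := ih (by omega)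
    obtain ⟨ρ, h3, h4⟩ := hs N τ (by omega) h2
    exact ⟨ρ, by simp [iter, h1, h3], h4⟩

/-- The space `G v` varies with the round because the chains of interest do: permutations of `Fin
k`, arrays of length `k`. -/
theorem coupled_loop {G : ℕ → Type*} {x : IVar} {b : IExpr} {c : Cmd} {σ : State}
    (q : ∀ v, PMF (G v)) (q' : ∀ v, G v → PMF (G (v + 1)))
    (hq : ∀ v < b.eval σ, q (v + 1) = (q v).bind (q' v))
    (R : ∀ v, G v → State → Prop)
    (h0 : Coupled (q 0) (PMF.pure (σ.tick (b.cost + 1))) (R 0))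
    (hs : ∀ v g τ, v < b.eval σ → R v g τ →
      Coupled (q' v g) (run A c ((τ.setI x 0 v).tick 1)) (R (v + 1))) :
    Coupled (q (b.eval σ)) (run A (.loop x b c) σ) (R (b.eval σ)) := by
  suffices ∀ N ≤ b.eval σ, Coupled (q N) (iter (fun v τ => run A c ((τ.setI x 0 v).tick 1)) N
      (σ.tick (b.cost + 1))) (R N) from this _ le_rfl
  intro N
  induction N with
  | zero => exact fun _ => h0
  | succ N ih =>
    intro hN
    rw [hq N (by omega)]
    exact (ih (by omega)).bind fun g τ hg => hs N g τ (by omega) hg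

theorem Exec.coupled {α : Type*} {c : Cmd} {σ : State} {Q : State → Prop} {R : α → State → Prop}
    {a : α} (h : Exec A c σ Q) (hR : ∀ τ, Q τ → R a τ) :
    Coupled (PMF.pure a) (run A c σ) R := by
  obtain ⟨τ, h1, h2⟩ := h
  rw [h1]
  exact Coupled.pure (hR τ h2)

theorem coupled_seq {α β : Type*} {c d : Cmd} {σ : State} {q : PMF α} {q' : α → PMF β}
    {R : α → State → Prop} {R' : β → State → Prop} (h : Coupled q (run A c σ) R)
    (h' : ∀ a τ, R a τ → Coupled (q' a) (run A d τ) R') :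
    Coupled (q.bind q') (run A (.seq c d) σ) R' :=
  h.bind h'

theorem coupled_seq_exec {α : Type*} {c d : Cmd} {σ : State} {q : PMF α}
    {R : α → State → Prop} {R' : α → State → Prop} (h : Coupled q (run A c σ) R)
    (h' : ∀ a τ, R a τ → Exec A d τ (R' a)) :
    Coupled q (run A (.seq c d) σ) R' := by
  have := coupled_seq (q' := PMF.pure) h fun a τ hR => (h' a τ hR).coupled fun τ h => h
  simpa using this

theorem Exec.coupled_seq {α : Type*} {c d : Cmd} {σ : State} {q : PMF α}
    {R : α → State → Prop} (h : Exec A c σ fun τ => Coupled q (run A d τ) R) :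
    Coupled q (run A (.seq c d) σ) R := by
  obtain ⟨τ, h1, h2⟩ := h
  simpa [run, h1] using h2

/-! ### Variables that a command does not write -/

/-- The command writes the array `x` of natural numbers. -/
def Cmd.writesI (x : IVar) : Cmd → Bool
  | .skip => false
  | .setI y _ _ => decide (y = x)
  | .setN _ _ _ => false
  | .seq c d => c.writesI x || d.writesI x
  | .ifLt _ _ c d => c.writesI x || d.writesI x
  | .coin _ c d => c.writesI x || d.writesI x
  | .loop y _ c => decide (y = x) || c.writesI x

/-- The command writes the array `x` of complex numbers. -/
def Cmd.writesN (x : NVar) : Cmd → Bool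
  | .skip => false
  | .setI _ _ _ => false
  | .setN y _ _ => decide (y = x)
  | .seq c d => c.writesN x || d.writesN x
  | .ifLt _ _ c d => c.writesN x || d.writesN x
  | .coin _ c d => c.writesN x || d.writesN x
  | .loop _ _ c => c.writesN x

/-- The states differ at most in the variables that `c` writes. -/
def Frame (c : Cmd) (σ τ : State) : Prop :=
  (∀ x, c.writesI x = false → τ.int x = σ.int x) ∧ (∀ x, c.writesN x = false → τ.num x = σ.num x)

/-- Whether an array is written can be read off the syntax. Untouched arrays then need not be
carried through the invariants; the side conditions are closed by `rfl`. -/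
theorem frame_of_mem_support (c : Cmd) {σ τ : State} (h : τ ∈ (run A c σ).support) :
    Frame c σ τ := by
  induction c generalizing σ τ with
  | skip =>
    simp only [run, PMF.support_pure, Set.mem_singleton_iff] at h
    subst h
    exact ⟨fun _ _ => rfl, fun _ _ => rfl⟩
  | setI y i a =>
    simp only [run, PMF.support_pure, Set.mem_singleton_iff] at h
    subst h
    refine ⟨fun x hx => ?_, fun _ _ => rfl⟩
    simp only [Cmd.writesI, decide_eq_false_iff_not] at hx
    exact Function.update_of_ne (Ne.symm hx) _ _
  | setN y i a =>
    simp only [run, PMF.support_pure, Set.mem_singleton_iff] at h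
    subst h
    refine ⟨fun _ _ => rfl, fun x hx => ?_⟩
    simp only [Cmd.writesN, decide_eq_false_iff_not] at hx
    exact Function.update_of_ne (Ne.symm hx) _ _
  | seq c d ihc ihd =>
    obtain ⟨ρ, h1, h2⟩ := (PMF.mem_support_bind_iff _ _ _).1 h
    have h3 := ihc h1
    have h4 := ihd h2
    refine ⟨fun x hx => ?_, fun x hx => ?_⟩
    · simp only [Cmd.writesI, Bool.or_eq_false_iff] at hx
      rw [h4.1 x hx.2, h3.1 x hx.1]
    · simp only [Cmd.writesN, Bool.or_eq_false_iff] at hx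
      rw [h4.2 x hx.2, h3.2 x hx.1]
  | ifLt a b c d ihc ihd =>
    simp only [run] at h
    refine ⟨fun x hx => ?_, fun x hx => ?_⟩
    · simp only [Cmd.writesI, Bool.or_eq_false_iff] at hx
      split_ifs at h
      · exact (ihc h).1 x hx.1
      · exact (ihd h).1 x hx.2
    · simp only [Cmd.writesN, Bool.or_eq_false_iff] at hx
      split_ifs at h
      · exact (ihc h).2 x hx.1
      · exact (ihd h).2 x hx.2
  | coin p c d ihc ihd =>
    obtain ⟨b, -, h⟩ := (PMF.mem_support_bind_iff _ _ _).1 h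
    refine ⟨fun x hx => ?_, fun x hx => ?_⟩
    · simp only [Cmd.writesI, Bool.or_eq_false_iff] at hx
      split_ifs at h
      · exact (ihc h).1 x hx.1
      · exact (ihd h).1 x hx.2
    · simp only [Cmd.writesN, Bool.or_eq_false_iff] at hx
      split_ifs at h
      · exact (ihc h).2 x hx.1
      · exact (ihd h).2 x hx.2
  | loop y b c ih =>
    suffices ∀ N, ∀ τ ∈ (iter (fun v τ => run A c ((τ.setI y 0 v).tick 1)) N
        (σ.tick (b.cost + 1))).support, Frame (.loop y b c) σ τ from this _ _ h
    clear h
    intro N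
    induction N with
    | zero =>
      intro τ h
      simp only [iter, PMF.support_pure, Set.mem_singleton_iff] at h
      subst h
      exact ⟨fun _ _ => rfl, fun _ _ => rfl⟩
    | succ N ihN =>
      intro τ h
      obtain ⟨ρ, h1, h2⟩ := (PMF.mem_support_bind_iff _ _ _).1 h
      have h3 := ihN ρ h1
      have h4 := ih h2
      refine ⟨fun x hx => ?_, fun x hx => ?_⟩
      · rw [← h3.1 x hx]
        simp only [Cmd.writesI, Bool.or_eq_false_iff, decide_eq_false_iff_not] at hx
        rw [h4.1 x hx.2]
        exact Function.update_of_ne (Ne.symm hx.1) _ _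
      · rw [← h3.2 x hx]
        exact h4.2 x hx

theorem Exec.frame {c : Cmd} {σ : State} {Q : State → Prop} (h : Exec A c σ Q) :
    Exec A c σ fun τ => Frame c σ τ ∧ Q τ := by
  obtain ⟨τ, h1, h2⟩ := h
  exact ⟨τ, h1, frame_of_mem_support (A := A) c (by simp [h1]), h2⟩

theorem Coupled.frame {α : Type*} {q : PMF α} {c : Cmd} {σ : State} {R : α → State → Prop}
    (h : Coupled q (run A c σ) R) :
    Coupled q (run A c σ) fun a τ => Frame c σ τ ∧ R a τ :=
  h.mono fun _ _ _ hτ hR => ⟨frame_of_mem_support c hτ, hR⟩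

end BosonSampling

end

noncomputable section

namespace BosonSampling

/-! ### Measurability of expected values -/

instance instMeasurableSpaceState : MeasurableSpace State :=
  MeasurableSpace.comap (fun σ : State => (σ.int, σ.num, σ.time)) inferInstance

theorem measurable_state_iff {Ω : Type*} [MeasurableSpace Ω] {f : Ω → State} :
    Measurable f ↔ (∀ x i, Measurable fun ω => (f ω).int x i) ∧
      (∀ x i, Measurable fun ω => (f ω).num x i) ∧ Measurable fun ω => (f ω).time := by
  rw [measurable_comap_iff]
  constructor
  · intro h
    have h1 := measurable_fst.comp h
    have h2 := (measurable_fst.comp measurable_snd).comp h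
    have h3 := (measurable_snd.comp measurable_snd).comp h
    exact ⟨fun x i => measurable_pi_iff.1 (measurable_pi_iff.1 h1 x) i,
      fun x i => measurable_pi_iff.1 (measurable_pi_iff.1 h2 x) i, h3⟩
  · rintro ⟨h1, h2, h3⟩
    exact (measurable_pi_iff.2 fun x => measurable_pi_iff.2 fun i => h1 x i).prodMk
      ((measurable_pi_iff.2 fun x => measurable_pi_iff.2 fun i => h2 x i).prodMk h3)

/-- Indirect addressing and loops of variable length remain measurable because the index takes
countably many values. -/
theorem measurable_apply_nat {Ω β : Type*} [MeasurableSpace Ω] [MeasurableSpace β]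
    {f : ℕ → Ω → β} {i : Ω → ℕ} (hf : ∀ v, Measurable (f v)) (hi : Measurable i) :
    Measurable fun ω => f (i ω) ω := by
  have : Measurable fun x : ℕ × Ω => f x.1 x.2 := measurable_from_prod_countable_right hf
  exact this.comp (hi.prodMk measurable_id)

section

variable {Ω : Type*} [MeasurableSpace Ω] {A : Ω → ℕ → ℕ → ℂ} {f : Ω → State}

theorem measurable_tick (hf : Measurable f) (t : ℕ) : Measurable fun ω => (f ω).tick t := by
  rw [measurable_state_iff] at hf ⊢
  exact ⟨hf.1, hf.2.1, hf.2.2.add_const t⟩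

theorem measurable_setI (hf : Measurable f) (x : IVar) {i a : Ω → ℕ} (hi : Measurable i)
    (ha : Measurable a) : Measurable fun ω => (f ω).setI x (i ω) (a ω) := by
  rw [measurable_state_iff] at hf ⊢
  refine ⟨fun y j => ?_, hf.2.1, hf.2.2⟩
  by_cases hy : y = x
  · subst hy
    have : (fun ω => ((f ω).setI y (i ω) (a ω)).int y j) =
        fun ω => if j = i ω then a ω else (f ω).int y j := by
      ext ω
      simp [State.setI, Function.update_apply]
    rw [this]
    exact Measurable.ite (measurableSet_eq_fun measurable_const hi) ha (hf.1 y j)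
  · simpa [State.setI, Function.update_of_ne hy] using hf.1 y j

theorem measurable_setN (hf : Measurable f) (x : NVar) {i : Ω → ℕ} {a : Ω → ℂ}
    (hi : Measurable i) (ha : Measurable a) : Measurable fun ω => (f ω).setN x (i ω) (a ω) := by
  rw [measurable_state_iff] at hf ⊢
  refine ⟨hf.1, fun y j => ?_, hf.2.2⟩
  by_cases hy : y = x
  · subst hy
    have : (fun ω => ((f ω).setN y (i ω) (a ω)).num y j) =
        fun ω => if j = i ω then a ω else (f ω).num y j := by
      ext ω
      simp [State.setN, Function.update_apply]
    rw [this]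
    exact Measurable.ite (measurableSet_eq_fun measurable_const hi) ha (hf.2.1 y j)
  · simpa [State.setN, Function.update_of_ne hy] using hf.2.1 y j

theorem IExpr.measurable_eval (hf : Measurable f) (e : IExpr) :
    Measurable fun ω => e.eval (f ω) := by
  induction e with
  | lit c => exact measurable_const
  | get x i ih => exact measurable_apply_nat (fun v => (measurable_state_iff.1 hf).1 x v) ih
  | add a b iha ihb => exact iha.add ihb
  | sub a b iha ihb => exact iha.sub ihb

theorem NExpr.measurable_eval (hA : ∀ i j, Measurable fun ω => A ω i j) (hf : Measurable f)
    (e : NExpr) : Measurable fun ω => e.eval (A ω) (f ω) := by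
  induction e with
  | lit c => exact measurable_const
  | ofInt a => exact (measurable_of_countable (fun n : ℕ => (n : ℂ))).comp (a.measurable_eval hf)
  | get x i =>
    exact measurable_apply_nat (fun v => (measurable_state_iff.1 hf).2.1 x v)
      (i.measurable_eval hf)
  | input i j =>
    exact measurable_apply_nat (fun v => measurable_apply_nat (fun w => hA v w)
      (j.measurable_eval hf)) (i.measurable_eval hf)
  | add a b iha ihb => exact iha.add ihb
  | sub a b iha ihb => exact iha.sub ihb
  | mul a b iha ihb => exact iha.mul ihb
  | div a b iha ihb => exact iha.div ihb
  | absSq a ih =>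
    exact Complex.measurable_ofReal.comp (Complex.continuous_normSq.measurable.comp ih)

end

theorem measurable_clamp : Measurable clamp :=
  ENNReal.measurable_ofReal.min measurable_const

theorem expect_coinPMF (p : ℝ) (f : Bool → ℝ≥0∞) :
    expect (coinPMF p) f = clamp p * f true + (1 - clamp p) * f false := by
  simp [expect, tsum_fintype, coinPMF]

/-- Induction on the command with `g` arbitrary: in a sequence, the expectation over the second
command becomes the new `g`. That function depends on the input matrix too, so `g` is taken on pairs
from the start. -/
theorem measurable_expect_run (c : Cmd) {g : (ℕ → ℕ → ℂ) × State → ℝ≥0∞} (hg : Measurable g) :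
    Measurable fun x : (ℕ → ℕ → ℂ) × State =>
      expect (run x.1 c x.2) fun τ => g (x.1, τ) := by
  have hA : ∀ i j, Measurable fun x : (ℕ → ℕ → ℂ) × State => x.1 i j := fun i j =>
    (measurable_pi_apply j).comp ((measurable_pi_apply i).comp measurable_fst)
  have hS : Measurable fun x : (ℕ → ℕ → ℂ) × State => x.2 := measurable_snd
  induction c generalizing g with
  | skip =>
    simp only [run, expect_pure]
    exact hg.comp (measurable_fst.prodMk (measurable_tick hS 1))
  | setI y i a =>
    simp only [run, expect_pure]
    exact hg.comp (measurable_fst.prodMk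
      (measurable_tick (measurable_setI hS y (i.measurable_eval hS) (a.measurable_eval hS)) _))
  | setN y i a =>
    simp only [run, expect_pure]
    exact hg.comp (measurable_fst.prodMk (measurable_tick
      (measurable_setN hS y (i.measurable_eval hS) (a.measurable_eval hA hS)) _))
  | seq c d ihc ihd =>
    simp only [run, expect_bind]
    exact ihc (ihd hg)
  | ifLt a b c d ihc ihd =>
    have : (fun x : (ℕ → ℕ → ℂ) × State => expect (run x.1 (.ifLt a b c d) x.2)
        fun τ => g (x.1, τ)) = fun x => if a.eval x.2 < b.eval x.2 then
          expect (run x.1 c (x.2.tick (a.cost + b.cost + 1))) fun τ => g (x.1, τ) else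
          expect (run x.1 d (x.2.tick (a.cost + b.cost + 1))) fun τ => g (x.1, τ) := by
      ext x
      simp only [run]
      split_ifs <;> rfl
    rw [this]
    have ht := measurable_fst.prodMk (measurable_tick hS (a.cost + b.cost + 1))
    exact Measurable.ite (measurableSet_lt (a.measurable_eval hS) (b.measurable_eval hS))
      ((ihc hg).comp ht) ((ihd hg).comp ht)
  | coin p c d ihc ihd =>
    simp only [run, expect_bind, expect_coinPMF, if_true, Bool.false_eq_true, if_false]
    have ht := measurable_fst.prodMk (measurable_tick hS (p.cost + 1))
    have hp := measurable_clamp.comp (Complex.measurable_re.comp (p.measurable_eval hA hS))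
    exact (hp.mul ((ihc hg).comp ht)).add ((measurable_const.sub hp).mul ((ihd hg).comp ht))
  | loop y b c ih =>
    have key : ∀ N, ∀ {g : (ℕ → ℕ → ℂ) × State → ℝ≥0∞}, Measurable g →
        Measurable fun x : (ℕ → ℕ → ℂ) × State =>
          expect (iter (fun v τ => run x.1 c ((τ.setI y 0 v).tick 1)) N
            (x.2.tick (b.cost + 1))) fun τ => g (x.1, τ) := by
      intro N
      induction N with
      | zero =>
        intro g hg
        simp only [iter, expect_pure]
        exact hg.comp (measurable_fst.prodMk (measurable_tick hS _))
      | succ N ihN =>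
        intro g hg
        simp only [iter, expect_bind]
        refine ihN (g := fun x => expect (run x.1 c ((x.2.setI y 0 N).tick 1))
          fun τ => g (x.1, τ)) ?_
        exact (ih hg).comp (measurable_fst.prodMk (measurable_tick
          (measurable_setI hS y measurable_const measurable_const) 1))
    exact measurable_apply_nat (fun N => key N hg) (b.measurable_eval hS)

/-- Without measurability the lower integral in `averageTime` could fall below the mean, and an
upper bound for it would say little. -/
theorem measurable_expectedTime (m n : ℕ) :
    Measurable fun A : Matrix.unitaryGroup (Fin m) ℂ => expectedTime n A.1 := by
  have hg : Measurable fun x : (ℕ → ℕ → ℂ) × State => (x.2.time : ℝ≥0∞) :=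
    (measurable_of_countable (fun n : ℕ => (n : ℝ≥0∞))).comp
      ((measurable_state_iff.1 measurable_snd).2.2)
  refine (measurable_expect_run bosonSampler hg).comp
    (f := fun A : Matrix.unitaryGroup (Fin m) ℂ => (entries A.1, start m n)) ?_
  refine Measurable.prodMk (measurable_pi_iff.2 fun i => measurable_pi_iff.2 fun j => ?_)
    measurable_const
  by_cases h : i < m ∧ j < m
  · simp only [entries, h, and_self, dite_true]
    exact (continuous_subtype_val.matrix_elem _ _).measurable
  · simp only [entries, h, dite_false]
    exact measurable_const

end BosonSampling

end

noncomputable section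

namespace BosonSampling

/-! ### Multiplicities -/

theorem mult_eq_sum {m n : ℕ} (z : Fin n → Fin m) (j : Fin m) :
    mult z j = ∑ i, if z i = j then 1 else 0 := by
  simp [mult]

theorem mult_snoc {m n : ℕ} (r : Fin n → Fin m) (i j : Fin m) :
    mult (Fin.snoc r i : Fin (n + 1) → Fin m) j = mult r j + if i = j then 1 else 0 := by
  simp only [mult_eq_sum, Fin.sum_univ_castSucc, Fin.snoc_castSucc, Fin.snoc_last]

theorem sum_mult {m n : ℕ} (z : Fin n → Fin m) : ∑ j, mult z j = n := by
  simp_rw [mult_eq_sum]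
  rw [Finset.sum_comm]
  simp

theorem mult_le {m n : ℕ} (z : Fin n → Fin m) (j : Fin m) : mult z j ≤ n := by
  conv_rhs => rw [← sum_mult z]
  exact Finset.single_le_sum (fun i _ => Nat.zero_le (mult z i)) (Finset.mem_univ j)

theorem mult_comp_perm {m n : ℕ} (z : Fin n → Fin m) (σ : Equiv.Perm (Fin n)) :
    mult (z ∘ σ) = mult z := by
  ext j
  simp_rw [mult_eq_sum, Function.comp_apply]
  exact Equiv.sum_comp σ fun i => if z i = j then 1 else 0

theorem exists_perm_of_mult_eq {m n : ℕ} {y z : Fin n → Fin m} (h : mult y = mult z) :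
    ∃ σ : Equiv.Perm (Fin n), z ∘ σ = y := by
  have hc : ∀ j, Nonempty ({i // y i = j} ≃ {i // z i = j}) := fun j => by
    refine Fintype.card_eq.1 ?_
    rw [Fintype.card_subtype, Fintype.card_subtype]
    exact congrFun h j
  exact ⟨Equiv.ofFiberEquiv fun j => (hc j).some, funext fun i => Equiv.ofFiberEquiv_map _ i⟩

theorem eq_of_monotone_of_mult_eq {m n : ℕ} {y z : Fin n → Fin m} (hy : Monotone y)
    (hz : Monotone z) (h : mult y = mult z) : y = z := by
  obtain ⟨σ, hσ⟩ := exists_perm_of_mult_eq h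
  have := Tuple.unique_monotone (f := z) (σ := σ) (τ := 1) (by rwa [hσ]) (by simpa using hz)
  rw [hσ] at this
  simpa using this

/-- Orbit and stabiliser: the permutations that carry `z` to a given rearrangement form a coset of
the stabiliser of `z`, which has ∏ s_j! elements. -/
theorem sum_perm_comp {m n : ℕ} {M : Type*} [CommSemiring M] (z : Fin n → Fin m)
    (F : (Fin n → Fin m) → M) :
    ∑ σ : Equiv.Perm (Fin n), F (z ∘ σ) =
      ((∏ j, (mult z j).factorial : ℕ) : M) *
        ∑ f ∈ Finset.univ.filter fun f => mult f = mult z, F f := by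
  classical
  rw [← Finset.sum_fiberwise_of_maps_to
    (t := Finset.univ.filter fun f => mult f = mult z) (g := fun σ : Equiv.Perm (Fin n) => z ∘ σ)
    (fun σ _ => by simp [mult_comp_perm]), Finset.mul_sum]
  refine Finset.sum_congr rfl fun f hf => ?_
  obtain ⟨τ, rfl⟩ := exists_perm_of_mult_eq (Finset.mem_filter.1 hf).2
  rw [Finset.sum_congr rfl (g := fun _ => F (z ∘ τ)) fun σ hσ => by
    rw [(Finset.mem_filter.1 hσ).2], Finset.sum_const, nsmul_eq_mul]
  congr 2
  have h1 := DomMulAct.stabilizer_card z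
  have h2 : ∏ i, (Fintype.card {a // z a = i}).factorial = ∏ j, (mult z j).factorial := by
    refine Finset.prod_congr rfl fun j _ => ?_
    rw [Fintype.card_subtype]
    rfl
  rw [← h2, ← h1, ← Fintype.card_subtype]
  refine Fintype.card_congr ((Equiv.mulRight τ⁻¹).subtypeEquiv fun σ => ?_)
  simp only [Equiv.coe_mulRight, Equiv.Perm.coe_mul]
  constructor
  · intro h
    rw [← Function.comp_assoc, h]
    ext i
    simp
  · intro h
    have := congrArg (· ∘ τ) h
    simpa [Function.comp_def] using this

theorem card_mult_eq {m n : ℕ} (z : Fin n → Fin m) :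
    (∏ j, (mult z j).factorial) * (Finset.univ.filter fun f : Fin n → Fin m => mult f = mult z).card =
      n.factorial := by
  have := sum_perm_comp z fun _ => (1 : ℕ)
  simpa [Fintype.card_perm] using this.symm

/-! ### Permanents -/

theorem permanent_repeated_rows {d n : ℕ} {R : Type*} [CommSemiring R]
    (b : Fin d → Fin n → R) (z : Fin n → Fin d) :
    (Matrix.of fun i j => b (z i) j).permanent = ((∏ j, (mult z j).factorial : ℕ) : R) *
      ∑ f ∈ Finset.univ.filter fun f => mult f = mult z, ∏ i, b (f i) i := by
  rw [← sum_perm_comp z fun f => ∏ i, b (f i) i]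
  rfl

/-- A permutation of `Fin (k + 1)`, given by the image of the last element and the permutation
that it induces on the remaining ones. -/
def permSnoc {k : ℕ} (x : Fin (k + 1) × Equiv.Perm (Fin k)) : Equiv.Perm (Fin (k + 1)) :=
  (finSuccEquiv' (Fin.last k)).trans ((Equiv.optionCongr x.2).trans (finSuccEquiv' x.1).symm)

@[simp]
theorem permSnoc_last {k : ℕ} (l : Fin (k + 1)) (τ : Equiv.Perm (Fin k)) :
    permSnoc (l, τ) (Fin.last k) = l := by
  simp [permSnoc]

@[simp]
theorem permSnoc_castSucc {k : ℕ} (l : Fin (k + 1)) (τ : Equiv.Perm (Fin k)) (i : Fin k) :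
    permSnoc (l, τ) i.castSucc = l.succAbove (τ i) := by
  simp [permSnoc, finSuccEquiv'_last_apply_castSucc]

theorem permSnoc_bijective (k : ℕ) : Function.Bijective (permSnoc (k := k)) := by
  rw [Fintype.bijective_iff_injective_and_card]
  constructor
  · rintro ⟨l, τ⟩ ⟨l', τ'⟩ h
    have hl : l = l' := by
      rw [← permSnoc_last l τ, h, permSnoc_last]
    subst hl
    refine Prod.ext rfl (Equiv.ext fun i => ?_)
    have := congrArg (fun e => e i.castSucc) h
    simpa using this
  · simp [Fintype.card_perm, Nat.factorial_succ]

theorem sum_perm_succ {k : ℕ} {M : Type*} [AddCommMonoid M]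
    (F : Equiv.Perm (Fin (k + 1)) → M) :
    ∑ σ, F σ = ∑ l, ∑ τ, F (permSnoc (l, τ)) := by
  rw [← (permSnoc_bijective k).sum_comp, Fintype.sum_prod_type]

theorem permanent_succ_last_row {k : ℕ} {R : Type*} [CommSemiring R]
    (M : Matrix (Fin (k + 1)) (Fin (k + 1)) R) :
    M.permanent = ∑ l, M (Fin.last k) l * (M.submatrix Fin.castSucc l.succAbove).permanent := by
  rw [← Matrix.permanent_transpose, Matrix.permanent, sum_perm_succ]
  refine Finset.sum_congr rfl fun l _ => ?_
  rw [← Matrix.permanent_transpose (M.submatrix Fin.castSucc l.succAbove), Matrix.permanent,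
    Finset.mul_sum]
  refine Finset.sum_congr rfl fun τ _ => ?_
  simp [Fin.prod_univ_castSucc, mul_comm]

/-! ### Ryser's formula for repeated rows -/

/-- Up to sign this is the s-th forward difference at 0 of a power of degree less than s. In degree
s it is s!, which gives the next lemma. -/
theorem sum_alternating_choose_pow_of_lt {s e : ℕ} (h : e < s) :
    ∑ x ∈ Finset.range (s + 1), (-1 : ℂ) ^ x * (s.choose x : ℂ) * (x : ℂ) ^ e = 0 := by
  have h1 := fwdDiff_iter_eq_sum_shift (1 : ℂ) (fun r : ℂ => r ^ e) s 0
  rw [fwdDiff_iter_pow_eq_zero_of_lt h] at h1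
  have h2 : ∀ x ∈ Finset.range (s + 1), (-1 : ℂ) ^ x * (s.choose x : ℂ) * (x : ℂ) ^ e =
      (-1) ^ s * (((-1 : ℤ) ^ (s - x) * s.choose x) • (0 + x • (1 : ℂ)) ^ e) := by
    intro x hx
    have hx' : x ≤ s := by simpa [Nat.lt_succ_iff] using hx
    have h3 : (-1 : ℂ) ^ s * (-1) ^ (s - x) = (-1) ^ x := by
      rw [← pow_add, show s + (s - x) = x + 2 * (s - x) by omega, pow_add, pow_mul]
      simp
    rw [← h3]
    simp only [zsmul_eq_mul]
    push_cast
    simp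
    ring
  rw [Finset.sum_congr rfl h2, ← Finset.mul_sum, ← h1]
  simp

theorem sum_alternating_choose_pow_self (s : ℕ) :
    ∑ x ∈ Finset.range (s + 1), (-1 : ℂ) ^ x * (s.choose x : ℂ) * (x : ℂ) ^ s =
      (-1) ^ s * s.factorial := by
  have h1 := fwdDiff_iter_eq_sum_shift (1 : ℂ) (fun r : ℂ => r ^ s) s 0
  rw [fwdDiff_iter_eq_factorial] at h1
  have h2 : ∀ x ∈ Finset.range (s + 1), (-1 : ℂ) ^ x * (s.choose x : ℂ) * (x : ℂ) ^ s =
      (-1) ^ s * (((-1 : ℤ) ^ (s - x) * s.choose x) • (0 + x • (1 : ℂ)) ^ s) := by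
    intro x hx
    have hx' : x ≤ s := by simpa [Nat.lt_succ_iff] using hx
    have h3 : (-1 : ℂ) ^ s * (-1) ^ (s - x) = (-1) ^ x := by
      rw [← pow_add, show s + (s - x) = x + 2 * (s - x) by omega, pow_add, pow_mul]
      simp
    rw [← h3]
    simp only [zsmul_eq_mul]
    push_cast
    simp
    ring
  rw [Finset.sum_congr rfl h2, ← Finset.mul_sum, ← h1]
  simp

theorem prod_comp_eq_prod_pow_mult {d k : ℕ} (f : Fin k → Fin d) (w : Fin d → ℂ) :
    ∏ j, w (f j) = ∏ ν, w ν ^ mult f ν := by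
  rw [← Finset.prod_fiberwise_of_maps_to (t := Finset.univ) (g := f) fun _ _ => Finset.mem_univ _]
  refine Finset.prod_congr rfl fun ν _ => ?_
  rw [Finset.prod_congr rfl (g := fun _ => w ν) fun j hj => by rw [(Finset.mem_filter.1 hj).2],
    Finset.prod_const]
  rfl

/-- Expanding the product of linear forms into monomials indexed by `f`, the sum over `w` factors
over the rows, and row `ν` contributes an alternating sum of powers with exponent `mult f ν`. Only
the `f` with the multiplicities of `z` survive, each with factor (-1)^k ∏ s_ν!. -/
theorem ryser_repeated_rows {d k : ℕ} (b : Fin d → Fin k → ℂ) (z : Fin k → Fin d) :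
    (-1) ^ k * ∑ w ∈ Fintype.piFinset fun ν => Finset.range (mult z ν + 1),
      (∏ ν, (-1) ^ w ν * ((mult z ν).choose (w ν) : ℂ)) * ∏ j, ∑ ν, (w ν : ℂ) * b ν j =
    (Matrix.of fun i j => b (z i) j).permanent := by
  have h1 : ∀ w : Fin d → ℕ, (∏ ν, (-1) ^ w ν * ((mult z ν).choose (w ν) : ℂ)) *
      ∏ j, ∑ ν, (w ν : ℂ) * b ν j = ∑ f : Fin k → Fin d,
        (∏ ν, (-1) ^ w ν * ((mult z ν).choose (w ν) : ℂ) * (w ν : ℂ) ^ mult f ν) *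
          ∏ j, b (f j) j := by
    intro w
    rw [Finset.prod_univ_sum, Fintype.piFinset_univ, Finset.mul_sum]
    refine Finset.sum_congr rfl fun f _ => ?_
    rw [Finset.prod_mul_distrib (f := fun j => (w (f j) : ℂ)),
      prod_comp_eq_prod_pow_mult f fun ν => (w ν : ℂ),
      Finset.prod_mul_distrib (f := fun ν => (-1) ^ w ν * ((mult z ν).choose (w ν) : ℂ))]
    ring
  have h2 : ∀ f : Fin k → Fin d, (∏ ν, ∑ x ∈ Finset.range (mult z ν + 1),
      (-1 : ℂ) ^ x * ((mult z ν).choose x : ℂ) * (x : ℂ) ^ mult f ν) =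
        if mult f = mult z then (-1) ^ k * ((∏ ν, (mult z ν).factorial : ℕ) : ℂ) else 0 := by
    intro f
    split_ifs with hf
    · rw [hf]
      simp_rw [sum_alternating_choose_pow_self]
      rw [Finset.prod_mul_distrib, Finset.prod_pow_eq_pow_sum, sum_mult]
      push_cast
      rfl
    -- Both families of multiplicities add up to k, so if they differ, one exponent is too small and
    -- its alternating sum vanishes.
    · obtain ⟨ν, hν⟩ : ∃ ν, mult f ν < mult z ν := by
        by_contra! h
        refine hf (funext fun ν => ?_)
        have := (Finset.sum_eq_sum_iff_of_le (s := Finset.univ) fun ν _ => h ν).1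
          (by rw [sum_mult, sum_mult])
        exact (this ν (Finset.mem_univ ν)).symm
      exact Finset.prod_eq_zero (Finset.mem_univ ν) (sum_alternating_choose_pow_of_lt hν)
  simp_rw [h1]
  rw [Finset.sum_comm]
  simp_rw [← Finset.sum_mul]
  rw [Finset.sum_congr rfl fun f _ => by
    rw [← Finset.prod_univ_sum (fun ν => Finset.range (mult z ν + 1))
      (fun ν x => (-1 : ℂ) ^ x * ((mult z ν).choose x : ℂ) * (x : ℂ) ^ mult f ν), h2 f]]
  rw [permanent_repeated_rows, Finset.sum_filter, Finset.mul_sum, Finset.mul_sum]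
  refine Finset.sum_congr rfl fun f _ => ?_
  split_ifs
  · rw [← mul_assoc, ← mul_assoc, ← mul_pow]
    simp
  · simp

/-! ### Sums over arrays -/

theorem sum_snoc {m k : ℕ} {M : Type*} [AddCommMonoid M] (F : (Fin (k + 1) → Fin m) → M) :
    ∑ r, F r = ∑ r : Fin k → Fin m, ∑ i, F (Fin.snoc r i) := by
  rw [← (Fin.snocEquiv fun _ => Fin m).sum_comp, Fintype.sum_prod_type, Finset.sum_comm]
  rfl

/-- The product of the factorials of the multiplicities. -/
def factProd {m k : ℕ} (r : Fin k → Fin m) : ℕ := ∏ j, (mult r j).factorial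

/-- The number of words of the Guan code that belongs to the multiplicities of `r`. -/
def codeLength {m k : ℕ} (r : Fin k → Fin m) : ℕ := ∏ j, (mult r j + 1)

theorem factProd_snoc {m k : ℕ} (r : Fin k → Fin m) (i : Fin m) :
    factProd (Fin.snoc r i : Fin (k + 1) → Fin m) = (mult r i + 1) * factProd r := by
  unfold factProd
  rw [← Finset.mul_prod_erase _ _ (Finset.mem_univ i),
    ← Finset.mul_prod_erase _ (fun j => (mult r j).factorial) (Finset.mem_univ i), mult_snoc,
    if_pos rfl, Nat.factorial_succ, mul_assoc]
  congr 2
  refine Finset.prod_congr rfl fun j hj => ?_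
  rw [mult_snoc, if_neg (Finset.ne_of_mem_erase hj).symm, add_zero]

/-- Cross-multiplied in order to stay in the natural numbers; the factor `mult r i + 1` is the one
that `factProd_snoc` supplies. -/
theorem codeLength_snoc {m k : ℕ} (r : Fin k → Fin m) (i : Fin m) :
    (mult r i + 1) * codeLength (Fin.snoc r i : Fin (k + 1) → Fin m) =
      (mult r i + 2) * codeLength r := by
  unfold codeLength
  rw [← Finset.mul_prod_erase _ _ (Finset.mem_univ i),
    ← Finset.mul_prod_erase _ (fun j => mult r j + 1) (Finset.mem_univ i), mult_snoc, if_pos rfl,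
    Finset.prod_congr rfl (g := fun j => mult r j + 1) fun j hj => by
      rw [mult_snoc, if_neg (Finset.ne_of_mem_erase hj).symm, add_zero]]
  ring

/-- A Pólya urn: adding row i multiplies the weight by s_i + 1, and these factors add up to m + k.
-/
theorem sum_factProd (m k : ℕ) :
    ∑ r : Fin k → Fin m, factProd r = ∏ i ∈ Finset.range k, (m + i) := by
  induction k with
  | zero => simp [factProd, mult]
  | succ k ih =>
    rw [sum_snoc, Finset.prod_range_succ, ← ih, Finset.sum_mul]
    refine Finset.sum_congr rfl fun r _ => ?_
    simp_rw [factProd_snoc]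
    rw [← Finset.sum_mul, Finset.sum_add_distrib, sum_mult]
    simp
    ring

/-- The same urn with factors s_i + 2, whose sum is 2m + k. The quotient of the two products is the
mean number of code words. -/
theorem sum_factProd_mul_codeLength (m k : ℕ) :
    ∑ r : Fin k → Fin m, factProd r * codeLength r = ∏ i ∈ Finset.range k, (2 * m + i) := by
  induction k with
  | zero => simp [factProd, codeLength, mult]
  | succ k ih =>
    rw [sum_snoc, Finset.prod_range_succ, ← ih, Finset.sum_mul]
    refine Finset.sum_congr rfl fun r _ => ?_
    have : ∀ i, factProd (Fin.snoc r i : Fin (k + 1) → Fin m) *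
        codeLength (Fin.snoc r i : Fin (k + 1) → Fin m) =
          (mult r i + 2) * (factProd r * codeLength r) := by
      intro i
      rw [factProd_snoc, mul_right_comm, codeLength_snoc]
      ring
    simp_rw [this]
    rw [← Finset.sum_mul, Finset.sum_add_distrib, sum_mult]
    simp
    ring

end BosonSampling

end

noncomputable section

namespace BosonSampling

/-! ### The Guan code -/

/-- The next word of the Guan code.  A digit is given by its largest value, its value and its
direction (`0` for upward). -/
def grayNext : List (ℕ × ℕ × ℕ) → List (ℕ × ℕ × ℕ)
  | [] => []
  | (s, r, d) :: L =>
    if d < 1 then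
      if r < s then (s, r + 1, d) :: L else (s, r, 1) :: grayNext L
    else
      if 0 < r then (s, r - 1, d) :: L else (s, r, 0) :: grayNext L

/-- The digit is at the end of its range that it leaves behind. -/
def IsInitialDigit (x : ℕ × ℕ × ℕ) : Prop := x.2 = (0, 0) ∨ x.2 = (x.1, 1)

/-- The sum of `f` over all words with digits bounded by the entries of a list. -/
def boxSum (f : List ℕ → ℂ) : List ℕ → ℂ
  | [] => f []
  | s :: L => ∑ p ∈ Finset.range (s + 1), boxSum (fun w => f (p :: w)) L

theorem boxSum_sum {ι : Type*} (I : Finset ι) (f : ι → List ℕ → ℂ) (L : List ℕ) :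
    boxSum (fun w => ∑ i ∈ I, f i w) L = ∑ i ∈ I, boxSum (f i) L := by
  induction L generalizing f with
  | nil => rfl
  | cons s L ih =>
    simp only [boxSum]
    rw [Finset.sum_comm]
    exact Finset.sum_congr rfl fun p _ => ih fun i w => f i (p :: w)

theorem grayNext_iterate_up (s : ℕ) (L : List (ℕ × ℕ × ℕ)) {p : ℕ} (hp : p ≤ s) :
    grayNext^[p] ((s, 0, 0) :: L) = (s, p, 0) :: L := by
  induction p with
  | zero => rfl
  | succ p ih =>
    rw [Function.iterate_succ_apply', ih (by omega)]
    simp [grayNext, show p < s by omega]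

theorem grayNext_iterate_down (s : ℕ) (L : List (ℕ × ℕ × ℕ)) {p : ℕ} (hp : p ≤ s) :
    grayNext^[p] ((s, s, 1) :: L) = (s, s - p, 1) :: L := by
  induction p with
  | zero => rfl
  | succ p ih =>
    rw [Function.iterate_succ_apply', ih (by omega)]
    simp [grayNext, show p < s by omega]
    omega

/-- The first digit crosses its range in `x.1` steps; one further step reverses its direction and
advances the rest of the word. -/
theorem grayNext_iterate_sweep {x : ℕ × ℕ × ℕ} (hx : IsInitialDigit x) (L : List (ℕ × ℕ × ℕ)) :
    ∃ y, IsInitialDigit y ∧ y.1 = x.1 ∧ grayNext^[x.1 + 1] (x :: L) = y :: grayNext L := by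
  obtain ⟨s, r, d⟩ := x
  rcases hx with hx | hx <;> simp only [Prod.mk.injEq] at hx <;> obtain ⟨rfl, rfl⟩ := hx
  · refine ⟨(s, s, 1), Or.inr rfl, rfl, ?_⟩
    rw [Function.iterate_succ_apply', grayNext_iterate_up s L le_rfl]
    simp [grayNext]
  · refine ⟨(r, 0, 0), Or.inl rfl, rfl, ?_⟩
    rw [Function.iterate_succ_apply', grayNext_iterate_down r L le_rfl]
    simp [grayNext]

theorem grayNext_iterate_mul {x : ℕ × ℕ × ℕ} (hx : IsInitialDigit x) (L : List (ℕ × ℕ × ℕ))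
    (q : ℕ) : ∃ y, IsInitialDigit y ∧ y.1 = x.1 ∧
      grayNext^[(x.1 + 1) * q] (x :: L) = y :: grayNext^[q] L := by
  induction q with
  | zero => exact ⟨x, hx, rfl, rfl⟩
  | succ q ih =>
    obtain ⟨y, hy, hy', h⟩ := ih
    obtain ⟨z, hz, hz', h'⟩ := grayNext_iterate_sweep hy (grayNext^[q] L)
    refine ⟨z, hz, hz'.trans hy', ?_⟩
    rw [Nat.mul_succ, add_comm, Function.iterate_add_apply, h, ← hy', h',
      Function.iterate_succ_apply']

theorem sum_grayNext_sweep {x : ℕ × ℕ × ℕ} (hx : IsInitialDigit x) (L : List (ℕ × ℕ × ℕ))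
    (f : List ℕ → ℂ) :
    ∑ p ∈ Finset.range (x.1 + 1), f ((grayNext^[p] (x :: L)).map fun y => y.2.1) =
      ∑ p ∈ Finset.range (x.1 + 1), f (p :: L.map fun y => y.2.1) := by
  obtain ⟨s, r, d⟩ := x
  rcases hx with hx | hx <;> simp only [Prod.mk.injEq] at hx <;> obtain ⟨rfl, rfl⟩ := hx
  · refine Finset.sum_congr rfl fun p hp => ?_
    rw [grayNext_iterate_up s L (by simpa [Nat.lt_succ_iff] using hp)]
    rfl
  · rw [← Finset.sum_range_reflect]
    refine Finset.sum_congr rfl fun p hp => ?_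
    have hp' : p ≤ r := by simpa [Nat.lt_succ_iff] using hp
    rw [grayNext_iterate_down r L (by simp)]
    simp only [List.map_cons]
    congr 2
    omega

theorem sum_range_mul_eq {M : Type*} [AddCommMonoid M] (g : ℕ → M) (a b : ℕ) :
    ∑ t ∈ Finset.range (a * b), g t =
      ∑ q ∈ Finset.range b, ∑ p ∈ Finset.range a, g (a * q + p) := by
  induction b with
  | zero => simp
  | succ b ih => rw [Nat.mul_succ, Finset.sum_range_add, ih, Finset.sum_range_succ]

/-- With t = (s + 1) q + p, the tail is the q-th word of its own code while p runs through one sweep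
of the first digit, upward or downward. So every word of the box is visited exactly once. -/
theorem sum_grayNext (L : List (ℕ × ℕ × ℕ)) (hL : ∀ x ∈ L, IsInitialDigit x)
    (f : List ℕ → ℂ) :
    ∑ t ∈ Finset.range (L.map fun x => x.1 + 1).prod,
      f ((grayNext^[t] L).map fun x => x.2.1) = boxSum f (L.map fun x => x.1) := by
  induction L generalizing f with
  | nil => simp [boxSum]
  | cons x L ih =>
    have hx := hL x (by simp)
    rw [List.map_cons, List.prod_cons, sum_range_mul_eq, List.map_cons]
    have h1 : ∀ q, ∑ p ∈ Finset.range (x.1 + 1),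
        f ((grayNext^[(x.1 + 1) * q + p] (x :: L)).map fun x => x.2.1) =
          ∑ p ∈ Finset.range (x.1 + 1), f (p :: (grayNext^[q] L).map fun y => y.2.1) := by
      intro q
      obtain ⟨y, hy, hy', h⟩ := grayNext_iterate_mul hx L q
      rw [← hy', ← sum_grayNext_sweep hy, hy']
      refine Finset.sum_congr rfl fun p _ => ?_
      rw [add_comm, Function.iterate_add_apply, h]
    simp_rw [h1]
    rw [ih (fun y hy => hL y (by simp [hy])) fun w => ∑ p ∈ Finset.range (x.1 + 1), f (p :: w),
      boxSum_sum]
    rfl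

theorem boxSum_ofFn {d : ℕ} (s : Fin d → ℕ) (f : List ℕ → ℂ) :
    boxSum f (List.ofFn s) =
      ∑ w ∈ Fintype.piFinset fun ν => Finset.range (s ν + 1), f (List.ofFn w) := by
  induction d generalizing f with
  | zero => simp [boxSum]
  | succ d ih =>
    rw [List.ofFn_succ]
    simp only [boxSum]
    simp_rw [ih]
    rw [← Finset.sum_product']
    refine Finset.sum_nbij' (fun x => Fin.cons x.1 x.2) (fun w => (w 0, Fin.tail w)) ?_ ?_ ?_ ?_ ?_
    · rintro ⟨p, w⟩ h
      simp only [Finset.mem_product, Fintype.mem_piFinset] at h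
      rw [Fintype.mem_piFinset]
      intro ν
      cases ν using Fin.cases with
      | zero => exact h.1
      | succ ν => exact h.2 ν
    · intro w h
      rw [Fintype.mem_piFinset] at h
      simp only [Finset.mem_product, Fintype.mem_piFinset]
      exact ⟨h 0, fun ν => h ν.succ⟩
    · rintro ⟨p, w⟩ _
      simp
    · intro w _
      simp
    · rintro ⟨p, w⟩ _
      simp [List.ofFn_succ]

end BosonSampling

end

noncomputable section

namespace BosonSampling

/-! ### Reading and writing the memory -/

namespace State

variable (σ : State)

@[simp] theorem tick_int (t : ℕ) : (σ.tick t).int = σ.int := rfl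
@[simp] theorem tick_num (t : ℕ) : (σ.tick t).num = σ.num := rfl
@[simp] theorem tick_time (t : ℕ) : (σ.tick t).time = σ.time + t := rfl
@[simp] theorem setI_num (x : IVar) (i a : ℕ) : (σ.setI x i a).num = σ.num := rfl
@[simp] theorem setI_time (x : IVar) (i a : ℕ) : (σ.setI x i a).time = σ.time := rfl
@[simp] theorem setN_int (x : NVar) (i : ℕ) (a : ℂ) : (σ.setN x i a).int = σ.int := rfl
@[simp] theorem setN_time (x : NVar) (i : ℕ) (a : ℂ) : (σ.setN x i a).time = σ.time := rfl

@[simp] theorem setI_int_self (x : IVar) (i a : ℕ) :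
    (σ.setI x i a).int x = Function.update (σ.int x) i a :=
  Function.update_self _ _ _

@[simp] theorem setN_num_self (x : NVar) (i : ℕ) (a : ℂ) :
    (σ.setN x i a).num x = Function.update (σ.num x) i a :=
  Function.update_self _ _ _

@[simp] theorem setI_int_of_ne {x y : IVar} (h : y ≠ x) (i a : ℕ) :
    (σ.setI x i a).int y = σ.int y :=
  Function.update_of_ne h _ _

@[simp] theorem setN_num_of_ne {x y : NVar} (h : y ≠ x) (i : ℕ) (a : ℂ) :
    (σ.setN x i a).num y = σ.num y :=
  Function.update_of_ne h _ _

end State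

attribute [simp] IExpr.eval NExpr.eval IExpr.cost NExpr.cost iv nv inc sj rj ajl

variable {A : ℕ → ℕ → ℂ}

/-! ### Deterministic parts of the sampler -/

/-- The forward pass stores coef · ∏_{j<l} lin[j]. The backward pass meets l = k - v in round v,
when `acc` is the product over j > l. All k + 1 products with one factor omitted thus cost O(k + 1),
without divisions. -/
theorem exec_addTerms {σ : State} {k : ℕ} (hk : σ.int .k 0 = k) :
    Exec A addTerms σ fun τ => (∀ l ≤ k, τ.num .minor l = σ.num .minor l +
      σ.num .coef 0 * ∏ j ∈ (Finset.range (k + 1)).erase l, σ.num .lin j) ∧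
      τ.time ≤ σ.time + 100 * (k + 1) := by
  unfold addTerms
  refine exec_seq (exec_setN (exec_seq ((exec_loop (fun v τ => τ.int .k 0 = k ∧
    τ.num .lin = σ.num .lin ∧ τ.num .minor = σ.num .minor ∧
    (∀ l < v, τ.num .fwd l = σ.num .coef 0 * ∏ j ∈ Finset.range l, σ.num .lin j) ∧
    τ.num .acc 0 = σ.num .coef 0 * ∏ j ∈ Finset.range v, σ.num .lin j ∧
    τ.time ≤ σ.time + 9 + 14 * v) ?_ ?_).mono ?_)))
  · simp [hk]
  · rintro v τ hv ⟨h1, h2, h3, h4, h5, h6⟩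
    refine exec_seq (exec_setN (exec_setN ?_))
    simp only [State.tick_int, State.tick_num, State.tick_time, IExpr.eval, NExpr.eval,
      State.setI_int_self, Function.update_self, iv, nv]
    refine ⟨by simpa using h1, by simpa using h2, by simpa using h3, ?_, ?_, ?_⟩
    · intro l hl
      by_cases hlv : l = v
      · subst hlv
        simp [h5]
      · simp [hlv, h4 l (by omega)]
    · simp [h5, h2, Finset.prod_range_succ, mul_assoc]
    · simp
      omega
  · rintro τ ⟨h1, h2, h3, h4, h5, h6⟩
    simp only [inc, iv, IExpr.eval, State.tick_int, State.setN_int, hk] at h1 h2 h3 h4 h5 h6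
    refine exec_seq (exec_setN ((exec_loop (fun v ρ => ρ.int .k 0 = k ∧
      ρ.num .lin = σ.num .lin ∧ ρ.num .fwd = τ.num .fwd ∧
      (∀ l, l + v ≤ k → ρ.num .minor l = σ.num .minor l) ∧
      (∀ l ≤ k, k < l + v → ρ.num .minor l = σ.num .minor l +
        σ.num .coef 0 * ∏ j ∈ (Finset.range (k + 1)).erase l, σ.num .lin j) ∧
      ρ.num .acc 0 = ∏ j ∈ Finset.Ico (k + 1 - v) (k + 1), σ.num .lin j ∧
      ρ.time ≤ τ.time + 9 + 60 * v) ?_ ?_).mono ?_))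
    · simp [h1, h2, h3]
      intro l hl hl'
      omega
    · rintro v ρ hv ⟨g1, g2, g3, g4, g5, g6, g7⟩
      simp only [inc, iv, IExpr.eval, State.tick_int, State.setN_int, h1] at hv
      refine exec_seq (exec_setN (exec_setN ?_))
      have hkv : k - v + v = k := by omega
      refine ⟨by simpa using g1, by simpa using g2, by simpa using g3, ?_, ?_, ?_, ?_⟩
      · intro l hl
        simp [g1, show l ≠ k - v by omega, g4 l (by omega)]
      · intro l hl hl'
        by_cases hlv : l = k - v
        · subst hlv
          simp only [State.tick_int, State.tick_num, IExpr.eval, NExpr.eval, iv, nv, ne_eq,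
            reduceCtorEq, not_false_eq_true, State.setI_int_of_ne, State.setI_int_self,
            State.setN_int, State.setI_num, State.setN_num_self, State.setN_num_of_ne,
            Function.update_self, g1, g3, g4 _ hkv.le, h4 (k - v) (by omega), g6]
          rw [mul_assoc]
          congr 2
          have h : (Finset.range (k + 1)).erase (k - v) =
              Finset.range (k - v) ∪ Finset.Ico (k + 1 - v) (k + 1) := by
            ext j
            simp only [Finset.mem_erase, Finset.mem_range, Finset.mem_union, Finset.mem_Ico]
            omega
          rw [h, Finset.prod_union]
          rw [Finset.disjoint_left]
          intro j hj hj'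
          simp only [Finset.mem_range, Finset.mem_Ico] at hj hj'
          omega
        · simp [g1, hlv, g5 l hl (by omega)]
      · have h : Finset.Ico (k + 1 - (v + 1)) (k + 1) =
            insert (k - v) (Finset.Ico (k + 1 - v) (k + 1)) := by
          ext j
          simp only [Finset.mem_insert, Finset.mem_Ico]
          omega
        rw [h, Finset.prod_insert (by simp; omega)]
        simp [g1, g6, g2, mul_comm]
      · simp
        omega
    · rintro ρ ⟨g1, g2, g3, g4, g5, g6, g7⟩
      simp only [inc, iv, IExpr.eval, State.tick_int, State.setN_int, h1] at g5 g7
      exact ⟨fun l hl => g5 l hl (by omega), by omega⟩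

end BosonSampling

end

/-! ### One step of the Guan code in memory. -/

noncomputable section

namespace BosonSampling

variable {A : ℕ → ℕ → ℂ}

/-- The digits of the code word with indices in the list `J`. -/
def digits (S r dir : ℕ → ℕ) (J : List ℕ) : List (ℕ × ℕ × ℕ) := J.map fun j => (S j, r j, dir j)

theorem digits_congr {S r dir r' dir' : ℕ → ℕ} {J : List ℕ}
    (h : ∀ j ∈ J, r j = r' j ∧ dir j = dir' j) : digits S r dir J = digits S r' dir' J :=
  List.map_congr_left fun j hj => by rw [(h j hj).1, (h j hj).2]

/-- The signed product of binomial coefficients that belongs to a code word. -/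
def codeCoef (c : ℂ) (S : ℕ → ℕ) (d : ℕ) (r : ℕ → ℕ) : ℂ :=
  c * ∏ ν ∈ Finset.range d, ((-1) ^ r ν * ((S ν).choose (r ν) : ℂ))

/-- The linear form that belongs to a code word. -/
def codeLin (a : ℕ → ℂ) (d : ℕ) (r : ℕ → ℕ) : ℂ := ∑ ν ∈ Finset.range d, (r ν : ℂ) * a ν

theorem prod_range_update {M : Type*} [CommMonoid M] (g : ℕ → ℕ → M) {d v : ℕ} (hv : v < d)
    (r : ℕ → ℕ) (y : ℕ) :
    ∏ ν ∈ Finset.range d, g ν (Function.update r v y ν) =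
      g v y * ∏ ν ∈ (Finset.range d).erase v, g ν (r ν) := by
  rw [← Finset.mul_prod_erase _ _ (Finset.mem_range.2 hv), Function.update_self]
  congr 1
  refine Finset.prod_congr rfl fun ν hν => ?_
  rw [Function.update_of_ne (Finset.ne_of_mem_erase hν)]

/-- From C(s, r + 1)(r + 1) = C(s, r)(s - r) and a change of sign. With truncated subtraction this
holds for every r, so no bound on the digit is required. -/
theorem codeCoef_update_succ (c : ℂ) (S : ℕ → ℕ) {d v : ℕ} (hv : v < d) (r : ℕ → ℕ) :
    codeCoef c S d (Function.update r v (r v + 1)) =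
      0 - codeCoef c S d r * ((S v - r v : ℕ) : ℂ) / ((r v + 1 : ℕ) : ℂ) := by
  unfold codeCoef
  rw [prod_range_update (fun ν x => (-1 : ℂ) ^ x * ((S ν).choose x : ℂ)) hv,
    ← Finset.mul_prod_erase (Finset.range d) (fun ν => (-1 : ℂ) ^ r ν * ((S ν).choose (r ν) : ℂ))
      (Finset.mem_range.2 hv)]
  have h1 : ((S v).choose (r v + 1) : ℂ) * ((r v + 1 : ℕ) : ℂ) =
      ((S v).choose (r v) : ℂ) * ((S v - r v : ℕ) : ℂ) := by
    exact_mod_cast Nat.choose_succ_right_eq (S v) (r v)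
  have h2 : ((r v + 1 : ℕ) : ℂ) ≠ 0 := Nat.cast_ne_zero.2 (Nat.succ_ne_zero _)
  rw [eq_comm, zero_sub, neg_eq_iff_eq_neg, div_eq_iff h2, pow_succ]
  linear_combination c * (-1) ^ r v * (∏ ν ∈ (Finset.range d).erase v,
    (-1) ^ r ν * ((S ν).choose (r ν) : ℂ)) * (-h1)

/-- The upward rule, applied to the word with the smaller digit and solved for the old coefficient;
`r v ≤ S v` makes the divisor nonzero. -/
theorem codeCoef_update_pred (c : ℂ) (S : ℕ → ℕ) {d v : ℕ} (hv : v < d) (r : ℕ → ℕ)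
    (h : 0 < r v) (h' : r v ≤ S v) : codeCoef c S d (Function.update r v (r v - 1)) =
      0 - codeCoef c S d r * ((r v : ℕ) : ℂ) / ((S v - r v + 1 : ℕ) : ℂ) := by
  obtain ⟨x, hx⟩ : ∃ x, r v = x + 1 := ⟨r v - 1, by omega⟩
  have h1 := codeCoef_update_succ c S hv (Function.update r v x)
  rw [Function.update_self, Function.update_idem, ← hx, Function.update_eq_self] at h1
  have h2 : ((r v : ℕ) : ℂ) ≠ 0 := by exact_mod_cast h.ne'
  have h3 : ((S v - x : ℕ) : ℂ) ≠ 0 := by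
    have : S v - x ≠ 0 := by omega
    exact_mod_cast this
  rw [show S v - r v + 1 = S v - x by omega, show r v - 1 = x by omega, h1]
  field_simp
  ring

theorem codeLin_update (a : ℕ → ℂ) {d v : ℕ} (hv : v < d) (r : ℕ → ℕ) (y : ℕ) :
    codeLin a d (Function.update r v y) = codeLin a d r + ((y : ℂ) - r v) * a v := by
  unfold codeLin
  rw [← Finset.add_sum_erase _ _ (Finset.mem_range.2 hv),
    ← Finset.add_sum_erase (Finset.range d) (fun ν => (r ν : ℂ) * a ν) (Finset.mem_range.2 hv),
    Function.update_self, Finset.sum_congr rfl (g := fun ν => (r ν : ℂ) * a ν) fun ν hν => by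
      rw [Function.update_of_ne (Finset.ne_of_mem_erase hν)]]
  ring

/-- The memory describes the word of a Guan code with `d` digits, largest digits `S` and rows
`value`, together with the coefficient and the linear forms that belong to it. -/
structure IsCodeState (A : ℕ → ℕ → ℂ) (c : ℂ) (k d : ℕ) (value s perm : ℕ → ℕ) (σ : State) :
    Prop where
  k_eq : σ.int .k 0 = k
  d_eq : σ.int .distinct 0 = d
  value_eq : σ.int .value = value
  s_eq : σ.int .s = s
  perm_eq : σ.int .perm = perm
  r_le : ∀ j < d, σ.int .r j ≤ s (value j)
  coef_eq : σ.num .coef 0 = codeCoef c (s ∘ value) d (σ.int .r)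
  lin_eq : ∀ l ≤ k, σ.num .lin l = codeLin (fun ν => A (value ν) (perm l)) d (σ.int .r)

theorem exec_lin_add {σ : State} {k : ℕ} (hk : σ.int .k 0 = k) :
    Exec A (.loop .l (inc (iv .k)) (.setN .lin (iv .l) (.add (.get .lin (iv .l)) ajl))) σ
      fun τ => (∀ l ≤ k, τ.num .lin l = σ.num .lin l +
        A (σ.int .value (σ.int .j 0)) (σ.int .perm l)) ∧ τ.time ≤ σ.time + 40 * (k + 1) := by
  refine (exec_loop (fun v τ => τ.int .k 0 = k ∧ τ.int .value = σ.int .value ∧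
    τ.int .j = σ.int .j ∧ τ.int .perm = σ.int .perm ∧
    (∀ l < v, τ.num .lin l = σ.num .lin l + A (σ.int .value (σ.int .j 0)) (σ.int .perm l)) ∧
    (∀ l, v ≤ l → τ.num .lin l = σ.num .lin l) ∧ τ.time ≤ σ.time + 20 + 20 * v) ?_ ?_).mono ?_
  · simp [hk]
  · rintro v τ hv ⟨h1, h2, h3, h4, h5, h6, h7⟩
    refine exec_setN ⟨by simpa using h1, by simpa using h2, by simpa using h3, by simpa using h4,
      ?_, ?_, ?_⟩
    · intro l hl
      by_cases hlv : l = v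
      · subst hlv
        simp [h2, h3, h4, h6 l le_rfl]
      · simp [hlv, h5 l (by omega)]
    · intro l hl
      simp [show l ≠ v by omega, h6 l (by omega)]
    · simp
      omega
  · rintro τ ⟨h1, h2, h3, h4, h5, h6, h7⟩
    simp only [inc, iv, IExpr.eval, hk] at h5 h7
    exact ⟨fun l hl => h5 l (by omega), by omega⟩

theorem exec_lin_sub {σ : State} {k : ℕ} (hk : σ.int .k 0 = k) :
    Exec A (.loop .l (inc (iv .k)) (.setN .lin (iv .l) (.sub (.get .lin (iv .l)) ajl))) σ
      fun τ => (∀ l ≤ k, τ.num .lin l = σ.num .lin l -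
        A (σ.int .value (σ.int .j 0)) (σ.int .perm l)) ∧ τ.time ≤ σ.time + 40 * (k + 1) := by
  refine (exec_loop (fun v τ => τ.int .k 0 = k ∧ τ.int .value = σ.int .value ∧
    τ.int .j = σ.int .j ∧ τ.int .perm = σ.int .perm ∧
    (∀ l < v, τ.num .lin l = σ.num .lin l - A (σ.int .value (σ.int .j 0)) (σ.int .perm l)) ∧
    (∀ l, v ≤ l → τ.num .lin l = σ.num .lin l) ∧ τ.time ≤ σ.time + 20 + 20 * v) ?_ ?_).mono ?_
  · simp [hk]
  · rintro v τ hv ⟨h1, h2, h3, h4, h5, h6, h7⟩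
    refine exec_setN ⟨by simpa using h1, by simpa using h2, by simpa using h3, by simpa using h4,
      ?_, ?_, ?_⟩
    · intro l hl
      by_cases hlv : l = v
      · subst hlv
        simp [h2, h3, h4, h6 l le_rfl]
      · simp [hlv, h5 l (by omega)]
    · intro l hl
      simp [show l ≠ v by omega, h6 l (by omega)]
    · simp
      omega
  · rintro τ ⟨h1, h2, h3, h4, h5, h6, h7⟩
    simp only [inc, iv, IExpr.eval, hk] at h5 h7
    exact ⟨fun l hl => h5 l (by omega), by omega⟩

theorem digits_range_split (S r dir r' dir' : ℕ → ℕ) {v d : ℕ} (hv : v < d)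
    (h : ∀ j, v < j → r' j = r j ∧ dir' j = dir j) :
    digits S r' dir' (List.range d) = digits S r' dir' (List.range v) ++
      (S v, r' v, dir' v) :: digits S r dir (List.range' (v + 1) (d - v - 1)) := by
  rw [digits_congr (r := r) (dir := dir) (r' := r') (dir' := dir')
    (J := List.range' (v + 1) (d - v - 1)) fun j hj => by
      have := (List.mem_range'_1.1 hj).1
      exact ⟨(h j (by omega)).1.symm, (h j (by omega)).2.symm⟩]
  have : List.range d = List.range v ++ v :: List.range' (v + 1) (d - v - 1) := by
    rw [List.range_eq_range', List.range_eq_range', ← List.range'_succ,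
      show d - v - 1 + 1 = d - v by omega]
    have := List.range'_append (s := 0) (m := v) (n := d - v) (step := 1)
    simp only [one_mul, zero_add] at this
    rw [this, show v + (d - v) = d by omega]
  rw [this]
  simp [digits]

theorem digits_range'_cons (S r dir : ℕ → ℕ) {v d : ℕ} (hv : v < d) :
    digits S r dir (List.range' v (d - v)) =
      (S v, r v, dir v) :: digits S r dir (List.range' (v + 1) (d - v - 1)) := by
  rw [show d - v = (d - v - 1) + 1 by omega, List.range'_succ]
  simp [digits]

theorem digits_range_succ (S r dir r' dir' : ℕ → ℕ) {v : ℕ}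
    (h : ∀ j < v, r' j = r j ∧ dir' j = dir j) :
    digits S r' dir' (List.range (v + 1)) =
      digits S r dir (List.range v) ++ [(S v, r' v, dir' v)] := by
  rw [digits_congr (r := r) (dir := dir) (r' := r') (dir' := dir') (J := List.range v) fun j hj =>
    by simpa [eq_comm] using h j (List.mem_range.1 hj), List.range_succ]
  simp [digits]

/-- Until a digit moves, the invariant says that the successor of the whole word consists of the
digits already reversed followed by the successor of the untouched tail. Once a digit has moved, the
word in memory is the successor. The linear forms are updated for at most one digit, which keeps the
cost at O(k + 1 + d). -/
theorem exec_nextCode {σ : State} {c : ℂ} {k d : ℕ} {value s perm : ℕ → ℕ}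
    (hσ : IsCodeState A c k d value s perm σ) :
    Exec A nextCode σ fun τ => IsCodeState A c k d value s perm τ ∧
      digits (s ∘ value) (τ.int .r) (τ.int .dir) (List.range d) =
        grayNext (digits (s ∘ value) (σ.int .r) (σ.int .dir) (List.range d)) ∧
      τ.time ≤ σ.time + 200 * (k + 1) + 100 * d := by
  unfold nextCode
  refine exec_seq (exec_setI ((exec_loop (fun v τ => IsCodeState A c k d value s perm τ ∧
    ((τ.int .found 0 = 0 ∧ (∀ j, v ≤ j → τ.int .r j = σ.int .r j ∧ τ.int .dir j = σ.int .dir j) ∧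
      grayNext (digits (s ∘ value) (σ.int .r) (σ.int .dir) (List.range d)) =
        digits (s ∘ value) (τ.int .r) (τ.int .dir) (List.range v) ++
        grayNext (digits (s ∘ value) (σ.int .r) (σ.int .dir) (List.range' v (d - v))) ∧
      τ.time ≤ σ.time + 100 * v + 10) ∨
     (τ.int .found 0 = 1 ∧ digits (s ∘ value) (τ.int .r) (τ.int .dir) (List.range d) =
        grayNext (digits (s ∘ value) (σ.int .r) (σ.int .dir) (List.range d)) ∧
      τ.time ≤ σ.time + 100 * v + 10 + 100 * (k + 1)))) ?_ ?_).mono ?_))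
  · obtain ⟨g1, g2, g3, g4, g5, g6, g7, g8⟩ := hσ
    refine ⟨⟨by simpa using g1, by simpa using g2, by simpa using g3, by simpa using g4,
      by simpa using g5, by simpa using g6, by simpa using g7, by simpa using g8⟩, Or.inl ?_⟩
    simp [List.range_eq_range', digits]
  · rintro v τ hv ⟨hτ, h⟩
    have hvd : v < d := by simpa [hσ.d_eq] using hv
    obtain ⟨g1, g2, g3, g4, g5, g6, g7, g8⟩ := hτ
    have g6v := g6 v hvd
    refine exec_ifLt (fun hf => ?_) (fun hf => ?_)
    · have hf' : τ.int .found 0 < 1 := by simpa using hf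
      rcases h with ⟨-, h2, h3, h4⟩ | ⟨h1, -, -⟩
      swap
      · omega
      obtain ⟨hr, hd⟩ := h2 v le_rfl
      rw [digits_range'_cons _ _ _ hvd] at h3
      refine exec_ifLt (fun hdir => ?_) (fun hdir => ?_)
      · have hdir' : σ.int .dir v < 1 := by simpa [hd] using hdir
        refine exec_ifLt (fun hlt => ?_) (fun hlt => ?_)
        · have hlt' : σ.int .r v < s (value v) := by simpa [g3, g4, hr] using hlt
          refine exec_seq (exec_setN (exec_seq (exec_setI (exec_seq
            ((exec_lin_add (k := k) ?_).frame.mono ?_)))))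
          · simpa using g1
          rintro ρ ⟨⟨hρi, hρn⟩, hρl, hρt⟩
          have e1 := hρi .k (by rfl)
          have e2 := hρi .distinct (by rfl)
          have e3 := hρi .value (by rfl)
          have e4 := hρi .s (by rfl)
          have e5 := hρi .perm (by rfl)
          have e6 := hρi .r (by rfl)
          have e7 := hρi .dir (by rfl)
          have e8 := hρn .coef (by rfl)
          simp at e1 e2 e3 e4 e5 e6 e7 e8 hρl hρt
          refine exec_setI ⟨⟨?_, ?_, ?_, ?_, ?_, ?_, ?_, ?_⟩, Or.inr ⟨?_, ?_, ?_⟩⟩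
          · simpa [e1] using g1
          · simpa [e2] using g2
          · simpa [e3] using g3
          · simpa [e4] using g4
          · simpa [e5] using g5
          · intro j hj
            by_cases hjv : j = v
            · subst hjv
              simpa [e6, hr] using hlt'
            · simpa [e6, hjv] using g6 j hj
          · have := codeCoef_update_succ c (s ∘ value) hvd (τ.int .r)
            simp [e8, e6, g3, g4, this, g7]
          · intro l hl
            simp [hρl l hl, e6, codeLin_update _ hvd, g8 l hl, g3, g5]
          · simp
          · rw [h3]
            rw [digits_range_split (s ∘ value) (σ.int .r) (σ.int .dir) _ _ hvd]
            · rw [digits_congr (r' := τ.int .r) (dir' := τ.int .dir) (J := List.range v)]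
              · simp [grayNext, e6, e7, hdir', hlt', hr, hd]
              · intro j hj
                have : j ≠ v := (List.mem_range.1 hj).ne
                simp [e6, e7, this]
            · intro j hj
              simpa [e6, e7, show j ≠ v by omega] using h2 j (by omega)
          · simp
            omega
        · have hlt' : ¬ σ.int .r v < s (value v) := by simpa [g3, g4, hr] using hlt
          refine exec_setI ⟨⟨?_, ?_, ?_, ?_, ?_, ?_, ?_, ?_⟩, Or.inl ⟨?_, ?_, ?_, ?_⟩⟩
          · simpa using g1
          · simpa using g2
          · simpa using g3
          · simpa using g4
          · simpa using g5
          · simpa using g6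
          · simpa using g7
          · simpa using g8
          · simpa using hf'
          · intro j hj
            simpa [show j ≠ v by omega] using h2 j (by omega)
          · rw [h3, digits_range_succ (s ∘ value) (τ.int .r) (τ.int .dir)]
            · simp [grayNext, hdir', hlt', hr, Nat.sub_sub]
            · intro j hj
              simp [hj.ne]
          · simp
            omega
      · have hdir' : ¬ σ.int .dir v < 1 := by simpa [hd] using hdir
        refine exec_ifLt (fun hlt => ?_) (fun hlt => ?_)
        · have hlt' : 0 < σ.int .r v := by simpa [g3, g4, hr] using hlt
          refine exec_seq (exec_setN (exec_seq (exec_setI (exec_seq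
            ((exec_lin_sub (k := k) ?_).frame.mono ?_)))))
          · simpa using g1
          rintro ρ ⟨⟨hρi, hρn⟩, hρl, hρt⟩
          have e1 := hρi .k (by rfl)
          have e2 := hρi .distinct (by rfl)
          have e3 := hρi .value (by rfl)
          have e4 := hρi .s (by rfl)
          have e5 := hρi .perm (by rfl)
          have e6 := hρi .r (by rfl)
          have e7 := hρi .dir (by rfl)
          have e8 := hρn .coef (by rfl)
          simp at e1 e2 e3 e4 e5 e6 e7 e8 hρl hρt
          refine exec_setI ⟨⟨?_, ?_, ?_, ?_, ?_, ?_, ?_, ?_⟩, Or.inr ⟨?_, ?_, ?_⟩⟩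
          · simpa [e1] using g1
          · simpa [e2] using g2
          · simpa [e3] using g3
          · simpa [e4] using g4
          · simpa [e5] using g5
          · intro j hj
            by_cases hjv : j = v
            · subst hjv
              simp [e6]
              omega
            · simpa [e6, hjv] using g6 j hj
          · have := codeCoef_update_pred c (s ∘ value) hvd (τ.int .r) (by simpa [hr] using hlt')
              g6v
            simp [e8, e6, g3, g4, this, g7]
          · intro l hl
            rw [← hr] at hlt'
            simp [hρl l hl, e6, codeLin_update _ hvd, g8 l hl, g3, g5, Nat.cast_sub hlt']
            ring
          · simp
          · rw [h3]
            rw [digits_range_split (s ∘ value) (σ.int .r) (σ.int .dir) _ _ hvd]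
            · rw [digits_congr (r' := τ.int .r) (dir' := τ.int .dir) (J := List.range v)]
              · simp [grayNext, e6, e7, hdir', hlt', hr, hd]
              · intro j hj
                have : j ≠ v := (List.mem_range.1 hj).ne
                simp [e6, e7, this]
            · intro j hj
              simpa [e6, e7, show j ≠ v by omega] using h2 j (by omega)
          · simp
            omega
        · have hlt' : ¬ 0 < σ.int .r v := by simpa [g3, g4, hr] using hlt
          refine exec_setI ⟨⟨?_, ?_, ?_, ?_, ?_, ?_, ?_, ?_⟩, Or.inl ⟨?_, ?_, ?_, ?_⟩⟩
          · simpa using g1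
          · simpa using g2
          · simpa using g3
          · simpa using g4
          · simpa using g5
          · simpa using g6
          · simpa using g7
          · simpa using g8
          · simpa using hf'
          · intro j hj
            simpa [show j ≠ v by omega] using h2 j (by omega)
          · rw [h3, digits_range_succ (s ∘ value) (τ.int .r) (τ.int .dir)]
            · simp [grayNext, hdir', hlt', hr, Nat.sub_sub]
            · intro j hj
              simp [hj.ne]
          · simp
            omega
    · have hf' : ¬ τ.int .found 0 < 1 := by simpa using hf
      rcases h with ⟨h1, -, -⟩ | ⟨h1, h2, h3⟩
      · omega
      refine exec_skip ⟨⟨by simpa using g1, by simpa using g2, by simpa using g3,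
        by simpa using g4, by simpa using g5, by simpa using g6, by simpa using g7,
        by simpa using g8⟩, Or.inr ⟨by simpa using h1, by simpa using h2, ?_⟩⟩
      simp
      omega
  · rintro τ ⟨hτ, h⟩
    refine ⟨hτ, ?_⟩
    simp only [iv, IExpr.eval, State.tick_int, ne_eq, reduceCtorEq, not_false_eq_true,
      State.setI_int_of_ne, hσ.d_eq] at h
    rcases h with ⟨-, -, h1, h2⟩ | ⟨-, h1, h2⟩
    -- No digit could move: the word was the last one, its tail is empty, and only directions have
    -- changed, so coefficient and linear forms still fit.
    · rw [h1]
      simp [digits, grayNext]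
      omega
    · exact ⟨h1, by omega⟩

end BosonSampling

end

/-! ### The minors by Ryser's formula and the weights by Laplace expansion. -/

noncomputable section

namespace BosonSampling

variable {A : ℕ → ℕ → ℂ}

/-- Integers can only be added, so multiplying `count` by s_i + 1 takes s_i + 1 additions, paid for
by the sum of the multiplicities. Rows with s_i = 0 contribute the factor 1, so the product over the
distinct rows is the product over all rows. -/
theorem exec_initCode {σ : State} {m : ℕ} {s : ℕ → ℕ} (hm : σ.int .m 0 = m) (hs : σ.int .s = s) :
    Exec A initCode σ fun τ => ∃ d, τ.int .distinct 0 = d ∧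
      (∀ ν < d, τ.int .value ν < m ∧ 0 < s (τ.int .value ν)) ∧
      (∀ ν < d, ∀ ν' < d, τ.int .value ν = τ.int .value ν' → ν = ν') ∧
      (∀ i < m, 0 < s i → ∃ ν < d, τ.int .value ν = i) ∧
      (∀ ν < d, τ.int .r ν = 0 ∧ τ.int .dir ν = 0) ∧
      τ.int .count 0 = ∏ i ∈ Finset.range m, (s i + 1) ∧
      ∏ ν ∈ Finset.range d, (s (τ.int .value ν) + 1) = ∏ i ∈ Finset.range m, (s i + 1) ∧
      d ≤ ∑ i ∈ Finset.range m, s i ∧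
      τ.time ≤ σ.time + 100 * (m + ∑ i ∈ Finset.range m, s i) + 100 := by
  unfold initCode
  refine exec_seq (exec_setI (exec_seq (exec_setI ((exec_loop (fun v τ => τ.int .s = s ∧
    ∃ d, τ.int .distinct 0 = d ∧
      (∀ ν < d, τ.int .value ν < v ∧ 0 < s (τ.int .value ν)) ∧
      (∀ ν < d, ∀ ν' < d, τ.int .value ν = τ.int .value ν' → ν = ν') ∧
      (∀ i < v, 0 < s i → ∃ ν < d, τ.int .value ν = i) ∧
      (∀ ν < d, τ.int .r ν = 0 ∧ τ.int .dir ν = 0) ∧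
      τ.int .count 0 = ∏ i ∈ Finset.range v, (s i + 1) ∧
      ∏ ν ∈ Finset.range d, (s (τ.int .value ν) + 1) = ∏ i ∈ Finset.range v, (s i + 1) ∧
      d ≤ ∑ i ∈ Finset.range v, s i ∧
      τ.time ≤ σ.time + 100 * (v + ∑ i ∈ Finset.range v, s i) + 100) ?_ ?_).mono ?_))))
  · simp [hs]
  · rintro v τ hv ⟨h0, d, h1, h2, h3, h4, h5, h6, h7, h8, h9⟩
    refine exec_ifLt (fun hsv => ?_) (fun hsv => ?_)
    · have hsv' : 0 < s v := by simpa [h0] using hsv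
      refine exec_seq (exec_setI (exec_seq (exec_setI (exec_seq (exec_setI (exec_seq (exec_setI
        (exec_seq (exec_setI (exec_seq ((exec_loop (fun j ρ =>
          ρ.int .aux 0 = j * ∏ i ∈ Finset.range v, (s i + 1) ∧
          ρ.int .count 0 = ∏ i ∈ Finset.range v, (s i + 1) ∧
          ρ.time ≤ τ.time + 20 * j + 60) ?_ ?_).frame.mono ?_)))))))))))
      · simp [h6]
      · rintro j ρ hj ⟨g1, g2, g3⟩
        refine exec_setI ⟨?_, ?_, ?_⟩
        · simp [g1, g2]
          ring
        · simpa using g2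
        · simp
          omega
      · rintro ρ ⟨⟨hρi, -⟩, g1, g2, g3⟩
        simp [h0] at g1 g3
        have e1 := hρi .s (by rfl)
        have e2 := hρi .distinct (by rfl)
        have e3 := hρi .value (by rfl)
        have e4 := hρi .r (by rfl)
        have e5 := hρi .dir (by rfl)
        simp [h1] at e1 e2 e3 e4 e5
        refine exec_setI ⟨by simpa [e1] using h0, d + 1, by simp [e2], ?_, ?_, ?_, ?_, ?_, ?_, ?_,
          ?_⟩
        · intro ν hν
          by_cases hνd : ν = d
          · subst hνd
            simp [e3, hsv']
          · have := h2 ν (by omega)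
            simp [e3, hνd, this.2]
            omega
        · intro ν hν ν' hν' h
          simp [e3, Function.update_apply] at h
          split_ifs at h with h10 h11 h11
          · omega
          · have := h2 ν' (by omega)
            omega
          · have := h2 ν (by omega)
            omega
          · exact h3 ν (by omega) ν' (by omega) h
        · intro i hi hsi
          by_cases hiv : i = v
          · subst hiv
            exact ⟨d, by omega, by simp [e3]⟩
          · obtain ⟨ν, hν, hν'⟩ := h4 i (by omega) hsi
            exact ⟨ν, by omega, by simp [e3, hν.ne, hν']⟩
        · intro ν hν
          by_cases hνd : ν = d
          · subst hνd
            simp [e4, e5]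
          · simpa [e4, e5, hνd] using h5 ν (by omega)
        · simp [g1, Finset.prod_range_succ, mul_comm]
        · rw [Finset.prod_range_succ, Finset.prod_range_succ, ← h7]
          simp [e3]
          refine Finset.prod_congr rfl fun ν hν => ?_
          simp [(Finset.mem_range.1 hν).ne]
        · rw [Finset.sum_range_succ]
          omega
        · rw [Finset.sum_range_succ]
          simp
          omega
    · have hsv' : s v = 0 := by simpa [h0] using hsv
      refine exec_skip ⟨by simpa using h0, d, by simpa using h1, ?_, by simpa using h3, ?_,
        by simpa using h5, ?_, ?_, ?_, ?_⟩
      · intro ν hν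
        have := h2 ν hν
        simp [this.2]
        omega
      · intro i hi hsi
        have : i ≠ v := by
          rintro rfl
          omega
        simpa using h4 i (by omega) hsi
      · simpa [Finset.prod_range_succ, hsv'] using h6
      · simpa [Finset.prod_range_succ, hsv'] using h7
      · simpa [Finset.sum_range_succ, hsv'] using h8
      · simp [Finset.sum_range_succ, hsv']
        omega
  · rintro τ ⟨-, h⟩
    simpa [hm] using h

/-- The term of Ryser's formula for the minor `l` that belongs to the code word `w`. -/
def ryserTerm (A : ℕ → ℕ → ℂ) (c : ℂ) (k d : ℕ) (value s perm : ℕ → ℕ) (l : ℕ) (w : List ℕ) : ℂ :=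
  codeCoef c (s ∘ value) d (fun ν => w.getD ν 0) * ∏ j ∈ (Finset.range (k + 1)).erase l,
    codeLin (fun ν => A (value ν) (perm j)) d fun ν => w.getD ν 0

theorem ryserTerm_digits (c : ℂ) (k d : ℕ) (value s perm : ℕ → ℕ) (l : ℕ) (S r dir : ℕ → ℕ) :
    ryserTerm A c k d value s perm l ((digits S r dir (List.range d)).map fun x => x.2.1) =
      codeCoef c (s ∘ value) d r * ∏ j ∈ (Finset.range (k + 1)).erase l,
        codeLin (fun ν => A (value ν) (perm j)) d r := by
  have h : ∀ ν ∈ Finset.range d,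
      ((digits S r dir (List.range d)).map fun x => x.2.1).getD ν 0 = r ν := by
    intro ν hν
    have hν' := Finset.mem_range.1 hν
    simp [digits, List.getD_eq_getElem?_getD, hν']
  unfold ryserTerm codeCoef codeLin
  congr 1
  · congr 1
    exact Finset.prod_congr rfl fun ν hν => by simp only [h ν hν]
  · refine Finset.prod_congr rfl fun j _ => Finset.sum_congr rfl fun ν hν => by simp only [h ν hν]

theorem prod_range_erase_eq {k : ℕ} (l : Fin (k + 1)) (g : ℕ → ℂ) :
    ∏ j ∈ (Finset.range (k + 1)).erase l, g j = ∏ j : Fin k, g (l.succAbove j) := by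
  symm
  refine Finset.prod_bij (fun j _ => (l.succAbove j : ℕ)) ?_ ?_ ?_ ?_
  · intro j _
    have h : (l.succAbove j : ℕ) ≠ l := fun h => Fin.succAbove_ne l j (Fin.ext h)
    exact Finset.mem_erase.2 ⟨h, Finset.mem_range.2 (Fin.is_lt _)⟩
  · intro i _ j _ h
    exact Fin.succAbove_right_injective (Fin.ext h)
  · intro j hj
    simp only [Finset.mem_erase, Finset.mem_range] at hj
    obtain ⟨i, hi⟩ := Fin.exists_succAbove_eq (x := ⟨j, hj.2⟩) (y := l)
      (fun h => hj.1 (congrArg Fin.val h))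
    exact ⟨i, Finset.mem_univ _, by rw [hi]⟩
  · intro j _
    rfl

/-- Relabelling the chosen rows by their position among the distinct ones turns the sum over the box
of words into `ryser_repeated_rows`; injectivity and surjectivity of `value` identify the
multiplicities. -/
theorem boxSum_ryserTerm {m k d : ℕ} {value s perm : ℕ → ℕ} {r : Fin k → Fin m}
    (hs : ∀ i : Fin m, s i = mult r i) (hlt : ∀ ν < d, value ν < m)
    (hinj : ∀ ν < d, ∀ ν' < d, value ν = value ν' → ν = ν')
    (hsurj : ∀ i < m, 0 < s i → ∃ ν < d, value ν = i) (l : Fin (k + 1)) :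
    boxSum (ryserTerm A ((-1) ^ k) k d value s perm l) ((List.range d).map (s ∘ value)) =
      (Matrix.of fun i j : Fin k => A (r i) (perm (l.succAbove j))).permanent := by
  have hz : ∀ j, ∃ ν : Fin d, value ν = r j := by
    intro j
    have : 0 < s (r j) := by
      rw [hs]
      exact Finset.card_pos.2 ⟨j, by simp⟩
    obtain ⟨ν, hν, h⟩ := hsurj (r j) (r j).2 this
    exact ⟨⟨ν, hν⟩, h⟩
  choose z hz using hz
  have hmult : ∀ ν : Fin d, mult z ν = s (value ν) := by
    intro ν
    have := hs ⟨value ν, hlt ν ν.2⟩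
    simp only at this
    rw [this, mult_eq_sum, mult_eq_sum]
    refine Finset.sum_congr rfl fun j _ => if_congr ?_ rfl rfl
    rw [Fin.ext_iff (a := r j), ← hz j]
    exact ⟨fun h => by rw [h], fun h => Fin.ext (hinj _ (z j).2 _ ν.2 h)⟩
  have h1 : (List.range d).map (s ∘ value) = List.ofFn fun ν : Fin d => mult z ν := by
    refine List.ext_getElem (by simp) fun i h h' => ?_
    simp [hmult]
  rw [h1, boxSum_ofFn]
  have h2 := ryser_repeated_rows (fun (ν : Fin d) (j : Fin k) => A (value ν) (perm (l.succAbove j))) z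
  simp only [hz] at h2
  rw [← h2, Finset.mul_sum]
  refine Finset.sum_congr rfl fun w _ => ?_
  have h3 : ∀ ν : Fin d, (List.ofFn w).getD ν 0 = w ν := by
    intro ν
    simp [List.getD_eq_getElem?_getD]
  unfold ryserTerm codeCoef codeLin
  rw [prod_range_erase_eq l fun j => ∑ ν ∈ Finset.range d,
    (((List.ofFn w).getD ν 0 : ℕ) : ℂ) * A (value ν) (perm j)]
  simp_rw [Finset.prod_range, Finset.sum_range, h3, Function.comp_apply, hmult, mul_assoc]

/-- The invariant keeps the partial Ryser sum over the first t code words. There are at most k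
distinct rows, so even scanning all digits for each word costs O(k + 1); no amortised analysis of
the code is required. -/
theorem exec_minors {σ : State} {m k : ℕ} {r : Fin k → Fin m} (hm : σ.int .m 0 = m)
    (hk : σ.int .k 0 = k) (hs : ∀ i : Fin m, σ.int .s i = mult r i)
    (hsign : σ.num .sign 0 = (-1) ^ k) :
    Exec A minors σ fun τ => (∀ l : Fin (k + 1), τ.num .minor l =
        (Matrix.of fun i j : Fin k => A (r i) (σ.int .perm (l.succAbove j))).permanent) ∧
      τ.time ≤ σ.time + 1000 * (m + (k + 1) * codeLength r) := by
  unfold minors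
  have hsum : ∑ i ∈ Finset.range m, σ.int .s i = k := by
    rw [Finset.sum_range]
    simp_rw [hs]
    exact sum_mult r
  have hprod : ∏ i ∈ Finset.range m, (σ.int .s i + 1) = codeLength r := by
    rw [Finset.prod_range]
    simp_rw [hs]
    rfl
  refine exec_seq ((exec_initCode hm rfl).frame.mono ?_)
  rintro τ ⟨⟨hτi, hτn⟩, d, h1, h2, h3, h4, h5, h6, h7, h8, h9⟩
  rw [hsum] at h8 h9
  rw [hprod] at h6 h7
  have e1 := hτi .k (by rfl)
  have e2 := hτi .s (by rfl)
  have e3 := hτi .perm (by rfl)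
  have e4 := hτn .sign (by rfl)
  refine exec_seq ((exec_loop (fun v ρ => ρ.int .k 0 = k ∧
    (∀ l < v, ρ.num .lin l = 0 ∧ ρ.num .minor l = 0) ∧
    ρ.time ≤ τ.time + 20 * v + 20) ?_ ?_).frame.mono ?_)
  · simp [e1, hk]
  · rintro v ρ hv ⟨g1, g2, g3⟩
    refine exec_seq (exec_setN (exec_setN ⟨by simpa using g1, ?_, ?_⟩))
    · intro l hl
      by_cases hlv : l = v
      · subst hlv
        simp
      · simpa [hlv] using g2 l (by omega)
    · simp
      omega
  rintro ρ ⟨⟨hρi, hρn⟩, g1, g2, g3⟩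
  simp only [inc, iv, IExpr.eval, e1, hk] at g2 g3
  have f2 := hρi .s (by rfl)
  have f3 := hρi .perm (by rfl)
  have f4 := hρn .sign (by rfl)
  have f5 := hρi .count (by rfl)
  have f6 := hρi .value (by rfl)
  have f7 := hρi .distinct (by rfl)
  have f8 := hρi .r (by rfl)
  have f9 := hρi .dir (by rfl)
  set L := digits (σ.int .s ∘ τ.int .value) (τ.int .r) (τ.int .dir) (List.range d) with hL
  set f := ryserTerm A ((-1) ^ k) k d (τ.int .value) (σ.int .s) (σ.int .perm) with hf
  refine exec_seq (exec_setN ((exec_loop (fun t ρ' =>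
    IsCodeState A ((-1) ^ k) k d (τ.int .value) (σ.int .s) (σ.int .perm) ρ' ∧
    digits (σ.int .s ∘ τ.int .value) (ρ'.int .r) (ρ'.int .dir) (List.range d) = grayNext^[t] L ∧
    (∀ l ≤ k, ρ'.num .minor l =
      ∑ u ∈ Finset.range t, f l ((grayNext^[u] L).map fun x => x.2.1)) ∧
    ρ'.time ≤ ρ.time + 20 + t * (500 * (k + 1))) ?_ ?_).mono ?_))
  · refine ⟨⟨?_, ?_, ?_, ?_, ?_, ?_, ?_, ?_⟩, ?_, ?_, ?_⟩
    · simpa using g1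
    · simpa [f7] using h1
    · simp [f6]
    · simp [f2, e2]
    · simp [f3, e3]
    · intro j hj
      simp [f8, (h5 j hj).1]
    · simp only [State.tick_num, State.setN_num_self, NExpr.eval, nv, IExpr.eval,
        Function.update_self, f4, e4, hsign, State.tick_int, State.setN_int, f8]
      unfold codeCoef
      rw [Finset.prod_eq_one, mul_one]
      intro ν hν
      simp [(h5 ν (Finset.mem_range.1 hν)).1]
    · intro l hl
      simp only [State.tick_num, State.tick_int, State.setN_int, f8, ne_eq, reduceCtorEq,
        not_false_eq_true, State.setN_num_of_ne, (g2 l (by omega)).1]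
      unfold codeLin
      rw [Finset.sum_eq_zero]
      intro ν hν
      simp [(h5 ν (Finset.mem_range.1 hν)).1]
    · simp [f8, f9, hL]
    · intro l hl
      simp [(g2 l (by omega)).2]
    · simp
  · rintro t ρ' ht ⟨q1, q2, q3, q4⟩
    refine exec_seq ((exec_addTerms (k := k) (by simpa using q1.k_eq)).frame.mono ?_)
    rintro ω ⟨⟨hωi, hωn⟩, w1, w2⟩
    have hω : IsCodeState A ((-1) ^ k) k d (τ.int .value) (σ.int .s) (σ.int .perm) ω := by
      obtain ⟨p1, p2, p3, p4, p5, p6, p7, p8⟩ := q1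
      have a1 := hωi .k (by rfl)
      have a2 := hωi .distinct (by rfl)
      have a3 := hωi .value (by rfl)
      have a4 := hωi .s (by rfl)
      have a5 := hωi .perm (by rfl)
      have a6 := hωi .r (by rfl)
      have a7 := hωn .coef (by rfl)
      have a8 := hωn .lin (by rfl)
      refine ⟨by simpa [a1] using p1, by simpa [a2] using p2, by simpa [a3] using p3,
        by simpa [a4] using p4, by simpa [a5] using p5, by simpa [a6] using p6,
        by simpa [a6, a7] using p7, by simpa [a6, a8] using p8⟩
    have a1 := hωi .r (by rfl)
    have a2 := hωi .dir (by rfl)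
    simp at a1 a2
    refine (exec_nextCode hω).frame.mono ?_
    rintro ω' ⟨⟨-, hω'n⟩, u1, u2, u3⟩
    refine ⟨u1, ?_, ?_, ?_⟩
    · rw [u2, a1, a2, q2, Function.iterate_succ_apply']
    · intro l hl
      rw [hω'n .minor (by rfl), w1 l hl, Finset.sum_range_succ, ← q2, hf, ryserTerm_digits]
      simp only [State.tick_num, State.setI_num, q3 l hl, q1.coef_eq]
      congr 2
      refine Finset.prod_congr rfl fun j hj => ?_
      have : j < k + 1 := Finset.mem_range.1 (Finset.mem_of_mem_erase hj)
      exact q1.lin_eq j (by omega)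
    · simp at w2
      rw [Nat.succ_mul]
      omega
  · rintro ρ' ⟨-, -, q3, q4⟩
    have hcount : (iv .count).eval ((ρ.setN .coef ((IExpr.lit 0).eval ρ)
        ((nv .sign).eval A ρ)).tick ((IExpr.lit 0).cost + (nv .sign).cost + 1)) =
          codeLength r := by
      simp [f5, h6]
    rw [hcount] at q3 q4
    have hLp : (L.map fun x => x.1 + 1).prod = codeLength r := by
      rw [← h7, hL, Finset.prod_range, ← List.prod_ofFn]
      congr 1
      refine List.ext_getElem (by simp [digits]) fun i h h' => ?_
      simp [digits]
    constructor
    · intro l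
      rw [q3 l (by omega), ← hLp, sum_grayNext L]
      · have : (L.map fun x => x.1) = (List.range d).map (σ.int .s ∘ τ.int .value) := by
          simp [hL, digits]
        rw [this]
        exact boxSum_ryserTerm hs (fun ν hν => (h2 ν hν).1) h3 h4 l
      · intro x hx
        obtain ⟨j, hj, rfl⟩ := List.mem_map.1 hx
        have := h5 j (List.mem_range.1 hj)
        exact Or.inl (by simp [this])
    · have hc : 1 ≤ codeLength r := Finset.prod_pos fun i _ => Nat.succ_pos _
      have : k + 1 ≤ (k + 1) * codeLength r := Nat.le_mul_of_pos_right _ hc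
      have : codeLength r * (500 * (k + 1)) = 500 * ((k + 1) * codeLength r) := by ring
      omega

theorem exec_weights {σ : State} {m k : ℕ} (hm : σ.int .m 0 = m) (hk : σ.int .k 0 = k) :
    Exec A weights σ fun τ => (∀ i < m, τ.num .wt i = ((‖∑ l ∈ Finset.range (k + 1),
        A i (σ.int .perm l) * σ.num .minor l‖ ^ 2 : ℝ) : ℂ)) ∧
      τ.time ≤ σ.time + 100 * (m * (k + 1)) + 100 := by
  unfold weights
  refine (exec_loop (fun v τ => τ.int .k = σ.int .k ∧ τ.int .perm = σ.int .perm ∧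
    τ.num .minor = σ.num .minor ∧ (∀ i < v, τ.num .wt i = ((‖∑ l ∈ Finset.range (k + 1),
        A i (σ.int .perm l) * σ.num .minor l‖ ^ 2 : ℝ) : ℂ)) ∧
    τ.time ≤ σ.time + v * (100 * (k + 1)) + 100) ?_ ?_).mono ?_
  · simp
  · rintro v τ hv ⟨h1, h2, h3, h4, h5⟩
    refine exec_seq (exec_setN (exec_seq ((exec_loop (fun u ρ =>
      ρ.int .i 0 = v ∧ ρ.int .perm = σ.int .perm ∧ ρ.num .minor = σ.num .minor ∧
      ρ.num .acc 0 = ∑ l ∈ Finset.range u, A v (σ.int .perm l) * σ.num .minor l ∧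
      ρ.time ≤ τ.time + 20 * u + 20) ?_ ?_).frame.mono ?_)))
    · simp [h2, h3]
    · rintro u ρ hu ⟨g1, g2, g3, g4, g5⟩
      refine exec_setN ⟨by simpa using g1, by simpa using g2, by simpa using g3, ?_, ?_⟩
      · simp [g1, g2, g3, g4, Finset.sum_range_succ]
      · simp
        omega
    · rintro ρ ⟨⟨hρi, hρn⟩, g1, g2, g3, g4, g5⟩
      have e1 := hρi .k (by rfl)
      have e2 := hρn .wt (by rfl)
      simp [h1, hk] at g4 g5 e1 e2
      refine exec_setN ⟨by simpa using e1, by simpa using g2, by simpa using g3, ?_, ?_⟩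
      · intro i hi
        by_cases hiv : i = v
        · subst hiv
          simp [g1, g4, Complex.normSq_eq_norm_sq]
        · simp [g1, hiv, e2, h4 i (by omega)]
      · simp
        rw [Nat.succ_mul]
        omega
  · rintro τ ⟨-, -, -, h4, h5⟩
    have : m * (100 * (k + 1)) = 100 * (m * (k + 1)) := by ring
    simp [hm] at h4 h5
    refine ⟨fun i hi => by simpa using h4 i hi, by omega⟩

end BosonSampling

end

noncomputable section

namespace BosonSampling

variable {A : ℕ → ℕ → ℂ}

/-! ### Drawing an index -/

/-- The index that has been taken after the first `v` of `N` indices with weights `w` have been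
offered. -/
def offerLaw (w : ℕ → ℝ) (N : ℕ) : ℕ → PMF (Option ℕ)
  | 0 => PMF.pure none
  | v + 1 => (offerLaw w N v).bind fun o =>
      match o with
      | some i => PMF.pure (some i)
      | none => (coinPMF (w v / ∑ i ∈ Finset.Ico v N, w i)).bind fun h =>
          PMF.pure (if h then some v else none)

theorem offerLaw_support (w : ℕ → ℝ) (N v : ℕ) {i : ℕ} (h : some i ∈ (offerLaw w N v).support) :
    i < v := by
  induction v with
  | zero => simp [offerLaw] at h
  | succ v ih =>
    obtain ⟨o, ho, h⟩ := (PMF.mem_support_bind_iff _ _ _).1 h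
    cases o with
    | some j =>
      simp only [PMF.support_pure, Set.mem_singleton_iff, Option.some.injEq] at h
      subst h
      have := ih ho
      omega
    | none =>
      obtain ⟨b, -, h⟩ := (PMF.mem_support_bind_iff _ _ _).1 h
      cases b <;> simp at h
      omega

theorem clamp_eq {p : ℝ} (h : p ≤ 1) : clamp p = ENNReal.ofReal p := by
  simpa [clamp] using h

theorem one_sub_clamp_eq {p : ℝ} (h0 : 0 ≤ p) (h : p ≤ 1) :
    1 - clamp p = ENNReal.ofReal (1 - p) := by
  rw [clamp_eq h, ← ENNReal.ofReal_one, ENNReal.ofReal_sub _ h0]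

/-- The mass not yet assigned is T/W, where T is the weight of the remaining indices and W the total
weight. Accepting v with conditional probability w_v/T therefore gives it mass w_v/W. -/
theorem expect_offerLaw {w : ℕ → ℝ} {N : ℕ} (hw : ∀ i, 0 ≤ w i)
    (hW : 0 < ∑ i ∈ Finset.range N, w i) (f : Option ℕ → ℝ≥0∞) {v : ℕ} (hv : v ≤ N) :
    expect (offerLaw w N v) f =
      ∑ i ∈ Finset.range v, ENNReal.ofReal (w i / ∑ i ∈ Finset.range N, w i) * f (some i) +
        ENNReal.ofReal ((∑ i ∈ Finset.Ico v N, w i) / ∑ i ∈ Finset.range N, w i) * f none := by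
  set W := ∑ i ∈ Finset.range N, w i with hWdef
  induction v generalizing f with
  | zero =>
    simp only [offerLaw, expect_pure, Finset.range_zero, Finset.sum_empty, zero_add]
    rw [← Finset.range_eq_Ico, ← hWdef, div_self hW.ne']
    simp
  | succ v ih =>
    rw [offerLaw, expect_bind, ih _ (by omega)]
    simp only [expect_pure, expect_bind, expect_coinPMF, if_true, Bool.false_eq_true, if_false]
    rw [Finset.sum_range_succ, add_assoc]
    congr 1
    set T := ∑ i ∈ Finset.Ico v N, w i with hT
    have hT' : T = w v + ∑ i ∈ Finset.Ico (v + 1) N, w i :=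
      Finset.sum_eq_sum_Ico_succ_bot (by omega) _
    have hT1 : 0 ≤ ∑ i ∈ Finset.Ico (v + 1) N, w i := Finset.sum_nonneg fun i _ => hw i
    have hT0 : 0 ≤ T := by
      have := hw v
      linarith
    have hp0 : 0 ≤ w v / T := div_nonneg (hw v) hT0
    have hp1 : w v / T ≤ 1 := div_le_one_of_le₀ (by linarith) hT0
    rw [clamp_eq hp1, ← clamp_eq hp1, one_sub_clamp_eq hp0 hp1, clamp_eq hp1, mul_add,
      ← mul_assoc, ← mul_assoc, ← ENNReal.ofReal_mul (div_nonneg hT0 hW.le),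
      ← ENNReal.ofReal_mul (div_nonneg hT0 hW.le)]
    -- If no weight remains, the conditional probability is 0/0 = 0, and both contributions vanish.
    rcases hT0.eq_or_lt with h0 | h0
    · have h1 : w v = 0 := by
        have := hw v
        linarith
      have h2 : ∑ i ∈ Finset.Ico (v + 1) N, w i = 0 := by linarith
      simp [← h0, h1, h2]
    · congr 3
      · field_simp
      · field_simp
        linarith

/-- The law of an index that is drawn with probability proportional to the weights `w`. -/
def drawLaw {N : ℕ} [NeZero N] (w : Fin N → ℝ) : PMF (Fin N) :=
  -- The default 0 is the value with which the program initialises `pick`, so the coupling with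
  -- `sample` requires no positivity of the weights.
  (offerLaw (fun i => if h : i < N then w ⟨i, h⟩ else 0) N N).map fun o => Fin.ofNat N (o.getD 0)

theorem expect_drawLaw {N : ℕ} [NeZero N] {w : Fin N → ℝ} (hw : ∀ i, 0 ≤ w i)
    (hW : 0 < ∑ i, w i) (f : Fin N → ℝ≥0∞) :
    expect (drawLaw w) f = ∑ i, ENNReal.ofReal (w i / ∑ i, w i) * f i := by
  have h1 : ∑ i ∈ Finset.range N, (if h : i < N then w ⟨i, h⟩ else 0) = ∑ i, w i := by
    rw [Finset.sum_range]
    simp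
  unfold drawLaw
  rw [expect_map, expect_offerLaw _ (by rwa [h1]) _ le_rfl, h1]
  · rw [Finset.sum_range]
    simp
  · intro i
    split_ifs
    · exact hw _
    · exact le_rfl

theorem drawLaw_apply {N : ℕ} [NeZero N] {w : Fin N → ℝ} (hw : ∀ i, 0 ≤ w i)
    (hW : 0 < ∑ i, w i) (i : Fin N) : drawLaw w i = ENNReal.ofReal (w i / ∑ i, w i) := by
  have h := expect_drawLaw hw hW fun j => if j = i then 1 else 0
  simpa [expect] using h

/-- The hypothesis on `b` says that its value is unaffected by the integer variables the sampler
writes, so both loops have length `N`. Only while nothing has been taken does `rem` have to equal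
the remaining weight. -/
theorem coupled_sample {b : IExpr} {σ : State} {N : ℕ} [NeZero N] {w : Fin N → ℝ}
    (hb : ∀ τ : State, (∀ y, y ≠ .i → y ≠ .pick → y ≠ .found → τ.int y = σ.int y) →
      b.eval τ = N) (hc : b.cost ≤ 10) (hw : ∀ i : Fin N, σ.num .wt i = (w i : ℂ)) :
    Coupled (drawLaw w) (run A (sample b) σ) fun i τ => τ.int .pick 0 = i ∧
      τ.time ≤ σ.time + 100 * N + 100 := by
  set w' : ℕ → ℝ := fun i => if h : i < N then w ⟨i, h⟩ else 0 with hw'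
  have hwt : ∀ i < N, σ.num .wt i = (w' i : ℂ) := by
    intro i hi
    simp only [hw', hi, dite_true]
    exact hw ⟨i, hi⟩
  unfold sample
  refine Exec.coupled_seq (exec_setN (Exec.coupled_seq ((exec_loop (fun v τ =>
    τ.num .wt = σ.num .wt ∧ τ.num .rem 0 = ((∑ i ∈ Finset.range v, w' i : ℝ) : ℂ) ∧
    τ.time ≤ σ.time + 20 * v + 20) ?_ ?_).frame.mono ?_)))
  · simp
    omega
  · rintro v τ hv ⟨h1, h2, h3⟩
    rw [hb _ (by simp)] at hv
    refine exec_setN ⟨by simpa using h1, ?_, ?_⟩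
    · simp [h1, h2, hwt v hv, Finset.sum_range_succ]
    · simp
      omega
  rintro τ ⟨⟨hτi, -⟩, h1, h2, h3⟩
  rw [hb _ (by simp)] at h2 h3
  refine Exec.coupled_seq (exec_setI (Exec.coupled_seq (exec_setI ?_)))
  set τ' := (((τ.setI .pick ((IExpr.lit 0).eval τ) ((IExpr.lit 0).eval τ)).tick
    ((IExpr.lit 0).cost + (IExpr.lit 0).cost + 1)).setI .found _ _).tick _ with hτ'
  have hb' : b.eval τ' = N := by
    refine hb _ fun y h4 h5 h6 => ?_
    simp only [hτ', State.tick_int, State.setI_int_of_ne _ h6, State.setI_int_of_ne _ h5]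
    rw [hτi y (by simpa [Cmd.writesI] using Ne.symm h4)]
    rfl
  have key := coupled_loop (A := A) (G := fun _ => Option ℕ) (x := .i) (b := b)
    (c := .ifLt (iv .found) (.lit 1)
      (.coin (.div (.get .wt (iv .i)) (nv .rem))
        (.setI .pick (.lit 0) (iv .i) ;; .setI .found (.lit 0) (.lit 1))
        (.setN .rem (.lit 0) (.sub (nv .rem) (.get .wt (iv .i)))))
      .skip) (σ := τ') (offerLaw w' N)
    (fun v o => match o with
      | some i => PMF.pure (some i)
      | none => (coinPMF (w' v / ∑ i ∈ Finset.Ico v N, w' i)).bind fun h =>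
          PMF.pure (if h then some v else none)) (fun v _ => rfl)
    (fun v o ρ => ρ.num .wt = σ.num .wt ∧ ρ.time ≤ τ.time + 30 * v + 30 ∧
      ρ.int .pick 0 = o.getD 0 ∧ ρ.int .found 0 = (if o.isSome then 1 else 0) ∧
      (o = none → ρ.num .rem 0 = ((∑ i ∈ Finset.Ico v N, w' i : ℝ) : ℂ))) ?_ ?_
  · rw [hb'] at key
    refine Coupled.map_left _ (key.mono (R' := fun o ρ => (∀ i, o = some i → i < N) ∧
      ρ.int .pick 0 = o.getD 0 ∧ ρ.time ≤ τ.time + 30 * N + 30) ?_) ?_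
    · rintro o ρ ho - ⟨g1, g2, g3, g4, g5⟩
      refine ⟨?_, g3, g2⟩
      rintro i rfl
      exact offerLaw_support _ _ _ ho
    · rintro o ρ ⟨g1, g2, g3⟩
      constructor
      · rw [g2]
        have : o.getD 0 < N := by
          cases o with
          | none => exact Nat.pos_of_ne_zero (NeZero.ne N)
          | some i => exact g1 i rfl
        simp [Nat.mod_eq_of_lt this]
      · omega
  · refine Coupled.pure ⟨by simpa [hτ'] using h1, ?_, ?_, ?_, ?_⟩
    · simp [hτ']
      omega
    · simp [hτ']
    · simp [hτ']
    · intro _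
      rw [← Finset.range_eq_Ico]
      simpa [hτ'] using h2
  · rintro v o ρ hv ⟨g1, g2, g3, g4, g5⟩
    rw [hb'] at hv
    cases o with
    | some i =>
      refine Exec.coupled (exec_ifLt (Q := fun ρ' => ρ'.num = ρ.num ∧ ρ'.time ≤ ρ.time + 10 ∧
        ρ'.int .pick = ρ.int .pick ∧ ρ'.int .found = ρ.int .found) (fun h => ?_)
        (fun h => exec_skip ⟨?_, ?_, ?_, ?_⟩)) ?_
      · simp [g4] at h
      · simp
      · simp
      · simp
      · simp
      · rintro ρ' ⟨e1, e2, e3, e4⟩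
        refine ⟨by rw [e1, g1], by omega, by rw [e3, g3], by rw [e4, g4], by simp⟩
    | none =>
      -- With `found` still 0 the comparison succeeds, at a cost of 4 steps.
      have hrun : run A (.ifLt (iv .found) (.lit 1)
          (.coin (.div (.get .wt (iv .i)) (nv .rem))
            (.setI .pick (.lit 0) (iv .i) ;; .setI .found (.lit 0) (.lit 1))
            (.setN .rem (.lit 0) (.sub (nv .rem) (.get .wt (iv .i)))))
          .skip) ((ρ.setI .i 0 v).tick 1) =
        run A (.coin (.div (.get .wt (iv .i)) (nv .rem))
            (.setI .pick (.lit 0) (iv .i) ;; .setI .found (.lit 0) (.lit 1))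
            (.setN .rem (.lit 0) (.sub (nv .rem) (.get .wt (iv .i)))))
          (((ρ.setI .i 0 v).tick 1).tick 4) := by
        conv_lhs => rw [run]
        rw [if_pos (by simp [g4])]
        rfl
      rw [hrun]
      simp only [run]
      have hp : ((NExpr.div (.get .wt (iv .i)) (nv .rem)).eval A
          (((ρ.setI .i 0 v).tick 1).tick 4)).re = w' v / ∑ i ∈ Finset.Ico v N, w' i := by
        simp only [NExpr.eval, iv, nv, IExpr.eval, State.tick_int, State.tick_num,
          State.setI_int_self, State.setI_num, Function.update_self, g1, hwt v hv, g5 rfl]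
        rw [← Complex.ofReal_div, Complex.ofReal_re]
      rw [hp]
      refine (coupled_refl _).bind ?_
      rintro h _ rfl
      cases h with
      | true =>
        rw [if_pos rfl]
        simp only [PMF.pure_bind, if_true]
        refine Coupled.pure ⟨by simpa using g1, ?_, ?_, ?_, by simp⟩
        · simp
          omega
        · simp
        · simp
      | false =>
        rw [if_neg (by simp)]
        refine Coupled.pure ⟨by simpa using g1, ?_, ?_, ?_, ?_⟩
        · simp
          omega
        · simpa using g3
        · simpa using g4
        · intro _
          simp [g5 rfl, g1, hwt v hv, Finset.sum_eq_sum_Ico_succ_bot hv]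

end BosonSampling

end

noncomputable section

namespace BosonSampling

variable {A : ℕ → ℕ → ℂ}

/-! ### The random permutation -/

/-- Insert the new largest element of a permutation at the position `p`. -/
def permInsert {k : ℕ} (x : Fin (k + 1) × Equiv.Perm (Fin k)) : Equiv.Perm (Fin (k + 1)) :=
  permSnoc (Fin.last k, x.2) * Equiv.swap x.1 (Fin.last k)

theorem permInsert_bijective (k : ℕ) : Function.Bijective (permInsert (k := k)) := by
  rw [Fintype.bijective_iff_injective_and_card]
  constructor
  · rintro ⟨p, τ⟩ ⟨p', τ'⟩ h
    have h1 : permInsert (p, τ) p = Fin.last k := by simp [permInsert]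
    have h2 : permInsert (p', τ') p' = Fin.last k := by simp [permInsert]
    have hp : p = p' := (permInsert (p', τ')).injective (by rw [h2, ← h, h1])
    subst hp
    have h3 := (permSnoc_bijective k).1 (mul_right_cancel h)
    simp only [Prod.mk.injEq, true_and] at h3
    rw [h3]
  · simp [Fintype.card_perm, Nat.factorial_succ]

theorem permInsert_apply {k : ℕ} (p : Fin (k + 1)) (τ : Equiv.Perm (Fin k)) (j : Fin (k + 1)) :
    (permInsert (p, τ) j : ℕ) = if j = p then k else
      if h : ((if j = Fin.last k then p else j : Fin (k + 1)) : ℕ) < k then (τ ⟨_, h⟩ : ℕ)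
      else k := by
  by_cases hp : j = p
  · subst hp
    simp [permInsert]
  · rw [if_neg hp]
    have hs : Equiv.swap p (Fin.last k) j = if j = Fin.last k then p else j := by
      rw [Equiv.swap_apply_def, if_neg hp]
    unfold permInsert
    rw [Equiv.Perm.mul_apply, hs]
    generalize (if j = Fin.last k then p else j) = i
    cases i using Fin.lastCases with
    | last => simp
    | cast i => simp

/-- The law of the random permutation that is built by successive insertions. -/
def permLaw : ∀ k : ℕ, PMF (Equiv.Perm (Fin k))
  | 0 => PMF.pure 1
  | k + 1 => (permLaw k).bind fun τ =>
      (drawLaw fun _ : Fin (k + 1) => (1 : ℝ)).map fun p => permInsert (p, τ)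

theorem expect_permLaw (k : ℕ) (f : Equiv.Perm (Fin k) → ℝ≥0∞) :
    expect (permLaw k) f = (k.factorial : ℝ≥0∞)⁻¹ * ∑ τ, f τ := by
  induction k with
  | zero =>
    simp only [permLaw, expect_pure, Nat.factorial_zero, Nat.cast_one, inv_one, one_mul]
    rw [Fintype.sum_eq_single 1 fun τ hτ => absurd (Subsingleton.elim τ 1) hτ]
  | succ k ih =>
    rw [permLaw, expect_bind, ih]
    have h1 : ∀ τ, expect ((drawLaw fun _ : Fin (k + 1) => (1 : ℝ)).map
        fun p => permInsert (p, τ)) f = ((k + 1 : ℕ) : ℝ≥0∞)⁻¹ * ∑ p, f (permInsert (p, τ)) := by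
      intro τ
      rw [expect_map, expect_drawLaw (fun _ => zero_le_one) (by simp; positivity), Finset.mul_sum]
      refine Finset.sum_congr rfl fun p _ => ?_
      have : ENNReal.ofReal (1 / ∑ _i : Fin (k + 1), (1 : ℝ)) = ((k + 1 : ℕ) : ℝ≥0∞)⁻¹ := by
        rw [Finset.sum_const, Finset.card_univ, Fintype.card_fin, nsmul_eq_mul, mul_one, one_div,
          ENNReal.ofReal_inv_of_pos (by positivity), ENNReal.ofReal_natCast]
      rw [this]
      rfl
    simp_rw [h1]
    rw [← Finset.mul_sum, ← mul_assoc, Finset.sum_comm, ← Fintype.sum_prod_type',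
      (permInsert_bijective k).sum_comp f, Nat.factorial_succ, mul_comm (k + 1), Nat.cast_mul,
      ENNReal.mul_inv (Or.inr (by simp)) (Or.inl (by simp))]

theorem coupled_permute {σ : State} {n : ℕ} (hn : σ.int .n 0 = n) :
    Coupled (permLaw n) (run A permute σ) fun π τ => (∀ j : Fin n, τ.int .perm j = π j) ∧
      τ.time ≤ σ.time + 500 * (n * n) + 10 := by
  have key := coupled_loop (A := A) (G := fun k => Equiv.Perm (Fin k)) (x := .k) (b := iv .n)
    (c := .loop .j (inc (iv .k)) (.setN .wt (iv .j) (.lit 1)) ;;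
      sample (inc (iv .k)) ;;
      .setI .perm (iv .k) (.get .perm (iv .pick)) ;;
      .setI .perm (iv .pick) (iv .k)) (σ := σ) permLaw
    (fun k τ => (drawLaw fun _ : Fin (k + 1) => (1 : ℝ)).map fun p => permInsert (p, τ))
    (fun k _ => rfl)
    (fun k π τ => (∀ j : Fin k, τ.int .perm j = π j) ∧
      τ.time ≤ σ.time + k * (500 * n) + 10) ?_ ?_
  · have h : (iv .n).eval σ = n := by simpa using hn
    rw [h] at key
    refine key.mono ?_
    rintro π τ - - ⟨h1, h2⟩
    refine ⟨h1, ?_⟩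
    have : n * (500 * n) = 500 * (n * n) := by ring
    omega
  · refine Coupled.pure ⟨fun j => j.elim0, ?_⟩
    simp
  · rintro k π τ hk ⟨h1, h2⟩
    have hk' : k < n := by simpa [hn] using hk
    refine Coupled.map_left (R := fun p τ' => (∀ j : Fin (k + 1),
      τ'.int .perm j = (permInsert (p, π) j : ℕ)) ∧ τ'.time ≤ σ.time + (k + 1) * (500 * n) + 10) _ ?_
      fun p τ' h => h
    refine Exec.coupled_seq ((exec_loop (fun v ρ => ρ.int .k 0 = k ∧
      (∀ j < v, ρ.num .wt j = 1) ∧ ρ.time ≤ τ.time + 20 * v + 20) ?_ ?_).frame.mono ?_)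
    · simp
    · rintro v ρ hv ⟨g1, g2, g3⟩
      refine exec_setN ⟨by simpa using g1, ?_, ?_⟩
      · intro j hj
        by_cases hjv : j = v
        · subst hjv
          simp
        · simpa [hjv] using g2 j (by omega)
      · simp
        omega
    · rintro ρ ⟨⟨hρi, -⟩, g1, g2, g3⟩
      simp at g2 g3
      have e1 := hρi .perm (by rfl)
      simp at e1
      refine coupled_seq_exec (coupled_sample (N := k + 1) (w := fun _ => 1) ?_ ?_ ?_).frame ?_
      · intro ω hω
        simp [hω .k, g1]
      · simp
      · intro j
        simp [g2 j (by omega)]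
      · rintro p ω ⟨⟨hωi, -⟩, w1, w2⟩
        have f1 := hωi .perm (by rfl)
        have f2 := hωi .k (by rfl)
        refine exec_seq (exec_setI (exec_setI ⟨?_, ?_⟩))
        · intro j
          simp only [State.tick_int, State.setI_int_self, IExpr.eval, iv, w1, f2, g1, f1, e1,
            State.setI_int_of_ne _ (show IVar.pick ≠ IVar.perm by simp),
            State.setI_int_of_ne _ (show IVar.k ≠ IVar.perm by simp)]
          rw [permInsert_apply]
          by_cases hj : j = p
          · subst hj
            simp
          · rw [if_neg hj, Function.update_of_ne (fun h => hj (Fin.ext h))]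
            by_cases hjk : j = Fin.last k
            · subst hjk
              have hpk : (p : ℕ) < k := by
                have := Fin.val_lt_last (fun h => hj h.symm : p ≠ Fin.last k)
                simpa using this
              simp only [Fin.val_last, Function.update_self, if_true, hpk, dite_true]
              exact h1 ⟨p, hpk⟩
            · have hjk' : (j : ℕ) < k := by simpa using Fin.val_lt_last hjk
              simp only [if_neg hjk, hjk', dite_true]
              rw [Function.update_of_ne hjk'.ne]
              exact h1 ⟨j, hjk'⟩
        · simp
          rw [Nat.succ_mul]
          omega

/-! ### The rows -/

/-- The squared modulus of a permanent of a matrix formed by rows `r` and columns `c` of `A`. -/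
def perSq {m k : ℕ} (A : Matrix (Fin m) (Fin m) ℂ) (r c : Fin k → Fin m) : ℝ :=
  ‖(A.submatrix r c).permanent‖ ^ 2

/-- The law of the first `k` rows that the sampler chooses, when the columns are arranged in the
order `c`. -/
def rowsLaw {m : ℕ} [NeZero m] (A : Matrix (Fin m) (Fin m) ℂ) :
    ∀ k : ℕ, (Fin k → Fin m) → PMF (Fin k → Fin m)
  | 0, c => PMF.pure c
  | k + 1, c => (rowsLaw A k (c ∘ Fin.castSucc)).bind fun r =>
      (drawLaw fun i => perSq A (Fin.snoc r i) c).map (Fin.snoc r)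

/-- A bound for the time that the sampler needs to choose the rows `r`. -/
def rowsTime {m : ℕ} : ∀ k : ℕ, (Fin k → Fin m) → ℕ
  | 0, _ => 0
  | k + 1, r => rowsTime k (Fin.init r) +
      2000 * ((k + 1) * codeLength (Fin.init r) + m * (k + 1))

theorem perSq_snoc {m k : ℕ} (A : Matrix (Fin m) (Fin m) ℂ) (r : Fin k → Fin m) (i : Fin m)
    (c : Fin (k + 1) → Fin m) : perSq A (Fin.snoc r i) c =
      ‖∑ l, A i (c l) * (A.submatrix r (c ∘ l.succAbove)).permanent‖ ^ 2 := by
  unfold perSq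
  rw [permanent_succ_last_row]
  congr 2
  refine Finset.sum_congr rfl fun l _ => ?_
  have : (A.submatrix (Fin.snoc r i) c).submatrix Fin.castSucc l.succAbove =
      A.submatrix r (c ∘ l.succAbove) := by
    ext a b
    simp
  rw [this]
  simp

theorem entries_apply {m : ℕ} (A : Matrix (Fin m) (Fin m) ℂ) (i j : Fin m) :
    entries A i j = A i j := by
  simp [entries]

/-- The memory before round `k`, when the rows `r` have been chosen. -/
structure IsRoundState {m : ℕ} (n : ℕ) (c : ℕ → Fin m) (k : ℕ) (r : Fin k → Fin m) (σ : State) :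
    Prop where
  m_eq : σ.int .m 0 = m
  n_eq : σ.int .n 0 = n
  perm_eq : ∀ j < n, σ.int .perm j = c j
  s_eq : ∀ i : Fin m, σ.int .s i = mult r i
  sign_eq : σ.num .sign 0 = (-1) ^ k

/-- The minors, the weights and the draw follow each other; since `m` is positive, the constant 1500
absorbs all terms of order m and all additive constants. The round loop costs one more step, covered
by the 2000 in `rowsTime`. -/
theorem coupled_round {m n k : ℕ} [NeZero m] (A : Matrix (Fin m) (Fin m) ℂ) (hk : k < n)
    {c : ℕ → Fin m} {r : Fin k → Fin m} {σ : State} (hσ : IsRoundState n c k r σ)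
    (hσk : σ.int .k 0 = k) :
    Coupled (drawLaw fun i => perSq A (Fin.snoc r i) fun j : Fin (k + 1) => c j)
      (run (entries A) (minors ;; weights ;; sample (iv .m) ;;
        .setI .s (iv .pick) (inc (.get .s (iv .pick))) ;;
        .setN .sign (.lit 0) (.sub (.lit 0) (nv .sign))) σ)
      fun i τ => IsRoundState n c (k + 1) (Fin.snoc r i) τ ∧
        τ.time ≤ σ.time + 1500 * ((k + 1) * codeLength r + m * (k + 1)) := by
  obtain ⟨h1, h2, h3, h4, h5⟩ := hσ
  have hm : 0 < m := Nat.pos_of_ne_zero (NeZero.ne m)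
  refine Exec.coupled_seq ((exec_minors h1 hσk h4 h5).frame.mono ?_)
  rintro τ ⟨⟨hτi, hτn⟩, g1, g2⟩
  have e1 := hτi .m (by rfl)
  have e2 := hτi .k (by rfl)
  have e3 := hτi .perm (by rfl)
  have e4 := hτi .s (by rfl)
  have e5 := hτi .n (by rfl)
  have e6 := hτn .sign (by rfl)
  refine Exec.coupled_seq ((exec_weights (m := m) (k := k) (by rw [e1, h1])
    (by rw [e2, hσk])).frame.mono ?_)
  rintro ρ ⟨⟨hρi, hρn⟩, q1, q2⟩
  have f1 := hρi .m (by rfl)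
  have f3 := hρi .perm (by rfl)
  have f4 := hρi .s (by rfl)
  have f5 := hρi .n (by rfl)
  have f6 := hρn .sign (by rfl)
  refine coupled_seq_exec (coupled_sample (N := m) ?_ ?_ ?_).frame ?_
  · intro ω hω
    simp [hω .m, f1, e1, h1]
  · simp
  · intro i
    have h : ∀ l : Fin (k + 1), entries A i (τ.int .perm l) * τ.num .minor l =
        A i (c l) * (A.submatrix r ((fun j : Fin (k + 1) => c j) ∘ l.succAbove)).permanent := by
      intro l
      rw [e3, h3 l (by omega), entries_apply, g1 l]
      congr 2
      ext a b
      simp only [Matrix.of_apply, Matrix.submatrix_apply, Function.comp_apply]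
      rw [h3 _ (by omega), entries_apply]
    rw [q1 i i.2, perSq_snoc, Finset.sum_range, Finset.sum_congr rfl fun l _ => h l]
  · rintro i ω ⟨⟨hωi, hωn⟩, w1, w2⟩
    have a1 := hωi .m (by rfl)
    have a3 := hωi .perm (by rfl)
    have a4 := hωi .s (by rfl)
    have a5 := hωi .n (by rfl)
    have a6 := hωn .sign (by rfl)
    refine exec_seq (exec_setI (exec_setN ⟨⟨?_, ?_, ?_, ?_, ?_⟩, ?_⟩))
    · simpa [a1, f1, e1] using h1
    · simpa [a5, f5, e5] using h2
    · simpa [a3, f3, e3] using h3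
    · intro j
      rw [mult_snoc]
      by_cases hij : i = j
      · subst hij
        simp [w1, a4, f4, e4, h4]
      · have : (j : ℕ) ≠ i := fun h => hij (Fin.ext h.symm)
        simp [w1, a4, f4, e4, h4, hij, this]
    · simp [a6, f6, e6, h5, pow_succ]
    · have h6 : m ≤ m * (k + 1) := Nat.le_mul_of_pos_right _ (Nat.succ_pos k)
      simp
      omega

theorem coupled_rounds {m n : ℕ} [NeZero m] (A : Matrix (Fin m) (Fin m) ℂ) {c : ℕ → Fin m}
    {r : Fin 0 → Fin m} {σ : State} (hσ : IsRoundState n c 0 r σ) :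
    Coupled (rowsLaw A n fun j : Fin n => c j)
      (run (entries A) (.loop .k (iv .n) (minors ;; weights ;; sample (iv .m) ;;
        .setI .s (iv .pick) (inc (.get .s (iv .pick))) ;;
        .setN .sign (.lit 0) (.sub (.lit 0) (nv .sign)))) σ)
      fun r τ => IsRoundState n c n r τ ∧ τ.time ≤ σ.time + rowsTime n r + 10 := by
  have key := coupled_loop (A := entries A) (G := fun k => Fin k → Fin m) (x := .k) (b := iv .n)
    (c := minors ;; weights ;; sample (iv .m) ;;
        .setI .s (iv .pick) (inc (.get .s (iv .pick))) ;;
        .setN .sign (.lit 0) (.sub (.lit 0) (nv .sign))) (σ := σ)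
    (fun k => rowsLaw A k fun j : Fin k => c j)
    (fun k r => (drawLaw fun i => perSq A (Fin.snoc r i) fun j : Fin (k + 1) => c j).map
      (Fin.snoc r)) (fun k _ => rfl)
    (fun k r τ => IsRoundState n c k r τ ∧ τ.time ≤ σ.time + rowsTime k r + 10) ?_ ?_
  · have h : (iv .n).eval σ = n := by simpa using hσ.n_eq
    rw [h] at key
    exact key
  · refine Coupled.pure ⟨?_, ?_⟩
    · have : (fun j : Fin 0 => c j) = r := Subsingleton.elim _ _
      rw [this]
      exact ⟨hσ.m_eq, hσ.n_eq, hσ.perm_eq, hσ.s_eq, hσ.sign_eq⟩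
    · simp
      omega
  · rintro k r τ hk ⟨h1, h2⟩
    have hk' : k < n := by simpa [hσ.n_eq] using hk
    refine Coupled.map_left _ (coupled_round A hk' (σ := (τ.setI .k 0 k).tick 1) (c := c)
      (r := r) ⟨?_, ?_, ?_, ?_, ?_⟩ ?_) ?_
    · simpa using h1.m_eq
    · simpa using h1.n_eq
    · simpa using h1.perm_eq
    · simpa using h1.s_eq
    · simpa using h1.sign_eq
    · simp
    · rintro i ρ ⟨g1, g2⟩
      refine ⟨g1, ?_⟩
      have hc : 1 ≤ codeLength r := Finset.prod_pos fun i _ => Nat.succ_pos _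
      have : 1 ≤ (k + 1) * codeLength r := Nat.mul_pos (Nat.succ_pos k) hc
      simp only [rowsTime, Fin.init_snoc]
      simp at g2
      omega

/-! ### The output -/

/-- In a sorted array the entries below `i` fill an initial segment, so the output pointer at the
start of stage i is the number of such entries. -/
theorem lt_card_iff_of_monotone {m n : ℕ} {y : Fin n → Fin m} (hy : Monotone y) (i : ℕ)
    (p : Fin n) : (p : ℕ) < (Finset.univ.filter fun q => (y q : ℕ) < i).card ↔ (y p : ℕ) < i := by
  constructor
  · intro h
    by_contra! hp
    have : (Finset.univ.filter fun q => (y q : ℕ) < i) ⊆ Finset.Iio p := by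
      intro q hq
      rw [Finset.mem_Iio]
      by_contra! hpq
      have h1 : (y p : ℕ) ≤ y q := hy hpq
      have h2 := (Finset.mem_filter.1 hq).2
      omega
    have := Finset.card_le_card this
    rw [Fin.card_Iio] at this
    omega
  · intro h
    have : Finset.Iic p ⊆ Finset.univ.filter fun q => (y q : ℕ) < i := by
      intro q hq
      have h1 : (y q : ℕ) ≤ y p := hy (Finset.mem_Iic.1 hq)
      simp
      omega
    have := Finset.card_le_card this
    rw [Fin.card_Iic] at this
    omega

theorem exec_sortedOutput {m n : ℕ} {y : Fin n → Fin m} (hy : Monotone y) {σ : State}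
    (hm : σ.int .m 0 = m) (hs : ∀ i : Fin m, σ.int .s i = mult y i) :
    Exec A sortedOutput σ fun τ => (∀ p : Fin n, τ.int .z p = y p) ∧
      τ.time ≤ σ.time + 100 * (m + n) + 20 := by
  set N : ℕ → ℕ := fun i => (Finset.univ.filter fun q => (y q : ℕ) < i).card with hN
  have hNs : ∀ i : Fin m, N (i + 1) = N i + σ.int .s i := by
    intro i
    rw [hs, mult, hN]
    simp only
    rw [← Finset.card_union_of_disjoint]
    · congr 1
      ext q
      simp [Fin.ext_iff]
      omega
    · rw [Finset.disjoint_left]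
      intro q hq hq'
      simp [Fin.ext_iff] at hq hq'
      omega
  have hNm : N m = n := by
    simp [hN]
  have hN0 : N 0 = 0 := by simp [hN]
  unfold sortedOutput
  refine exec_seq (exec_setI ((exec_loop (fun v τ => τ.int .s = σ.int .s ∧
    τ.int .pos 0 = N v ∧ (∀ p : Fin n, (p : ℕ) < N v → τ.int .z p = y p) ∧
    τ.time ≤ σ.time + 50 * (v + N v) + 20) ?_ ?_).mono ?_))
  · simp [hN0]
  · rintro v τ hv ⟨h1, h2, h3, h4⟩
    have hv' : v < m := by simpa [hm] using hv
    have hNv := hNs ⟨v, hv'⟩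
    simp only at hNv
    have hmono : N (v + 1) ≤ n := by
      rw [hN]
      simpa using Finset.card_le_univ (Finset.univ.filter fun q => (y q : ℕ) < v + 1)
    refine (exec_loop (fun j ρ => ρ.int .s = σ.int .s ∧ ρ.int .i 0 = v ∧
      ρ.int .pos 0 = N v + j ∧ (∀ p : Fin n, (p : ℕ) < N v + j → ρ.int .z p = y p) ∧
      ρ.time ≤ τ.time + 20 * j + 20) ?_ ?_).mono ?_
    · simpa [h1, h2] using h3
    · rintro j ρ hj ⟨g1, g2, g3, g4, g5⟩
      have hj' : j < σ.int .s v := by simpa [h1] using hj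
      refine exec_seq (exec_setI (exec_setI ⟨?_, ?_, ?_, ?_, ?_⟩))
      · simpa using g1
      · simpa using g2
      · simp [g3]
        omega
      · intro p hp
        by_cases hpj : (p : ℕ) = N v + j
        · have hp1 := (lt_card_iff_of_monotone hy (v + 1) p).1 (by
            change (p : ℕ) < N (v + 1)
            omega)
          have hp2 := (lt_card_iff_of_monotone hy v p).not.1 (by
            change ¬ (p : ℕ) < N v
            omega)
          simp [g3, hpj, g2]
          omega
        · simpa [g3, hpj] using g4 p (by omega)
      · simp
        omega
    · rintro ρ ⟨g1, g2, g3, g4, g5⟩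
      have : (IExpr.get .s (iv .i)).eval ((τ.setI .i 0 v).tick 1) = σ.int .s v := by simp [h1]
      rw [this] at g3 g4 g5
      rw [← hNv] at g3 g4
      exact ⟨g1, g3, g4, by omega⟩
  · rintro τ ⟨h1, h2, h3, h4⟩
    have : (iv .m).eval ((σ.setI .pos ((IExpr.lit 0).eval σ) ((IExpr.lit 0).eval σ)).tick
        ((IExpr.lit 0).cost + (IExpr.lit 0).cost + 1)) = m := by simp [hm]
    rw [this, hNm] at h3 h4
    exact ⟨fun p => h3 p p.2, by omega⟩

/-- The law of the rows that the sampler chooses. -/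
def samplerLaw {m n : ℕ} [NeZero m] (hnm : n ≤ m) (A : Matrix (Fin m) (Fin m) ℂ) :
    PMF (Fin n → Fin m) :=
  (permLaw n).bind fun π => rowsLaw A n (Fin.castLE hnm ∘ π)

/-- The memory keeps only the multiplicities of the chosen rows. They determine the sorted array,
which is why the output can be stated in terms of `Tuple.sort`. -/
theorem coupled_bosonSampler {m n : ℕ} [NeZero m] (hnm : n ≤ m) (A : Matrix (Fin m) (Fin m) ℂ) :
    Coupled (samplerLaw hnm A) (finalLaw n A) fun r τ =>
      (∀ p : Fin n, τ.int .z p = (r ∘ Tuple.sort r) p) ∧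
      τ.time ≤ 1000 * (n * n + m + 1) + rowsTime n r := by
  unfold finalLaw bosonSampler samplerLaw
  refine coupled_seq (coupled_permute (n := n) (by simp [start])).frame ?_
  rintro π τ ⟨⟨hτi, -⟩, h1, h2⟩
  have e1 := hτi .m (by rfl)
  have e2 := hτi .n (by rfl)
  -- One function on the naturals describes all prefixes of the column order at once; its value 0
  -- beyond `n` is never read.
  set c : ℕ → Fin m := fun j => if h : j < n then Fin.castLE hnm (π ⟨j, h⟩) else 0 with hc
  have hcπ : (Fin.castLE hnm ∘ π) = fun j : Fin n => c j := by
    ext j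
    simp [hc]
  rw [hcπ]
  refine Exec.coupled_seq ((exec_loop (fun v ρ => (∀ i < v, ρ.int .s i = 0) ∧
    ρ.time ≤ τ.time + 10 * v + 10) ?_ ?_).frame.mono ?_)
  · simp
  · rintro v ρ hv ⟨g1, g2⟩
    refine exec_setI ⟨?_, ?_⟩
    · intro i hi
      by_cases hiv : i = v
      · subst hiv
        simp
      · simpa [hiv] using g1 i (by omega)
    · simp
      omega
  rintro ρ ⟨⟨hρi, -⟩, g1, g2⟩
  have f1 := hρi .m (by rfl)
  have f2 := hρi .n (by rfl)
  have f3 := hρi .perm (by rfl)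
  have hm : (iv .m).eval τ = m := by simp [e1, start]
  rw [hm] at g1 g2
  refine Exec.coupled_seq (exec_setN ?_)
  refine coupled_seq_exec (coupled_rounds A (c := c) (r := fun j => j.elim0)
    ⟨?_, ?_, ?_, ?_, ?_⟩) ?_
  · simp [f1, e1, start]
  · simp [f2, e2, start]
  · intro j hj
    simpa [f3, hc, hj] using h1 ⟨j, hj⟩
  · intro i
    simp [g1 i i.2, mult]
  · simp
  · rintro r ω ⟨q1, q2⟩
    refine (exec_sortedOutput (Tuple.monotone_sort r) q1.m_eq ?_).mono ?_
    · intro i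
      rw [q1.s_eq i, mult_comp_perm]
    · rintro ω' ⟨w1, w2⟩
      refine ⟨w1, ?_⟩
      simp [start] at q2 h2
      have : n ≤ n * n := Nat.le_mul_self n
      omega

end BosonSampling

end

noncomputable section

namespace BosonSampling

/-! ### The law of the chosen rows -/

theorem perSq_nonneg {m k : ℕ} (A : Matrix (Fin m) (Fin m) ℂ) (r c : Fin k → Fin m) :
    0 ≤ perSq A r c :=
  sq_nonneg _

theorem perSq_comp_left {m k : ℕ} (A : Matrix (Fin m) (Fin m) ℂ) (r c : Fin k → Fin m)
    (σ : Equiv.Perm (Fin k)) : perSq A (r ∘ σ) c = perSq A r c := by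
  unfold perSq
  rw [← Matrix.permanent_permute_cols σ (A.submatrix r c)]
  rfl

theorem perSq_comp_right {m k : ℕ} (A : Matrix (Fin m) (Fin m) ℂ) (r c : Fin k → Fin m)
    (σ : Equiv.Perm (Fin k)) : perSq A r (c ∘ σ) = perSq A r c := by
  unfold perSq
  rw [← Matrix.permanent_permute_rows σ (A.submatrix r c)]
  rfl

theorem sum_norm_sq_unitary {m k : ℕ} {A : Matrix (Fin m) (Fin m) ℂ}
    (hA : A ∈ Matrix.unitaryGroup (Fin m) ℂ) {c : Fin k → Fin m} (hc : Function.Injective c)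
    (p : Fin k → ℂ) : ∑ i, ‖∑ l, A i (c l) * p l‖ ^ 2 = ∑ l, ‖p l‖ ^ 2 := by
  have hA' : ∀ a b, ∑ i, star (A i a) * A i b = if a = b then 1 else 0 := by
    intro a b
    have := congrFun (congrFun (Matrix.mem_unitaryGroup_iff'.1 hA) a) b
    simpa [Matrix.mul_apply, Matrix.star_apply, Matrix.one_apply] using this
  have key : ∑ i, ((‖∑ l, A i (c l) * p l‖ : ℂ) ^ 2) = ∑ l, ((‖p l‖ : ℂ) ^ 2) := by
    simp_rw [← Complex.conj_mul', map_sum, Finset.sum_mul_sum, map_mul]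
    rw [Finset.sum_comm]
    refine Finset.sum_congr rfl fun l _ => ?_
    rw [Finset.sum_comm]
    have : ∀ l', ∑ i, (starRingEnd ℂ) (A i (c l)) * (starRingEnd ℂ) (p l) *
        (A i (c l') * p l') = if l = l' then (starRingEnd ℂ) (p l) * p l' else 0 := by
      intro l'
      have h := hA' (c l) (c l')
      simp only [hc.eq_iff] at h
      have h2 : ∀ i, (starRingEnd ℂ) (A i (c l)) * (starRingEnd ℂ) (p l) * (A i (c l') * p l') =
          (star (A i (c l)) * A i (c l')) * ((starRingEnd ℂ) (p l) * p l') := by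
        intro i
        simp only [Complex.star_def]
        ring
      simp_rw [h2]
      rw [← Finset.sum_mul, h]
      split_ifs <;> simp
    simp_rw [this]
    simp
  exact_mod_cast key

/-- Laplace expansion along the new row exhibits the weights as the squared entries of a combination
of orthonormal columns with the minors as coefficients. In particular the total is symmetric in the
columns. -/
theorem sum_perSq_snoc {m k : ℕ} {A : Matrix (Fin m) (Fin m) ℂ}
    (hA : A ∈ Matrix.unitaryGroup (Fin m) ℂ) (r : Fin k → Fin m) {c : Fin (k + 1) → Fin m}
    (hc : Function.Injective c) :
    ∑ i, perSq A (Fin.snoc r i) c = ∑ l : Fin (k + 1), perSq A r (c ∘ l.succAbove) := by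
  simp_rw [perSq_snoc]
  exact sum_norm_sq_unitary hA hc _

theorem sum_perSq {m k : ℕ} {A : Matrix (Fin m) (Fin m) ℂ}
    (hA : A ∈ Matrix.unitaryGroup (Fin m) ℂ) {c : Fin k → Fin m} (hc : Function.Injective c) :
    ∑ r, perSq A r c = k.factorial := by
  induction k with
  | zero => simp [perSq, Matrix.permanent_isEmpty]
  | succ k ih =>
    rw [sum_snoc]
    simp_rw [sum_perSq_snoc hA _ hc]
    rw [Finset.sum_comm]
    simp_rw [fun l : Fin (k + 1) => ih (hc.comp (Fin.succAbove_right_injective (p := l)))]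
    simp [Nat.factorial_succ]

theorem rowsLaw_snoc {m k : ℕ} [NeZero m] (A : Matrix (Fin m) (Fin m) ℂ)
    (c : Fin (k + 1) → Fin m) (r : Fin k → Fin m) (i : Fin m) :
    rowsLaw A (k + 1) c (Fin.snoc r i : Fin (k + 1) → Fin m) =
      rowsLaw A k (c ∘ Fin.castSucc) r * drawLaw (fun i => perSq A (Fin.snoc r i) c) i := by
  rw [rowsLaw, PMF.bind_apply, tsum_eq_single r]
  · rw [PMF.map_apply, tsum_eq_single i]
    · simp
    · intro j hj
      rw [if_neg]
      intro h
      exact hj (by simpa using (congrFun h (Fin.last k)).symm)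
  · intro r' hr'
    rw [PMF.map_apply, ENNReal.tsum_eq_zero.2, mul_zero]
    intro j
    rw [if_neg]
    intro h
    refine hr' (funext fun a => ?_)
    simpa using (congrFun h a.castSucc).symm

/-- In the last step neither the weight nor the total depends on the column order. Sorting the
orders by their last column l, induction gives the first k rows the mass ∑_l |Per|² over the columns
without the l-th, which is precisely the total weight and cancels it. -/
theorem sum_perm_rowsLaw {m k : ℕ} [NeZero m] {A : Matrix (Fin m) (Fin m) ℂ}
    (hA : A ∈ Matrix.unitaryGroup (Fin m) ℂ) {c : Fin k → Fin m} (hc : Function.Injective c)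
    (r : Fin k → Fin m) :
    ∑ σ : Equiv.Perm (Fin k), rowsLaw A k (c ∘ σ) r = ENNReal.ofReal (perSq A r c) := by
  induction k with
  | zero =>
    rw [Fintype.sum_eq_single 1 fun τ hτ => absurd (Subsingleton.elim τ 1) hτ]
    have : r = c ∘ (1 : Equiv.Perm (Fin 0)) := Subsingleton.elim _ _
    simp [rowsLaw, perSq, Matrix.permanent_isEmpty, this]
  | succ k ih =>
    obtain ⟨r, i, rfl⟩ : ∃ r' i', r = Fin.snoc r' i' := ⟨Fin.init r, r (Fin.last k), by simp⟩
    simp_rw [rowsLaw_snoc, perSq_comp_right]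
    rw [← Finset.sum_mul, sum_perm_succ]
    have h1 : ∀ (l : Fin (k + 1)) (τ : Equiv.Perm (Fin k)),
        (c ∘ permSnoc (l, τ)) ∘ Fin.castSucc = (c ∘ l.succAbove) ∘ τ := by
      intro l τ
      ext a
      simp
    simp_rw [h1, fun l : Fin (k + 1) => ih (hc.comp (Fin.succAbove_right_injective (p := l))) r]
    rw [← ENNReal.ofReal_sum_of_nonneg fun l _ => perSq_nonneg _ _ _, ← sum_perSq_snoc hA r hc]
    have hW : 0 ≤ ∑ i, perSq A (Fin.snoc r i) c := Finset.sum_nonneg fun _ _ => perSq_nonneg _ _ _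
    -- If the total weight is zero, so is the weight of i, and both sides vanish whatever is drawn.
    rcases hW.eq_or_lt with h0 | h0
    · have := (Finset.sum_eq_zero_iff_of_nonneg fun i _ => perSq_nonneg _ _ _).1 h0.symm i
        (Finset.mem_univ i)
      rw [← h0, this]
      simp
    · rw [drawLaw_apply (fun _ => perSq_nonneg _ _ _) h0, ← ENNReal.ofReal_mul hW,
        mul_div_cancel₀ _ h0.ne']

theorem samplerLaw_apply {m n : ℕ} [NeZero m] (hnm : n ≤ m) {A : Matrix (Fin m) (Fin m) ℂ}
    (hA : A ∈ Matrix.unitaryGroup (Fin m) ℂ) (r : Fin n → Fin m) :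
    samplerLaw hnm A r =
      (n.factorial : ℝ≥0∞)⁻¹ * ENNReal.ofReal (perSq A r (Fin.castLE hnm)) := by
  have h := expect_permLaw n fun π => rowsLaw A n (Fin.castLE hnm ∘ π) r
  rw [sum_perm_rowsLaw hA (Fin.castLE_injective hnm)] at h
  rw [← h, samplerLaw, PMF.bind_apply]
  rfl

theorem outputLaw_eq_map {m n : ℕ} [NeZero m] (hnm : n ≤ m) (A : Matrix (Fin m) (Fin m) ℂ) :
    outputLaw n A = (samplerLaw hnm A).map fun (r : Fin n → Fin m) (p : Fin n) =>
      ((r ∘ Tuple.sort r) p : ℕ) :=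
  Coupled.map_eq ((coupled_bosonSampler hnm A).mono fun _ _ _ _ h => funext h.1)

/-- Permuting rows leaves the permanent unchanged, so the arrays that sort to `z` are equally
likely; `card_mult_eq` counts them as n!/∏ s_j!. -/
theorem outputLaw_apply {m n : ℕ} [NeZero m] (hnm : n ≤ m) {A : Matrix (Fin m) (Fin m) ℂ}
    (hA : A ∈ Matrix.unitaryGroup (Fin m) ℂ) {z : Fin n → Fin m} (hz : Monotone z) :
    outputLaw n A (fun i => (z i : ℕ)) = ENNReal.ofReal (bosonPMF hnm A z) := by
  classical
  have h1 : ∀ r : Fin n → Fin m, ((fun i => (z i : ℕ)) = fun p => ((r ∘ Tuple.sort r) p : ℕ)) ↔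
      mult r = mult z := by
    intro r
    constructor
    · intro h
      have : z = r ∘ Tuple.sort r := funext fun p => Fin.ext (congrFun h p)
      rw [this, mult_comp_perm]
    · intro h
      have : z = r ∘ Tuple.sort r := eq_of_monotone_of_mult_eq hz (Tuple.monotone_sort r)
        (by rw [mult_comp_perm, h])
      exact funext fun p => congrArg Fin.val (congrFun this p)
  rw [outputLaw_eq_map hnm, PMF.map_apply, tsum_fintype]
  simp_rw [h1, samplerLaw_apply hnm hA]
  rw [← Finset.sum_filter]
  have h2 : ∀ r ∈ Finset.univ.filter fun r : Fin n → Fin m => mult r = mult z,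
      (n.factorial : ℝ≥0∞)⁻¹ * ENNReal.ofReal (perSq A r (Fin.castLE hnm)) =
        (n.factorial : ℝ≥0∞)⁻¹ * ENNReal.ofReal (perSq A z (Fin.castLE hnm)) := by
    intro r hr
    obtain ⟨σ, rfl⟩ := exists_perm_of_mult_eq (Finset.mem_filter.1 hr).2
    rw [perSq_comp_left]
  rw [Finset.sum_congr rfl h2, Finset.sum_const, nsmul_eq_mul]
  set N := (Finset.univ.filter fun r : Fin n → Fin m => mult r = mult z).card with hN
  have h3 : (∏ j, (mult z j).factorial) * N = n.factorial := card_mult_eq z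
  have h4 : bosonPMF hnm A z =
      N * ((n.factorial : ℝ)⁻¹ * perSq A z (Fin.castLE hnm)) := by
    have hP : (∏ j, ((mult z j).factorial : ℝ)) ≠ 0 :=
      Finset.prod_ne_zero_iff.2 fun j _ => by positivity
    have h3' : (∏ j, ((mult z j).factorial : ℝ)) * N = n.factorial := by exact_mod_cast h3
    have hn : (n.factorial : ℝ) ≠ 0 := by positivity
    unfold bosonPMF
    change perSq A z (Fin.castLE hnm) / _ = _
    rw [div_eq_iff hP]
    calc perSq A z (Fin.castLE hnm) = (n.factorial : ℝ)⁻¹ * n.factorial *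
          perSq A z (Fin.castLE hnm) := by rw [inv_mul_cancel₀ hn, one_mul]
      _ = _ := by
        rw [← h3']
        ring
  rw [h4, ENNReal.ofReal_mul (by positivity), ENNReal.ofReal_mul (by positivity),
    ENNReal.ofReal_inv_of_pos (by positivity), ENNReal.ofReal_natCast, ENNReal.ofReal_natCast]

theorem exists_monotone_of_mem_support {m n : ℕ} [NeZero m] (hnm : n ≤ m)
    (A : Matrix (Fin m) (Fin m) ℂ) {y : Fin n → ℕ} (hy : y ∈ (outputLaw n A).support) :
    ∃ z : Fin n → Fin m, Monotone z ∧ y = fun i => (z i : ℕ) := by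
  rw [outputLaw_eq_map hnm] at hy
  obtain ⟨r, -, rfl⟩ := (PMF.mem_support_map_iff _ _ _).1 hy
  exact ⟨r ∘ Tuple.sort r, Tuple.monotone_sort r, rfl⟩

/-! ### The expected time for a given matrix -/

/-- The cost of a round depends only on the rows chosen before it, whose law is the chain stopped at
that round. -/
theorem expect_rowsTime {m : ℕ} [NeZero m] (A : Matrix (Fin m) (Fin m) ℂ) (c : ℕ → Fin m)
    (k : ℕ) : expect (rowsLaw A k fun j : Fin k => c j) (fun r => (rowsTime k r : ℝ≥0∞)) =
      ∑ j ∈ Finset.range k, expect (rowsLaw A j fun i : Fin j => c i) fun r =>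
        ((2000 * ((j + 1) * codeLength r + m * (j + 1)) : ℕ) : ℝ≥0∞) := by
  induction k with
  | zero => simp [rowsLaw, expect_pure, rowsTime]
  | succ k ih =>
    rw [Finset.sum_range_succ, ← ih, ← expect_add, rowsLaw, expect_bind]
    congr 1
    ext r
    rw [expect_map]
    have : (fun r : Fin (k + 1) → Fin m => (rowsTime (k + 1) r : ℝ≥0∞)) ∘ Fin.snoc r =
        fun _ => (rowsTime k r : ℝ≥0∞) +
          ((2000 * ((k + 1) * codeLength r + m * (k + 1)) : ℕ) : ℝ≥0∞) := by
      ext i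
      simp only [Function.comp_apply, rowsTime, Fin.init_snoc]
      push_cast
      rfl
    rw [this, expect_const]

/-- Before the last round only a prefix of the columns has been used. Its internal order is still
uniform, so `sum_perm_rowsLaw` applies after averaging over rearrangements of the prefix. -/
theorem sum_perm_expect_rowsLaw {m n j : ℕ} [NeZero m] (hnm : n ≤ m) (hj : j ≤ n)
    {A : Matrix (Fin m) (Fin m) ℂ} (hA : A ∈ Matrix.unitaryGroup (Fin m) ℂ)
    (g : (Fin j → Fin m) → ℝ≥0∞) :
    ∑ π : Equiv.Perm (Fin n),
      expect (rowsLaw A j (Fin.castLE hnm ∘ π ∘ Fin.castLE hj)) g =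
    ∑ π : Equiv.Perm (Fin n), (j.factorial : ℝ≥0∞)⁻¹ *
      ∑ r, ENNReal.ofReal (perSq A r (Fin.castLE hnm ∘ π ∘ Fin.castLE hj)) * g r := by
  have h1 : ∀ τ : Equiv.Perm (Fin j), ∑ π : Equiv.Perm (Fin n),
      expect (rowsLaw A j (Fin.castLE hnm ∘ π ∘ Fin.castLE hj)) g =
      ∑ π : Equiv.Perm (Fin n),
        expect (rowsLaw A j ((Fin.castLE hnm ∘ π ∘ Fin.castLE hj) ∘ τ)) g := by
    intro τ
    -- A permutation τ of the first j positions extends to all n, and multiplying by it merely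
    -- reindexes the sum over π.
    set e : Fin j ↪ Fin n := ⟨Fin.castLE hj, Fin.castLE_injective hj⟩
    rw [← Equiv.sum_comp (Equiv.mulRight (τ.viaFintypeEmbedding e))]
    refine Finset.sum_congr rfl fun π _ => ?_
    congr 2
    ext a
    have := τ.viaFintypeEmbedding_apply_image e a
    simp only [e, Function.Embedding.coeFn_mk] at this
    simp [e, this]
  have hj0 : (j.factorial : ℝ≥0∞) ≠ 0 := by exact_mod_cast j.factorial_ne_zero
  have hjt : (j.factorial : ℝ≥0∞) ≠ ⊤ := ENNReal.natCast_ne_top _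
  have h2 : ∑ τ : Equiv.Perm (Fin j), ∑ π : Equiv.Perm (Fin n),
      expect (rowsLaw A j (Fin.castLE hnm ∘ π ∘ Fin.castLE hj)) g =
        j.factorial * ∑ π : Equiv.Perm (Fin n),
          expect (rowsLaw A j (Fin.castLE hnm ∘ π ∘ Fin.castLE hj)) g := by
    simp [Fintype.card_perm]
  rw [← Finset.mul_sum, ← one_mul (∑ π : Equiv.Perm (Fin n), expect _ g),
    ← ENNReal.inv_mul_cancel hj0 hjt, mul_assoc, ← h2]
  congr 1
  rw [Finset.sum_congr rfl fun τ _ => h1 τ, Finset.sum_comm]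
  refine Finset.sum_congr rfl fun π _ => ?_
  simp only [expect, tsum_fintype]
  rw [Finset.sum_comm]
  refine Finset.sum_congr rfl fun r _ => ?_
  rw [← Finset.sum_mul, sum_perm_rowsLaw hA]
  exact (Fin.castLE_injective hnm).comp (π.injective.comp (Fin.castLE_injective hj))

theorem expectedTime_le {m n : ℕ} [NeZero m] (hnm : n ≤ m) {A : Matrix (Fin m) (Fin m) ℂ}
    (hA : A ∈ Matrix.unitaryGroup (Fin m) ℂ) :
    expectedTime n A ≤ ((1000 * (n * n + m + 1) : ℕ) : ℝ≥0∞) +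
      (n.factorial : ℝ≥0∞)⁻¹ * ∑ j : Fin n, ∑ π : Equiv.Perm (Fin n),
        ((j : ℕ).factorial : ℝ≥0∞)⁻¹ * ∑ r : Fin j → Fin m,
          ENNReal.ofReal (perSq A r (Fin.castLE hnm ∘ π ∘ Fin.castLE j.2.le)) *
            ((2000 * ((j + 1) * codeLength r + m * (j + 1)) : ℕ) : ℝ≥0∞) := by
  have h1 : expectedTime n A ≤ expect (samplerLaw hnm A) fun r =>
      ((1000 * (n * n + m + 1) : ℕ) : ℝ≥0∞) + (rowsTime n r : ℝ≥0∞) := by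
    refine Coupled.expect_le ((coupled_bosonSampler hnm A).mono fun r τ _ _ h => ?_)
    exact_mod_cast h.2
  refine h1.trans ?_
  rw [expect_add, expect_const, samplerLaw, expect_bind, expect_permLaw]
  gcongr
  have h2 : ∀ π : Equiv.Perm (Fin n), expect (rowsLaw A n (Fin.castLE hnm ∘ π))
      (fun r => (rowsTime n r : ℝ≥0∞)) = ∑ j : Fin n,
        expect (rowsLaw A j (Fin.castLE hnm ∘ π ∘ Fin.castLE j.2.le)) fun r =>
          ((2000 * ((j + 1) * codeLength r + m * (j + 1)) : ℕ) : ℝ≥0∞) := by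
    intro π
    set c : ℕ → Fin m := fun j => if h : j < n then Fin.castLE hnm (π ⟨j, h⟩) else 0 with hc
    have h3 : (Fin.castLE hnm ∘ π) = fun j : Fin n => c j := by
      ext j
      simp [hc]
    rw [h3, expect_rowsTime, Finset.sum_range]
    refine Finset.sum_congr rfl fun j _ => ?_
    congr 2
    ext i
    have : (i : ℕ) < n := by omega
    simp [hc, this]
    rfl
  simp_rw [h2]
  rw [Finset.sum_comm]
  refine le_of_eq (Finset.sum_congr rfl fun j _ => ?_)
  exact sum_perm_expect_rowsLaw hnm j.2.le hA _

end BosonSampling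

end

noncomputable section

namespace BosonSampling

/-! ### Averages over the unitary group -/

instance instIsMulLeftInvariantHaarUnitary (m : ℕ) : (haarUnitary m).IsMulLeftInvariant := by
  unfold haarUnitary
  infer_instance

instance instIsProbabilityMeasureHaarUnitary (m : ℕ) : IsProbabilityMeasure (haarUnitary m) := by
  refine ⟨?_⟩
  have := Measure.haarMeasure_self
    (K₀ := (⊤ : PositiveCompacts (Matrix.unitaryGroup (Fin m) ℂ)))
  simpa [haarUnitary] using this

theorem continuous_entry {m : ℕ} (i j : Fin m) :
    Continuous fun A : Matrix.unitaryGroup (Fin m) ℂ => A.1 i j :=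
  continuous_subtype_val.matrix_elem i j

theorem integrable_haar {m : ℕ} {E : Type*} [NormedAddCommGroup E]
    {f : Matrix.unitaryGroup (Fin m) ℂ → E} (hf : Continuous f) :
    Integrable f (haarUnitary m) :=
  hf.integrable_of_hasCompactSupport (HasCompactSupport.of_compactSpace f)

/-- The product of the entries in the rows `f` and the columns `c`. -/
def entryProd {m k : ℕ} (c f : Fin k → Fin m) (A : Matrix (Fin m) (Fin m) ℂ) : ℂ :=
  ∏ l, A (f l) (c l)

theorem continuous_entryProd {m k : ℕ} (c f : Fin k → Fin m) :
    Continuous fun A : Matrix.unitaryGroup (Fin m) ℂ => entryProd c f A.1 :=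
  continuous_finsetProd _ fun l _ => continuous_entry (f l) (c l)

/-- The correlation of two products of entries under the Haar measure. -/
def entryCorr {m k : ℕ} (c f g : Fin k → Fin m) : ℂ :=
  ∫ A : Matrix.unitaryGroup (Fin m) ℂ,
    entryProd c f A.1 * (starRingEnd ℂ) (entryProd c g A.1) ∂haarUnitary m

theorem integrable_entryProd_mul {m k : ℕ} (c f g : Fin k → Fin m) :
    Integrable (fun A : Matrix.unitaryGroup (Fin m) ℂ =>
      entryProd c f A.1 * (starRingEnd ℂ) (entryProd c g A.1)) (haarUnitary m) :=
  integrable_haar ((continuous_entryProd c f).mul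
    (Complex.continuous_conj.comp (continuous_entryProd c g)))

theorem entryProd_diagonal_mul {m k : ℕ} (c f : Fin k → Fin m) (t : Fin m → ℂ)
    (A : Matrix (Fin m) (Fin m) ℂ) :
    entryProd c f (Matrix.diagonal t * A) = (∏ j, t j ^ mult f j) * entryProd c f A := by
  unfold entryProd
  simp_rw [Matrix.diagonal_mul]
  rw [Finset.prod_mul_distrib, prod_comp_eq_prod_pow_mult]

/-- Multiplying one row by a root of unity u preserves Haar measure but scales the correlation by a
power of u. Multiplicities are at most k, so order k + 1 suffices to tell two different ones apart.
-/
theorem entryCorr_eq_zero {m k : ℕ} (c : Fin k → Fin m) {f g : Fin k → Fin m}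
    (h : mult f ≠ mult g) : entryCorr c f g = 0 := by
  classical
  obtain ⟨j₀, hj₀⟩ := Function.ne_iff.1 h
  set u : ℂ := Complex.exp (2 * Real.pi * Complex.I / ((k + 1 : ℕ) : ℂ)) with hu
  have hprim : IsPrimitiveRoot u (k + 1) := Complex.isPrimitiveRoot_exp (k + 1) (Nat.succ_ne_zero k)
  have hnorm : ‖u‖ = 1 := hprim.norm'_eq_one (Nat.succ_ne_zero k)
  have hconj : u * (starRingEnd ℂ) u = 1 := by
    rw [Complex.mul_conj', hnorm]
    simp
  set t : Fin m → ℂ := Function.update 1 j₀ u with ht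
  have ht1 : ∀ j, t j * (starRingEnd ℂ) (t j) = 1 := by
    intro j
    by_cases hj : j = j₀
    · subst hj
      simpa [ht] using hconj
    · simp [ht, hj]
  have hD : Matrix.diagonal t ∈ Matrix.unitaryGroup (Fin m) ℂ := by
    rw [Matrix.mem_unitaryGroup_iff, Matrix.star_eq_conjTranspose, Matrix.diagonal_conjTranspose,
      Matrix.diagonal_mul_diagonal, ← Matrix.diagonal_one]
    congr 1
    ext j
    simpa using ht1 j
  have hprod : ∀ f : Fin k → Fin m, ∏ j, t j ^ mult f j = u ^ mult f j₀ := by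
    intro f
    rw [Finset.prod_eq_single j₀]
    · simp [ht]
    · intro j _ hj
      simp [ht, hj]
    · simp
  have key := integral_mul_left_eq_self (μ := haarUnitary m)
    (fun A : Matrix.unitaryGroup (Fin m) ℂ =>
      entryProd c f A.1 * (starRingEnd ℂ) (entryProd c g A.1)) ⟨Matrix.diagonal t, hD⟩
  have h1 : ∀ A : Matrix.unitaryGroup (Fin m) ℂ,
      entryProd c f ((⟨Matrix.diagonal t, hD⟩ * A : Matrix.unitaryGroup (Fin m) ℂ)).1 *
        (starRingEnd ℂ)
          (entryProd c g ((⟨Matrix.diagonal t, hD⟩ * A : Matrix.unitaryGroup (Fin m) ℂ)).1) =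
      (u ^ mult f j₀ * (starRingEnd ℂ) u ^ mult g j₀) *
        (entryProd c f A.1 * (starRingEnd ℂ) (entryProd c g A.1)) := by
    intro A
    change entryProd c f (Matrix.diagonal t * A.1) *
      (starRingEnd ℂ) (entryProd c g (Matrix.diagonal t * A.1)) = _
    rw [entryProd_diagonal_mul, entryProd_diagonal_mul, hprod, hprod, map_mul, map_pow]
    ring
  simp_rw [h1] at key
  rw [integral_const_mul] at key
  change _ * entryCorr c f g = entryCorr c f g at key
  by_contra hne
  have h2 : u ^ mult f j₀ * (starRingEnd ℂ) u ^ mult g j₀ = 1 :=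
    mul_right_cancel₀ hne (key.trans (one_mul _).symm)
  refine hj₀ (hprim.pow_inj (Nat.lt_succ_of_le (mult_le f j₀)) (Nat.lt_succ_of_le (mult_le g j₀)) ?_)
  calc u ^ mult f j₀ = u ^ mult f j₀ * (u * (starRingEnd ℂ) u) ^ mult g j₀ := by
        rw [hconj, one_pow, mul_one]
    _ = (u ^ mult f j₀ * (starRingEnd ℂ) u ^ mult g j₀) * u ^ mult g j₀ := by
        rw [mul_pow]
        ring
    _ = u ^ mult g j₀ := by rw [h2, one_mul]

/-! ### Mean squares of products of column forms. -/

/-- The product of the linear forms given by the columns `c`, at the point `x`. -/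
def colForm {m k : ℕ} (c : Fin k → Fin m) (x : Fin m → ℂ) (A : Matrix (Fin m) (Fin m) ℂ) : ℂ :=
  ∏ l, Matrix.vecMul x A (c l)

theorem colForm_eq_sum {m k : ℕ} (c : Fin k → Fin m) (x : Fin m → ℂ)
    (A : Matrix (Fin m) (Fin m) ℂ) :
    colForm c x A = ∑ f : Fin k → Fin m, (∏ l, x (f l)) * entryProd c f A := by
  unfold colForm entryProd
  simp_rw [Matrix.vecMul, dotProduct]
  rw [Finset.prod_univ_sum, Fintype.piFinset_univ]
  simp_rw [Finset.prod_mul_distrib]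

/-- The mean square of the product of linear forms. -/
def formMean {m k : ℕ} (c : Fin k → Fin m) (x : Fin m → ℂ) : ℂ :=
  ∫ A : Matrix.unitaryGroup (Fin m) ℂ,
    colForm c x A.1 * (starRingEnd ℂ) (colForm c x A.1) ∂haarUnitary m

theorem formMean_eq_sum {m k : ℕ} (c : Fin k → Fin m) (x : Fin m → ℂ) :
    formMean c x = ∑ f : Fin k → Fin m, ∑ g : Fin k → Fin m,
      ((∏ l, x (f l)) * (starRingEnd ℂ) (∏ l, x (g l))) * entryCorr c f g := by
  unfold formMean entryCorr
  simp_rw [colForm_eq_sum, map_sum, Finset.sum_mul_sum]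
  have h : ∀ (f g : Fin k → Fin m) (A : Matrix (Fin m) (Fin m) ℂ),
      (∏ l, x (f l)) * entryProd c f A * (starRingEnd ℂ) ((∏ l, x (g l)) * entryProd c g A) =
        ((∏ l, x (f l)) * (starRingEnd ℂ) (∏ l, x (g l))) *
          (entryProd c f A * (starRingEnd ℂ) (entryProd c g A)) := by
    intro f g A
    rw [map_mul]
    ring
  simp_rw [h]
  rw [integral_finsetSum]
  · refine Finset.sum_congr rfl fun f _ => ?_
    rw [integral_finsetSum]
    · refine Finset.sum_congr rfl fun g _ => ?_
      rw [integral_const_mul]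
    · exact fun g _ => (integrable_entryProd_mul c f g).const_mul _
  · exact fun f _ => integrable_finsetSum _ fun g _ =>
      (integrable_entryProd_mul c f g).const_mul _

theorem formMean_vecMul {m k : ℕ} (c : Fin k → Fin m) (x : Fin m → ℂ)
    {B : Matrix (Fin m) (Fin m) ℂ} (hB : B ∈ Matrix.unitaryGroup (Fin m) ℂ) :
    formMean c (Matrix.vecMul x B) = formMean c x := by
  have key := integral_mul_left_eq_self (μ := haarUnitary m)
    (fun A : Matrix.unitaryGroup (Fin m) ℂ =>
      colForm c x A.1 * (starRingEnd ℂ) (colForm c x A.1)) ⟨B, hB⟩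
  rw [formMean, formMean, ← key]
  have h : ∀ A : Matrix.unitaryGroup (Fin m) ℂ, colForm c (Matrix.vecMul x B) A.1 =
      colForm c x ((⟨B, hB⟩ * A : Matrix.unitaryGroup (Fin m) ℂ)).1 := by
    intro A
    change _ = colForm c x (B * A.1)
    unfold colForm
    rw [Matrix.vecMul_vecMul]
  simp_rw [h]

theorem formMean_smul {m k : ℕ} (c : Fin k → Fin m) (ρ : ℝ) (x : Fin m → ℂ) :
    formMean c ((ρ : ℂ) • x) = ((ρ : ℂ) ^ 2) ^ k * formMean c x := by
  have h : ∀ A, colForm c ((ρ : ℂ) • x) A = (ρ : ℂ) ^ k * colForm c x A := by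
    intro A
    unfold colForm
    rw [Matrix.smul_vecMul]
    simp [Finset.prod_mul_distrib]
  unfold formMean
  rw [← integral_const_mul]
  congr 1
  ext A
  rw [h, map_mul, map_pow, Complex.conj_ofReal]
  ring

/-- A Householder reflection, in the hyperplane orthogonal to v = x - |x| e₀. Real vectors are
enough, because the squares of real numbers already determine a polynomial. -/
theorem exists_unitary_vecMul_eq {m : ℕ} [NeZero m] (x : Fin m → ℝ) :
    ∃ B ∈ Matrix.unitaryGroup (Fin m) ℂ, Matrix.vecMul (fun i => (x i : ℂ)) B =
      ((√(∑ i, x i ^ 2) : ℝ) : ℂ) • Pi.single 0 1 := by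
  set ρ := √(∑ i, x i ^ 2) with hρ
  have hρ2 : ρ ^ 2 = x ⬝ᵥ x := by
    rw [hρ, Real.sq_sqrt (Finset.sum_nonneg fun i _ => sq_nonneg _)]
    simp [dotProduct, sq]
  set e : Fin m → ℝ := ρ • Pi.single 0 1 with he
  have hee : e ⬝ᵥ e = x ⬝ᵥ x := by
    rw [← hρ2, he]
    simp [sq]
  suffices ∃ H : Matrix (Fin m) (Fin m) ℝ, H * H.transpose = 1 ∧ Matrix.vecMul x H = e by
    obtain ⟨H, h1, h2⟩ := this
    refine ⟨H.map Complex.ofRealHom, ?_, ?_⟩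
    · rw [Matrix.mem_unitaryGroup_iff]
      have h3 : star (H.map Complex.ofRealHom) = H.transpose.map Complex.ofRealHom := by
        ext i j
        simp [Matrix.star_apply]
      rw [h3, ← Matrix.map_mul, h1]
      simp
    · have h3 := RingHom.map_vecMul Complex.ofRealHom H x
      ext j
      have h4 := h3 j
      rw [h2] at h4
      change Matrix.vecMul (Complex.ofRealHom ∘ x) (H.map Complex.ofRealHom) j = _
      rw [← h4, he]
      by_cases hj : j = 0
      · subst hj
        simp
      · simp [hj]
  -- The reflection divides by |v|², so the case v = 0 is settled by the identity.
  by_cases hv : x = e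
  · exact ⟨1, by simp, by simpa using hv⟩
  · set v := x - e with hvdef
    have hvv : v ⬝ᵥ v ≠ 0 := by
      intro h
      exact hv (sub_eq_zero.1 (dotProduct_self_eq_zero.1 h))
    set V := Matrix.vecMulVec v v with hV
    have hVV : V * V = (v ⬝ᵥ v) • V := by
      rw [hV, Matrix.vecMulVec_mul_vecMulVec, Matrix.vecMulVec_smul]
    have hVT : V.transpose = V := by
      rw [hV, Matrix.transpose_vecMulVec]
    refine ⟨1 - (2 / (v ⬝ᵥ v)) • V, ?_, ?_⟩
    · rw [Matrix.transpose_sub, Matrix.transpose_smul, hVT, Matrix.transpose_one, sub_mul, mul_sub,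
        mul_sub, Matrix.smul_mul, Matrix.mul_smul, Matrix.mul_smul, Matrix.smul_mul, hVV, smul_smul,
        smul_smul]
      have : 2 / (v ⬝ᵥ v) * (2 / (v ⬝ᵥ v)) * (v ⬝ᵥ v) = 2 / (v ⬝ᵥ v) + 2 / (v ⬝ᵥ v) := by
        field_simp
        norm_num
      rw [this, add_smul]
      simp
    · rw [Matrix.vecMul_sub, Matrix.vecMul_one, Matrix.vecMul_smul, hV, Matrix.vecMul_vecMulVec,
        smul_smul]
      have h1 : v ⬝ᵥ v = 2 * (x ⬝ᵥ v) := by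
        rw [hvdef]
        simp only [sub_dotProduct, dotProduct_sub, hee, dotProduct_comm e x]
        ring
      have h2 : 2 / (v ⬝ᵥ v) * (x ⬝ᵥ v) = 1 := by
        rw [h1] at hvv ⊢
        field_simp
        exact div_self (fun h => hvv (by rw [h, mul_zero]))
      rw [h2, one_smul, hvdef]
      simp

theorem formMean_ofReal {m k : ℕ} [NeZero m] (c : Fin k → Fin m) (x : Fin m → ℝ) :
    formMean c (fun i => (x i : ℂ)) =
      ((∑ i, x i ^ 2 : ℝ) : ℂ) ^ k * formMean c (Pi.single 0 1) := by
  obtain ⟨B, hB, h⟩ := exists_unitary_vecMul_eq x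
  rw [← formMean_vecMul c _ hB, h, formMean_smul, ← Complex.ofReal_pow,
    Real.sq_sqrt (Finset.sum_nonneg fun i _ => sq_nonneg _)]

theorem sum_single_eq_iff {m k : ℕ} (f g : Fin k → Fin m) :
    (∑ l, Finsupp.single (f l) 1 : Fin m →₀ ℕ) = ∑ l, Finsupp.single (g l) 1 ↔
      mult f = mult g := by
  have h : ∀ f : Fin k → Fin m, ⇑(∑ l, Finsupp.single (f l) 1 : Fin m →₀ ℕ) = mult f := by
    intro f
    ext j
    rw [Finsupp.finsetSum_apply, mult_eq_sum]
    simp [Finsupp.single_apply]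
  rw [← DFunLike.coe_fn_eq, h, h]

/-- For real x the mean square is K (∑ x_i²)^k by rotation invariance. Expanding it, with
correlations of different multiplicities absent, gives ∑_f J(f) ∏ x_{f(l)}². Both are polynomials in
the squares x_i², and the coefficient at the monomial of `r` is compared. -/
theorem sum_entryCorr_eq {m k : ℕ} [NeZero m] (c r : Fin k → Fin m) :
    ∑ f ∈ Finset.univ.filter (fun f : Fin k → Fin m => mult f = mult r),
      ∑ g ∈ Finset.univ.filter (fun g : Fin k → Fin m => mult g = mult r), entryCorr c f g =
    (Finset.univ.filter fun f : Fin k → Fin m => mult f = mult r).card *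
      formMean c (Pi.single 0 1) := by
  classical
  set K := formMean c (Pi.single 0 1) with hK
  set J : (Fin k → Fin m) → ℂ := fun f =>
    ∑ g ∈ Finset.univ.filter (fun g : Fin k → Fin m => mult g = mult f), entryCorr c f g with hJ
  have hsum : ∀ x : Fin m → ℝ, ∑ f : Fin k → Fin m, (J f - K) * ∏ l, ((x (f l) ^ 2 : ℝ) : ℂ) = 0 := by
    intro x
    have h1 := formMean_ofReal c x
    rw [formMean_eq_sum, ← hK] at h1
    have h2 : ((∑ i, x i ^ 2 : ℝ) : ℂ) ^ k =
        ∑ f : Fin k → Fin m, ∏ l, ((x (f l) ^ 2 : ℝ) : ℂ) := by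
      rw [Complex.ofReal_sum, ← Fin.prod_const, Finset.prod_univ_sum, Fintype.piFinset_univ]
    rw [h2, Finset.sum_mul] at h1
    simp_rw [sub_mul]
    rw [Finset.sum_sub_distrib, sub_eq_zero]
    simp_rw [mul_comm K]
    rw [← h1]
    refine Finset.sum_congr rfl fun f _ => ?_
    rw [hJ]
    simp only
    rw [Finset.sum_mul, Finset.sum_filter]
    refine Finset.sum_congr rfl fun g _ => ?_
    split_ifs with hfg
    · rw [mul_comm]
      congr 1
      rw [map_prod]
      simp only [Complex.conj_ofReal]
      rw [prod_comp_eq_prod_pow_mult g fun i => (x i : ℂ), hfg,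
        ← prod_comp_eq_prod_pow_mult f fun i => (x i : ℂ), ← Finset.prod_mul_distrib]
      refine Finset.prod_congr rfl fun l _ => ?_
      push_cast
      ring
    · rw [entryCorr_eq_zero c (Ne.symm hfg), mul_zero]
  set P : MvPolynomial (Fin m) ℂ :=
    ∑ f : Fin k → Fin m, MvPolynomial.monomial (∑ l, Finsupp.single (f l) 1) (J f - K) with hP
  have hP0 : P = 0 := by
    -- Squares of reals form an infinite set, and a polynomial that vanishes on a product of
    -- infinite sets is zero.
    refine MvPolynomial.funext_set (fun _ => Set.range fun y : ℝ => ((y ^ 2 : ℝ) : ℂ)) ?_ ?_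
    · intro _
      refine Set.infinite_of_injective_forall_mem (f := fun n : ℕ => (((n : ℝ) ^ 2 : ℝ) : ℂ)) ?_
        fun n => ⟨n, rfl⟩
      intro a b hab
      have : (a : ℝ) ^ 2 = (b : ℝ) ^ 2 := Complex.ofReal_injective hab
      exact_mod_cast (pow_left_inj₀ (Nat.cast_nonneg a) (Nat.cast_nonneg b) two_ne_zero).1 this
    · intro y hy
      choose x hx using fun i => hy i (Set.mem_univ i)
      have hx' : y = fun i => ((x i ^ 2 : ℝ) : ℂ) := funext fun i => (hx i).symm
      subst hx'
      rw [map_zero, ← hsum x, hP, map_sum]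
      refine Finset.sum_congr rfl fun f _ => ?_
      rw [MvPolynomial.monomial_sum_index, map_mul, MvPolynomial.eval_C, map_prod]
      congr 1
      refine Finset.prod_congr rfl fun l _ => ?_
      simp [MvPolynomial.eval_monomial]
  have hcoeff := congrArg (MvPolynomial.coeff (∑ l, Finsupp.single (r l) 1)) hP0
  rw [hP, MvPolynomial.coeff_sum, MvPolynomial.coeff_zero] at hcoeff
  simp_rw [MvPolynomial.coeff_monomial, sum_single_eq_iff] at hcoeff
  rw [← Finset.sum_filter, Finset.sum_sub_distrib, sub_eq_zero, Finset.sum_const,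
    nsmul_eq_mul] at hcoeff
  rw [← hcoeff]
  refine Finset.sum_congr rfl fun f hf => ?_
  rw [hJ]
  simp only [(Finset.mem_filter.1 hf).2]

theorem perSq_eq_entryProd {m k : ℕ} (A : Matrix (Fin m) (Fin m) ℂ) (r c : Fin k → Fin m) :
    ((perSq A r c : ℝ) : ℂ) = (factProd r : ℂ) ^ 2 *
      ∑ f ∈ Finset.univ.filter (fun f : Fin k → Fin m => mult f = mult r),
      ∑ g ∈ Finset.univ.filter (fun g : Fin k → Fin m => mult g = mult r),
        entryProd c f A * (starRingEnd ℂ) (entryProd c g A) := by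
  have h := permanent_repeated_rows (fun i j => A i (c j)) r
  change (A.submatrix r c).permanent = (factProd r : ℂ) * ∑ f ∈ _, entryProd c f A at h
  unfold perSq
  push_cast
  rw [← Complex.mul_conj', h, map_mul, map_sum, ← Finset.sum_mul_sum, Complex.conj_natCast]
  ring

theorem continuous_perSq {m k : ℕ} (r c : Fin k → Fin m) :
    Continuous fun A : Matrix.unitaryGroup (Fin m) ℂ => perSq A.1 r c := by
  unfold perSq Matrix.permanent
  refine ((continuous_finsetSum _ fun σ _ => continuous_finsetProd _ fun l _ => ?_).norm).pow 2
  exact continuous_entry _ _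

/-- The permanent is ∏ s_j! times a sum of entry products over the rearrangements of `r`, of which
there are k!/∏ s_j!. One of the two factors ∏ s_j! in the square thus turns into k!. -/
theorem ofReal_integral_perSq {m k : ℕ} [NeZero m] (r c : Fin k → Fin m) :
    ((∫ A : Matrix.unitaryGroup (Fin m) ℂ, perSq A.1 r c ∂haarUnitary m : ℝ) : ℂ) =
      factProd r * (k.factorial * formMean c (Pi.single 0 1)) := by
  rw [← integral_complex_ofReal]
  simp_rw [perSq_eq_entryProd]
  rw [integral_const_mul, integral_finsetSum]
  · have h : ∀ f ∈ Finset.univ.filter (fun f : Fin k → Fin m => mult f = mult r),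
        ∫ A : Matrix.unitaryGroup (Fin m) ℂ,
          ∑ g ∈ Finset.univ.filter (fun g : Fin k → Fin m => mult g = mult r),
            entryProd c f A.1 * (starRingEnd ℂ) (entryProd c g A.1) ∂haarUnitary m =
        ∑ g ∈ Finset.univ.filter (fun g : Fin k → Fin m => mult g = mult r), entryCorr c f g := by
      intro f _
      rw [integral_finsetSum]
      · rfl
      · exact fun g _ => integrable_entryProd_mul c f g
    rw [Finset.sum_congr rfl h, sum_entryCorr_eq, ← card_mult_eq r]
    simp only [factProd]
    push_cast
    ring
  · exact fun f _ => integrable_finsetSum _ fun g _ => integrable_entryProd_mul c f g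

/-- The constant `K` is never computed directly: summed over all `r`, the squared permanents give k!
for each unitary matrix, and the weights ∏ s_j! add up to ∏ (m + i). -/
theorem integral_perSq {m k : ℕ} [NeZero m] (r : Fin k → Fin m) {c : Fin k → Fin m}
    (hc : Function.Injective c) :
    ∫ A : Matrix.unitaryGroup (Fin m) ℂ, perSq A.1 r c ∂haarUnitary m =
      k.factorial * (factProd r / ∏ i ∈ Finset.range k, ((m : ℝ) + i)) := by
  set K := formMean c (Pi.single 0 1) with hK
  have h1 : ∑ r : Fin k → Fin m,
      ∫ A : Matrix.unitaryGroup (Fin m) ℂ, perSq A.1 r c ∂haarUnitary m = k.factorial := by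
    rw [← integral_finsetSum]
    · simp_rw [fun A : Matrix.unitaryGroup (Fin m) ℂ => sum_perSq A.2 hc]
      simp
    · exact fun r _ => integrable_haar (continuous_perSq r c)
  have h2 := congrArg (fun y : ℝ => (y : ℂ)) h1
  simp only [Complex.ofReal_sum, ofReal_integral_perSq] at h2
  rw [← Finset.sum_mul, ← Nat.cast_sum, sum_factProd, ← hK] at h2
  have hk : (k.factorial : ℂ) ≠ 0 := by exact_mod_cast k.factorial_ne_zero
  have h3 : K = (∏ i ∈ Finset.range k, ((m : ℂ) + i))⁻¹ := by
    refine eq_inv_of_mul_eq_one_left ?_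
    refine mul_left_cancel₀ hk ?_
    push_cast at h2
    linear_combination h2
  have h4 := ofReal_integral_perSq r c
  rw [← hK, h3] at h4
  have h5 : ((∫ A : Matrix.unitaryGroup (Fin m) ℂ, perSq A.1 r c ∂haarUnitary m : ℝ) : ℂ) =
      ((k.factorial * (factProd r / ∏ i ∈ Finset.range k, ((m : ℝ) + i)) : ℝ) : ℂ) := by
    rw [h4]
    push_cast
    ring
  exact_mod_cast h5

theorem lintegral_perSq {m k : ℕ} [NeZero m] (r : Fin k → Fin m) {c : Fin k → Fin m}
    (hc : Function.Injective c) :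
    ∫⁻ A : Matrix.unitaryGroup (Fin m) ℂ, ENNReal.ofReal (perSq A.1 r c) ∂haarUnitary m =
      k.factorial * ENNReal.ofReal (factProd r / ∏ i ∈ Finset.range k, ((m : ℝ) + i)) := by
  rw [← ofReal_integral_eq_lintegral_ofReal (integrable_haar (continuous_perSq r c))
    (ae_of_all _ fun A => perSq_nonneg _ _ _), integral_perSq r hc,
    ENNReal.ofReal_mul (by positivity), ENNReal.ofReal_natCast]

end BosonSampling

end

noncomputable section

namespace BosonSampling

/-! ### The average time -/

/-- The average number of words of the Guan code in round `k`. -/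
def meanLength (m k : ℕ) : ℝ := ∏ i ∈ Finset.range k, ((2 * m + i : ℝ) / (m + i))

theorem meanLength_nonneg (m k : ℕ) : 0 ≤ meanLength m k :=
  Finset.prod_nonneg fun i _ => by positivity

theorem sum_round_cost {m j : ℕ} [NeZero m] :
    ∑ r : Fin j → Fin m, ENNReal.ofReal (factProd r / ∏ i ∈ Finset.range j, ((m : ℝ) + i)) *
      ((2000 * ((j + 1) * codeLength r + m * (j + 1)) : ℕ) : ℝ≥0∞) =
    ENNReal.ofReal (2000 * ((j + 1) * (meanLength m j + m))) := by
  have hm : (0 : ℝ) < m := by exact_mod_cast Nat.pos_of_ne_zero (NeZero.ne m)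
  have hW : (0 : ℝ) < ∏ i ∈ Finset.range j, ((m : ℝ) + i) :=
    Finset.prod_pos fun i _ => by positivity
  have h1 : ∀ r : Fin j → Fin m,
      ENNReal.ofReal (factProd r / ∏ i ∈ Finset.range j, ((m : ℝ) + i)) *
        ((2000 * ((j + 1) * codeLength r + m * (j + 1)) : ℕ) : ℝ≥0∞) =
      ENNReal.ofReal (factProd r / (∏ i ∈ Finset.range j, ((m : ℝ) + i)) *
        ((2000 * ((j + 1) * codeLength r + m * (j + 1)) : ℕ) : ℝ)) := by
    intro r
    rw [ENNReal.ofReal_mul (by positivity), ENNReal.ofReal_natCast]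
  simp_rw [h1]
  rw [← ENNReal.ofReal_sum_of_nonneg fun r _ => by positivity]
  congr 1
  have h2 : ∑ r : Fin j → Fin m, (factProd r : ℝ) = ∏ i ∈ Finset.range j, ((m : ℝ) + i) := by
    exact_mod_cast congrArg (Nat.cast : ℕ → ℝ) (sum_factProd m j)
  have h3 : ∑ r : Fin j → Fin m, (factProd r * codeLength r : ℝ) =
      ∏ i ∈ Finset.range j, (2 * (m : ℝ) + i) := by
    exact_mod_cast congrArg (Nat.cast : ℕ → ℝ) (sum_factProd_mul_codeLength m j)
  have h4 : ∀ r : Fin j → Fin m, factProd r / (∏ i ∈ Finset.range j, ((m : ℝ) + i)) *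
        ((2000 * ((j + 1) * codeLength r + m * (j + 1)) : ℕ) : ℝ) =
      2000 * (j + 1) / (∏ i ∈ Finset.range j, ((m : ℝ) + i)) * (factProd r * codeLength r) +
      2000 * (j + 1) * m / (∏ i ∈ Finset.range j, ((m : ℝ) + i)) * factProd r := by
    intro r
    push_cast
    ring
  simp_rw [h4]
  rw [Finset.sum_add_distrib, ← Finset.mul_sum, ← Finset.mul_sum, h2, h3, meanLength,
    Finset.prod_div_distrib]
  field_simp

/-- The Haar mean depends on the columns only through their being distinct, so all π contribute
equally and the factor n! cancels. -/
theorem averageTime_le {m n : ℕ} [NeZero m] (hnm : n ≤ m) :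
    averageTime m n ≤ ENNReal.ofReal (1000 * (n * n + m + 1) +
      ∑ j ∈ Finset.range n, 2000 * ((j + 1) * (meanLength m j + m))) := by
  have h1 : averageTime m n ≤ ∫⁻ A : Matrix.unitaryGroup (Fin m) ℂ,
      (((1000 * (n * n + m + 1) : ℕ) : ℝ≥0∞) +
      (n.factorial : ℝ≥0∞)⁻¹ * ∑ j : Fin n, ∑ π : Equiv.Perm (Fin n),
        ((j : ℕ).factorial : ℝ≥0∞)⁻¹ * ∑ r : Fin j → Fin m,
          ENNReal.ofReal (perSq A.1 r (Fin.castLE hnm ∘ π ∘ Fin.castLE j.2.le)) *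
            ((2000 * ((j + 1) * codeLength r + m * (j + 1)) : ℕ) : ℝ≥0∞)) ∂haarUnitary m :=
    lintegral_mono fun A => expectedTime_le hnm A.2
  refine h1.trans ?_
  have hmeas : ∀ (j : ℕ) (r c : Fin j → Fin m),
      Measurable fun A : Matrix.unitaryGroup (Fin m) ℂ => ENNReal.ofReal (perSq A.1 r c) :=
    fun j r c => ENNReal.measurable_ofReal.comp (continuous_perSq r c).measurable
  have hmeas2 : ∀ (j : Fin n) (π : Equiv.Perm (Fin n)),
      Measurable fun A : Matrix.unitaryGroup (Fin m) ℂ => ∑ r : Fin j → Fin m,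
        ENNReal.ofReal (perSq A.1 r (Fin.castLE hnm ∘ π ∘ Fin.castLE j.2.le)) *
          ((2000 * ((j + 1) * codeLength r + m * (j + 1)) : ℕ) : ℝ≥0∞) := fun j π =>
    Finset.measurable_fun_sum _ fun r _ => (hmeas _ _ _).mul_const _
  rw [lintegral_add_left measurable_const, lintegral_const, lintegral_const_mul _
      (Finset.measurable_fun_sum _ fun j _ =>
        Finset.measurable_fun_sum _ fun π _ => (hmeas2 j π).const_mul _),
    lintegral_finsetSum _ fun j _ =>
      Finset.measurable_fun_sum _ fun π _ => (hmeas2 j π).const_mul _]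
  have h2 : ∀ j : Fin n, ∫⁻ A : Matrix.unitaryGroup (Fin m) ℂ, ∑ π : Equiv.Perm (Fin n),
        ((j : ℕ).factorial : ℝ≥0∞)⁻¹ * ∑ r : Fin j → Fin m,
          ENNReal.ofReal (perSq A.1 r (Fin.castLE hnm ∘ π ∘ Fin.castLE j.2.le)) *
            ((2000 * ((j + 1) * codeLength r + m * (j + 1)) : ℕ) : ℝ≥0∞) ∂haarUnitary m =
      n.factorial * ENNReal.ofReal (2000 * ((j + 1) * (meanLength m j + m))) := by
    intro j
    rw [lintegral_finsetSum _ fun π _ => (hmeas2 j π).const_mul _]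
    have h3 : ∀ π : Equiv.Perm (Fin n), ∫⁻ A : Matrix.unitaryGroup (Fin m) ℂ,
        ((j : ℕ).factorial : ℝ≥0∞)⁻¹ * ∑ r : Fin j → Fin m,
          ENNReal.ofReal (perSq A.1 r (Fin.castLE hnm ∘ π ∘ Fin.castLE j.2.le)) *
            ((2000 * ((j + 1) * codeLength r + m * (j + 1)) : ℕ) : ℝ≥0∞) ∂haarUnitary m =
        ENNReal.ofReal (2000 * ((j + 1) * (meanLength m j + m))) := by
      intro π
      have hinj : Function.Injective (Fin.castLE hnm ∘ π ∘ Fin.castLE j.2.le) :=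
        (Fin.castLE_injective hnm).comp (π.injective.comp (Fin.castLE_injective j.2.le))
      rw [lintegral_const_mul _ (hmeas2 j π),
        lintegral_finsetSum _ fun r _ => (hmeas _ _ _).mul_const _, ← sum_round_cost,
        Finset.mul_sum]
      refine Finset.sum_congr rfl fun r _ => ?_
      rw [lintegral_mul_const _ (hmeas _ _ _), lintegral_perSq r hinj, ← mul_assoc, ← mul_assoc,
        ENNReal.inv_mul_cancel (by exact_mod_cast (j : ℕ).factorial_ne_zero)
          (ENNReal.natCast_ne_top _), one_mul]
    simp_rw [h3]
    simp [Fintype.card_perm]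
  simp_rw [h2]
  rw [← Finset.mul_sum, ← mul_assoc,
    ENNReal.inv_mul_cancel (by exact_mod_cast n.factorial_ne_zero) (ENNReal.natCast_ne_top _),
    one_mul, measure_univ, mul_one, ENNReal.ofReal_add (by positivity)
      (Finset.sum_nonneg fun j _ => by have := meanLength_nonneg m j; positivity),
    ENNReal.ofReal_sum_of_nonneg fun j _ => by have := meanLength_nonneg m j; positivity,
    Finset.sum_range]
  refine le_of_eq (congrArg₂ _ ?_ rfl)
  rw [← ENNReal.ofReal_natCast]
  push_cast
  rfl

/-- The ratio of successive terms is 1 + m/(m + k), so the increment is m/(m + k) times the term.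
This makes the sum over the rounds telescope. -/
theorem meanLength_succ_sub {m : ℕ} (hm : 0 < m) (k : ℕ) :
    meanLength m k = (m + k) / m * (meanLength m (k + 1) - meanLength m k) := by
  have hm' : (0 : ℝ) < m := by exact_mod_cast hm
  rw [meanLength, meanLength, Finset.prod_range_succ]
  field_simp
  ring

theorem meanLength_le_succ {m : ℕ} (hm : 0 < m) (k : ℕ) :
    meanLength m k ≤ meanLength m (k + 1) := by
  have hm' : (0 : ℝ) < m := by exact_mod_cast hm
  have h1 : (1 : ℝ) ≤ (2 * m + k) / (m + k) := by
    rw [le_div_iff₀ (by positivity)]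
    linarith
  have h2 : meanLength m (k + 1) = meanLength m k * ((2 * m + k) / (m + k)) := by
    rw [meanLength, Finset.prod_range_succ]
    rfl
  rw [h2]
  exact le_mul_of_one_le_right (meanLength_nonneg m k) h1

theorem sum_meanLength_le {m n : ℕ} (hm : 0 < m) :
    ∑ j ∈ Finset.range n, ((j : ℝ) + 1) * meanLength m j ≤
      n * (m + n) / m * meanLength m (n + 1) := by
  have hm' : (0 : ℝ) < m := by exact_mod_cast hm
  have h1 : ∀ j ∈ Finset.range n, ((j : ℝ) + 1) * meanLength m j ≤
      n * (m + n) / m * (meanLength m (j + 1) - meanLength m j) := by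
    intro j hj
    have hj' : ((j : ℝ) + 1) ≤ n := by exact_mod_cast Finset.mem_range.1 hj
    have h2 : 0 ≤ meanLength m (j + 1) - meanLength m j := sub_nonneg.2 (meanLength_le_succ hm j)
    -- Both occurrences of `meanLength m j` are expanded; reassociating protects the left one, so
    -- that the backward rewrite restores only the right one.
    rw [meanLength_succ_sub hm j, ← mul_assoc]
    rw [← meanLength_succ_sub hm j]
    refine mul_le_mul_of_nonneg_right ?_ h2
    rw [mul_div_assoc]
    refine mul_le_mul hj' ?_ (by positivity) (by positivity)
    gcongr
    exact (Finset.mem_range.1 hj).le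
  refine (Finset.sum_le_sum h1).trans ?_
  rw [← Finset.mul_sum, Finset.sum_range_sub (meanLength m)]
  refine mul_le_mul_of_nonneg_left ?_ (by positivity)
  have := meanLength_le_succ hm n
  have := meanLength_nonneg m 0
  linarith

theorem prod_range_add_eq (M k : ℕ) :
    ∏ i ∈ Finset.range (k + 1), (M + i) = (k + 1).factorial * (M + k).choose (k + 1) := by
  rw [← Nat.ascFactorial_eq_prod_range, Nat.ascFactorial_eq_factorial_mul_choose']
  rfl

theorem timeBound_eq {m n : ℕ} :
    timeBound m n = n * (m + n) / m * meanLength m (n + 1) + (n : ℝ) ^ 2 * m := by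
  unfold timeBound
  congr 1
  rw [mul_assoc]
  congr 1
  have h1 : ∏ i ∈ Finset.range (n + 1), ((m : ℝ) + i) =
      (n + 1).factorial * ((m + n).choose (n + 1) : ℝ) := by
    exact_mod_cast congrArg (Nat.cast : ℕ → ℝ) (prod_range_add_eq m n)
  have h2 : ∏ i ∈ Finset.range (n + 1), (2 * (m : ℝ) + i) =
      (n + 1).factorial * ((2 * m + n).choose (n + 1) : ℝ) := by
    exact_mod_cast congrArg (Nat.cast : ℕ → ℝ) (prod_range_add_eq (2 * m) n)
  have h3 : ((n + 1).factorial : ℝ) ≠ 0 := by positivity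
  rw [meanLength, Finset.prod_div_distrib, h1, h2, mul_div_mul_left _ _ h3, div_eq_inv_mul]

/-- Each of n², m and 1 is at most n² m, which accounts for 3000; the rounds account for the
remaining 2000. -/
theorem averageTime_le_timeBound {m n : ℕ} (hn : 1 ≤ n) (hnm : n ≤ m) :
    averageTime m n ≤ ENNReal.ofReal (5000 * timeBound m n) := by
  have : NeZero m := ⟨by omega⟩
  refine (averageTime_le hnm).trans (ENNReal.ofReal_le_ofReal ?_)
  have hn' : (1 : ℝ) ≤ n := by exact_mod_cast hn
  have hm' : (1 : ℝ) ≤ m := by exact_mod_cast hn.trans hnm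
  have h1 := sum_meanLength_le (m := m) (n := n) (by omega)
  have h2 : ∑ j ∈ Finset.range n, ((j : ℝ) + 1) * m ≤ (n : ℝ) ^ 2 * m := by
    have : ∀ j ∈ Finset.range n, ((j : ℝ) + 1) * m ≤ n * m := by
      intro j hj
      have hj' : ((j : ℝ) + 1) ≤ n := by exact_mod_cast Finset.mem_range.1 hj
      gcongr
    refine (Finset.sum_le_sum this).trans ?_
    rw [Finset.sum_const, Finset.card_range, nsmul_eq_mul]
    exact le_of_eq (by ring)
  have h3 : ∑ j ∈ Finset.range n, 2000 * (((j : ℝ) + 1) * (meanLength m j + m)) =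
      2000 * (∑ j ∈ Finset.range n, ((j : ℝ) + 1) * meanLength m j +
        ∑ j ∈ Finset.range n, ((j : ℝ) + 1) * m) := by
    rw [← Finset.sum_add_distrib, Finset.mul_sum]
    exact Finset.sum_congr rfl fun j _ => by ring
  rw [h3, timeBound_eq]
  have hn2 : (1 : ℝ) ≤ (n : ℝ) ^ 2 := one_le_pow₀ hn'
  have h4 : (n : ℝ) * n ≤ (n : ℝ) ^ 2 * m := by
    rw [← sq]
    exact le_mul_of_one_le_right (by positivity) hm'
  have h5 : (m : ℝ) ≤ (n : ℝ) ^ 2 * m := le_mul_of_one_le_left (by positivity) hn2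
  have h6 : 0 ≤ n * (m + n) / m * meanLength m (n + 1) :=
    mul_nonneg (by positivity) (meanLength_nonneg _ _)
  linarith

/-! ### The regime of a fixed ratio -/

theorem prod_range_add_mul_factorial (M k : ℕ) :
    (∏ i ∈ Finset.range (k + 1), (M + i)) * M.factorial = M * (M + k).factorial := by
  induction k with
  | zero => simp
  | succ k ih =>
    rw [Finset.prod_range_succ, mul_right_comm, ih, ← add_assoc M k 1, Nat.factorial_succ]
    ring

theorem meanLength_eq_factorial {m n : ℕ} (hm : 0 < m) :
    meanLength m (n + 1) * ((2 * m).factorial * (m + n).factorial) =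
      2 * ((2 * m + n).factorial * m.factorial) := by
  have hm' : (m : ℝ) ≠ 0 := by exact_mod_cast hm.ne'
  have h1 : (∏ i ∈ Finset.range (n + 1), ((m : ℝ) + i)) * m.factorial =
      m * (m + n).factorial := by
    exact_mod_cast congrArg (Nat.cast : ℕ → ℝ) (prod_range_add_mul_factorial m n)
  have h2 : (∏ i ∈ Finset.range (n + 1), (2 * (m : ℝ) + i)) * (2 * m).factorial =
      2 * m * (2 * m + n).factorial := by
    exact_mod_cast congrArg (Nat.cast : ℕ → ℝ) (prod_range_add_mul_factorial (2 * m) n)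
  have hW : (∏ i ∈ Finset.range (n + 1), ((m : ℝ) + i)) ≠ 0 :=
    Finset.prod_ne_zero_iff.2 fun i _ => by positivity
  rw [meanLength, Finset.prod_div_distrib, div_mul_eq_mul_div, div_eq_iff hW]
  refine mul_left_cancel₀ hm' ?_
  linear_combination ((m + n).factorial : ℝ) * m * h2 - 2 * ((2 * m + n).factorial : ℝ) * m * h1

/-- The leading term `√(2 N) (N / e) ^ N` of Stirling's formula. -/
def stirlingTerm (N : ℕ) : ℝ := √(2 * N) * (N / Real.exp 1) ^ N

/-- The Stirling sequence is antitone, hence at most its first value, and bounded below by a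
positive constant; its limit is irrelevant here. -/
theorem exists_stirling_bounds : ∃ α β : ℝ, 0 < α ∧ 0 < β ∧ ∀ N : ℕ, 1 ≤ N →
    α * stirlingTerm N ≤ N.factorial ∧ (N.factorial : ℝ) ≤ β * stirlingTerm N := by
  obtain ⟨α, hα, h⟩ := Stirling.stirlingSeq'_bounded_by_pos_constant
  refine ⟨α, Stirling.stirlingSeq 1, hα, Stirling.stirlingSeq'_pos 0, fun N hN => ?_⟩
  obtain ⟨k, rfl⟩ : ∃ k, N = k + 1 := ⟨N - 1, by omega⟩
  have hpos : 0 < stirlingTerm (k + 1) := by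
    unfold stirlingTerm
    positivity
  have hs : Stirling.stirlingSeq (k + 1) = (k + 1).factorial / stirlingTerm (k + 1) := rfl
  constructor
  · rw [← le_div_iff₀ hpos, ← hs]
    exact h k
  · rw [← div_le_iff₀ hpos, ← hs]
    exact Stirling.stirlingSeq'_antitone (Nat.zero_le k)

theorem growthRate_pos {θ : ℝ} (hθ : 1 ≤ θ) : 0 < growthRate θ := by
  unfold growthRate
  positivity

theorem log_growthRate {θ : ℝ} (hθ : 1 ≤ θ) : Real.log (growthRate θ) =
    (2 * θ + 1) * Real.log (2 * θ + 1) -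
      (θ * (2 * Real.log 2 + Real.log θ) + (θ + 1) * Real.log (θ + 1)) := by
  have h0 : 0 < θ := by linarith
  unfold growthRate
  rw [Real.log_div (by positivity) (by positivity), Real.log_mul (by positivity) (by positivity),
    Real.log_rpow (by positivity), Real.log_rpow (by positivity), Real.log_rpow (by positivity),
    Real.log_mul (by norm_num) h0.ne', show (4 : ℝ) = 2 ^ 2 by norm_num, Real.log_pow]
  push_cast
  ring

/-- The exponents on the two sides agree, (2m + n) + m = 2m + (m + n), so after taking logarithms
the powers of n and e cancel, leaving only θ. -/
theorem stirling_powers {θ : ℝ} (hθ : 1 ≤ θ) {m n : ℕ} (hn : 1 ≤ n) (hm : (m : ℝ) = θ * n) :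
    (((2 * m + n : ℕ) : ℝ) / Real.exp 1) ^ (2 * m + n) * ((m : ℝ) / Real.exp 1) ^ m =
      growthRate θ ^ n * ((((2 * m : ℕ) : ℝ) / Real.exp 1) ^ (2 * m) *
        (((m + n : ℕ) : ℝ) / Real.exp 1) ^ (m + n)) := by
  have h0 : 0 < θ := by linarith
  have hn' : (0 : ℝ) < n := by exact_mod_cast hn
  have hm' : (0 : ℝ) < m := by
    rw [hm]
    positivity
  have hlog : ∀ N : ℕ, 0 < (N : ℝ) →
      Real.log (((N : ℝ) / Real.exp 1) ^ N) = N * (Real.log N - 1) := by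
    intro N hN
    rw [Real.log_pow, Real.log_div hN.ne' (Real.exp_pos 1).ne', Real.log_exp]
  have p1 : (0 : ℝ) < ((2 * m + n : ℕ) : ℝ) := by
    push_cast
    positivity
  have p2 : (0 : ℝ) < ((2 * m : ℕ) : ℝ) := by
    push_cast
    positivity
  have p3 : (0 : ℝ) < ((m + n : ℕ) : ℝ) := by
    push_cast
    positivity
  have hρ := growthRate_pos hθ
  refine Real.log_injOn_pos (Set.mem_Ioi.2 (by positivity)) (Set.mem_Ioi.2 (by positivity)) ?_
  rw [Real.log_mul (by positivity) (by positivity), Real.log_mul (by positivity) (by positivity),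
    Real.log_mul (by positivity) (by positivity), hlog _ p1, hlog _ hm', hlog _ p2, hlog _ p3,
    Real.log_pow, log_growthRate hθ]
  have e1 : ((2 * m + n : ℕ) : ℝ) = (2 * θ + 1) * n := by
    push_cast
    rw [hm]
    ring
  have e2 : ((2 * m : ℕ) : ℝ) = 2 * (θ * n) := by
    push_cast
    rw [hm]
  have e3 : ((m + n : ℕ) : ℝ) = (θ + 1) * n := by
    push_cast
    rw [hm]
    ring
  rw [e1, e2, e3, hm, Real.log_mul (by positivity) hn'.ne', Real.log_mul (by positivity) hn'.ne',
    Real.log_mul (by norm_num) (by positivity), Real.log_mul h0.ne' hn'.ne',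
    Real.log_mul (by positivity) hn'.ne']
  ring

theorem exists_meanLength_bounds : ∃ a b : ℝ, 0 < a ∧ 0 < b ∧ ∀ θ : ℝ, 1 ≤ θ → ∀ m n : ℕ,
    1 ≤ n → (m : ℝ) = θ * n → a * growthRate θ ^ n ≤ meanLength m (n + 1) ∧
      meanLength m (n + 1) ≤ b * growthRate θ ^ n := by
  obtain ⟨α, β, hα, hβ, hS⟩ := exists_stirling_bounds
  refine ⟨α ^ 2 / β ^ 2, 2 * (β ^ 2 / α ^ 2), by positivity, by positivity, ?_⟩
  intro θ hθ m n hn hm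
  have hn' : (0 : ℝ) < n := by exact_mod_cast hn
  have hm' : (0 : ℝ) < m := by
    rw [hm]
    positivity
  have hm0 : 0 < m := by exact_mod_cast hm'
  have hρ : 0 < growthRate θ ^ n := pow_pos (growthRate_pos hθ) n
  obtain ⟨l1, u1⟩ := hS (2 * m + n) (by omega)
  obtain ⟨l2, u2⟩ := hS m (by omega)
  obtain ⟨l3, u3⟩ := hS (2 * m) (by omega)
  obtain ⟨l4, u4⟩ := hS (m + n) (by omega)
  set R₁ := √(2 * ((2 * m + n : ℕ) : ℝ)) * √(2 * (m : ℝ)) with hR₁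
  set R₂ := √(2 * ((2 * m : ℕ) : ℝ)) * √(2 * ((m + n : ℕ) : ℝ)) with hR₂
  have hR₁' : R₁ = √(4 * (m * (2 * m + n))) := by
    rw [hR₁, ← Real.sqrt_mul (by positivity)]
    congr 1
    push_cast
    ring
  have hR₂' : R₂ = √(8 * (m * (m + n))) := by
    rw [hR₂, ← Real.sqrt_mul (by positivity)]
    congr 1
    push_cast
    ring
  -- The squares are 8m² + 4mn and 8m² + 8mn, so the root factors of Stirling's formula agree up to
  -- a factor 2, uniformly in θ.
  have hR12 : R₁ ≤ R₂ := by
    rw [hR₁', hR₂']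
    refine Real.sqrt_le_sqrt ?_
    nlinarith [mul_pos hm' hn']
  have hR21 : R₂ ≤ 2 * R₁ := by
    rw [hR₂', Real.sqrt_le_left (by positivity), mul_pow, hR₁', Real.sq_sqrt (by positivity)]
    nlinarith [mul_pos hm' hn', mul_pos hm' hm']
  set E₂ := (((2 * m : ℕ) : ℝ) / Real.exp 1) ^ (2 * m) *
    (((m + n : ℕ) : ℝ) / Real.exp 1) ^ (m + n) with hE₂
  have hE₂0 : 0 < E₂ := by
    have p2 : (0 : ℝ) < ((2 * m : ℕ) : ℝ) := by
      push_cast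
      positivity
    have p3 : (0 : ℝ) < ((m + n : ℕ) : ℝ) := by
      push_cast
      positivity
    positivity
  have hT₁ : stirlingTerm (2 * m + n) * stirlingTerm m = R₁ * (growthRate θ ^ n * E₂) := by
    rw [hE₂, ← stirling_powers hθ hn hm, hR₁]
    unfold stirlingTerm
    ring
  have hT₂ : stirlingTerm (2 * m) * stirlingTerm (m + n) = R₂ * E₂ := by
    rw [hE₂, hR₂]
    unfold stirlingTerm
    ring
  have t0 : ∀ N, 0 ≤ stirlingTerm N := fun N => by
    unfold stirlingTerm
    positivity
  have hnum_le : ((2 * m + n).factorial * m.factorial : ℝ) ≤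
      β ^ 2 * (R₁ * (growthRate θ ^ n * E₂)) := by
    rw [← hT₁]
    calc ((2 * m + n).factorial * m.factorial : ℝ) ≤
        (β * stirlingTerm (2 * m + n)) * (β * stirlingTerm m) :=
          mul_le_mul u1 u2 (by positivity) (mul_nonneg hβ.le (t0 _))
      _ = _ := by ring
  have hnum_ge : α ^ 2 * (R₁ * (growthRate θ ^ n * E₂)) ≤
      ((2 * m + n).factorial * m.factorial : ℝ) := by
    rw [← hT₁]
    calc _ = (α * stirlingTerm (2 * m + n)) * (α * stirlingTerm m) := by ring
      _ ≤ _ := mul_le_mul l1 l2 (mul_nonneg hα.le (t0 _)) (by positivity)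
  have hden_le : ((2 * m).factorial * (m + n).factorial : ℝ) ≤ β ^ 2 * (R₂ * E₂) := by
    rw [← hT₂]
    calc ((2 * m).factorial * (m + n).factorial : ℝ) ≤
        (β * stirlingTerm (2 * m)) * (β * stirlingTerm (m + n)) :=
          mul_le_mul u3 u4 (by positivity) (mul_nonneg hβ.le (t0 _))
      _ = _ := by ring
  have hden_ge : α ^ 2 * (R₂ * E₂) ≤ ((2 * m).factorial * (m + n).factorial : ℝ) := by
    rw [← hT₂]
    calc _ = (α * stirlingTerm (2 * m)) * (α * stirlingTerm (m + n)) := by ring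
      _ ≤ _ := mul_le_mul l3 l4 (mul_nonneg hα.le (t0 _)) (by positivity)
  have hD : (0 : ℝ) < (2 * m).factorial * (m + n).factorial := by positivity
  have hmean := meanLength_eq_factorial (m := m) (n := n) hm0
  constructor
  · refine le_of_mul_le_mul_right ?_ hD
    rw [hmean]
    calc α ^ 2 / β ^ 2 * growthRate θ ^ n * ((2 * m).factorial * (m + n).factorial)
        ≤ α ^ 2 / β ^ 2 * growthRate θ ^ n * (β ^ 2 * (R₂ * E₂)) :=
          mul_le_mul_of_nonneg_left hden_le (by positivity)
      _ = α ^ 2 * growthRate θ ^ n * E₂ * R₂ := by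
        field_simp
      _ ≤ α ^ 2 * growthRate θ ^ n * E₂ * (2 * R₁) :=
        mul_le_mul_of_nonneg_left hR21 (by positivity)
      _ = 2 * (α ^ 2 * (R₁ * (growthRate θ ^ n * E₂))) := by ring
      _ ≤ _ := mul_le_mul_of_nonneg_left hnum_ge (by norm_num)
  · refine le_of_mul_le_mul_right ?_ hD
    rw [hmean]
    calc 2 * (((2 * m + n).factorial : ℝ) * m.factorial)
        ≤ 2 * (β ^ 2 * (R₁ * (growthRate θ ^ n * E₂))) :=
          mul_le_mul_of_nonneg_left hnum_le (by norm_num)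
      _ = 2 * β ^ 2 * growthRate θ ^ n * E₂ * R₁ := by ring
      _ ≤ 2 * β ^ 2 * growthRate θ ^ n * E₂ * R₂ :=
        mul_le_mul_of_nonneg_left hR12 (by positivity)
      _ = 2 * (β ^ 2 / α ^ 2) * growthRate θ ^ n * (α ^ 2 * (R₂ * E₂)) := by
        field_simp
      _ ≤ _ := mul_le_mul_of_nonneg_left hden_ge (by positivity)

theorem sq_le_pow_three_halves (n : ℕ) : (n : ℝ) ^ 2 ≤ 4 * (3 / 2) ^ n := by
  rcases le_total n 5 with h | h
  -- The induction starts at 5, the first positive n with (n + 1)² ≤ (3/2) n².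
  · interval_cases n <;> norm_num
  · induction n, h using Nat.le_induction with
    | base => norm_num
    | succ n hn ih =>
      have hn' : (5 : ℝ) ≤ n := by exact_mod_cast hn
      rw [pow_succ (3 / 2 : ℝ) n]
      push_cast
      nlinarith

/-- For i ≤ m each factor 1 + m/(m + i) is at least 3/2. This exponential growth absorbs the
polynomial term n² m of the bound. -/
theorem pow_le_meanLength {m n : ℕ} (hm : 0 < m) (hnm : n ≤ m) :
    (3 / 2 : ℝ) ^ n ≤ meanLength m (n + 1) := by
  have hm' : (0 : ℝ) < m := by exact_mod_cast hm
  refine le_trans ?_ (meanLength_le_succ hm n)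
  unfold meanLength
  rw [← Finset.card_range n, ← Finset.prod_const, Finset.card_range]
  refine Finset.prod_le_prod (fun _ _ => by norm_num) fun i hi => ?_
  have hi' : (i : ℝ) ≤ m := by exact_mod_cast (Finset.mem_range.1 hi).le.trans hnm
  rw [div_le_div_iff₀ (by norm_num) (by positivity)]
  linarith

theorem exists_timeBound_bounds {θ : ℝ} (hθ : 1 ≤ θ) : ∃ c C : ℝ, 0 < c ∧ 0 < C ∧ ∀ m n : ℕ,
    1 ≤ n → (m : ℝ) = θ * n → c * (n * growthRate θ ^ n) ≤ timeBound m n ∧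
      timeBound m n ≤ C * (n * growthRate θ ^ n) := by
  obtain ⟨a, b, ha, hb, h⟩ := exists_meanLength_bounds
  -- The part 2b uses (m + n)/m ≤ 2; the part 4θb comes from n² ≤ 4 (3/2)^n and m = θn.
  refine ⟨a, 2 * b + 4 * θ * b, ha, by positivity, ?_⟩
  intro m n hn hm
  obtain ⟨h1, h2⟩ := h θ hθ m n hn hm
  have hn' : (0 : ℝ) < n := by exact_mod_cast hn
  have hnm' : (n : ℝ) ≤ m := by
    rw [hm]
    exact le_mul_of_one_le_left hn'.le hθ
  have hnm : n ≤ m := by exact_mod_cast hnm'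
  have hm0 : 0 < m := by omega
  have hm' : (0 : ℝ) < m := by exact_mod_cast hm0
  have hL := meanLength_nonneg m (n + 1)
  have hρ : 0 < growthRate θ ^ n := pow_pos (growthRate_pos hθ) n
  rw [timeBound_eq]
  have h3 : (n : ℝ) ≤ n * (m + n) / m := by
    rw [le_div_iff₀ hm']
    nlinarith
  have h4 : (n : ℝ) * (m + n) / m ≤ 2 * n := by
    rw [div_le_iff₀ hm']
    nlinarith
  constructor
  · calc a * (n * growthRate θ ^ n) = n * (a * growthRate θ ^ n) := by ring
      _ ≤ n * (m + n) / m * meanLength m (n + 1) :=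
        mul_le_mul h3 h1 (by positivity) (by positivity)
      _ ≤ _ := le_add_of_nonneg_right (by positivity)
  · have h5 : n * (m + n) / m * meanLength m (n + 1) ≤ 2 * n * (b * growthRate θ ^ n) :=
      mul_le_mul h4 h2 hL (by positivity)
    have h6 : (n : ℝ) ^ 2 ≤ 4 * (b * growthRate θ ^ n) :=
      (sq_le_pow_three_halves n).trans
        (mul_le_mul_of_nonneg_left ((pow_le_meanLength hm0 hnm).trans h2) (by norm_num))
    have h7 : (n : ℝ) ^ 2 * m ≤ 4 * (b * growthRate θ ^ n) * m :=
      mul_le_mul_of_nonneg_right h6 hm'.le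
    rw [hm] at h7
    rw [hm] at h5 ⊢
    calc _ ≤ 2 * n * (b * growthRate θ ^ n) + 4 * (b * growthRate θ ^ n) * (θ * n) :=
          add_le_add h5 h7
      _ = _ := by ring

end BosonSampling

end

/-! ### The sampling law, the average time and the regime of a fixed ratio. -/

theorem theorem1p1 :
    -- for every unitary input the algorithm samples exactly from the boson sampling distribution
    (∀ (m n : ℕ) (_ : 1 ≤ n) (hnm : n ≤ m) (A : Matrix.unitaryGroup (Fin m) ℂ),
      (∀ z : Fin n → Fin m, Monotone z →
        BosonSampling.outputLaw n A.1 (fun i => (z i : ℕ)) = ENNReal.ofReal (BosonSampling.bosonPMF hnm A.1 z)) ∧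
      (∀ y ∈ (BosonSampling.outputLaw n A.1).support,
        ∃ z : Fin n → Fin m, Monotone z ∧ y = fun i => (z i : ℕ))) ∧
    -- its average-case time complexity
    (∀ m n : ℕ, 1 ≤ n → n ≤ m →
      Measurable fun A : Matrix.unitaryGroup (Fin m) ℂ => BosonSampling.expectedTime n A.1) ∧
    (∃ C : ℝ, ∀ m n : ℕ, 1 ≤ n → n ≤ m →
      BosonSampling.averageTime m n ≤ ENNReal.ofReal (C * BosonSampling.timeBound m n)) ∧
    -- the regime `m = θ n`
    (∀ θ : ℝ, 1 ≤ θ → ∃ c C : ℝ, 0 < c ∧ ∀ m n : ℕ, 1 ≤ n → (m : ℝ) = θ * n →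
      c * (n * BosonSampling.growthRate θ ^ n) ≤ BosonSampling.timeBound m n ∧
      BosonSampling.timeBound m n ≤ C * (n * BosonSampling.growthRate θ ^ n) ∧
      BosonSampling.averageTime m n ≤ ENNReal.ofReal (C * (n * BosonSampling.growthRate θ ^ n))) := by
  refine ⟨?_, fun m n _ _ => BosonSampling.measurable_expectedTime m n,
    ⟨5000, fun m n hn hnm => BosonSampling.averageTime_le_timeBound hn hnm⟩, ?_⟩
  · intro m n hn hnm A
    have : NeZero m := ⟨by omega⟩
    exact ⟨fun z hz => BosonSampling.outputLaw_apply hnm A.2 hz,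
      fun y hy => BosonSampling.exists_monotone_of_mem_support hnm A.1 hy⟩
  · intro θ hθ
    obtain ⟨c, C, hc, hC, h⟩ := BosonSampling.exists_timeBound_bounds hθ
    -- A single upper constant serves both `timeBound` and `averageTime`, hence the factor 5000 in
    -- both.
    refine ⟨c, 5000 * C, hc, fun m n hn hm => ?_⟩
    obtain ⟨h1, h2⟩ := h m n hn hm
    have hn' : (0 : ℝ) < n := by exact_mod_cast hn
    have hnm : n ≤ m := by
      have : (n : ℝ) ≤ m := by
        rw [hm]
        exact le_mul_of_one_le_left hn'.le hθ
      exact_mod_cast this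
    have hX : 0 < (n : ℝ) * BosonSampling.growthRate θ ^ n :=
      mul_pos hn' (pow_pos (BosonSampling.growthRate_pos hθ) n)
    refine ⟨h1, h2.trans ?_, (BosonSampling.averageTime_le_timeBound hn hnm).trans
      (ENNReal.ofReal_le_ofReal ?_)⟩
    · nlinarith [mul_pos hC hX]
    · rw [mul_assoc]
      exact mul_le_mul_of_nonneg_left h2 (by norm_num)
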